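/- Let $n\ge 2$, $s\in\mathbb R$ and $t>-n/2$. **Notation.** Let $T\mathbb S^{n-1}=\{(x,\xi)\in\mathbb R^n\times\mathbb R^n: |\xi|=1,\ \langle x,\xi\rangle=0\}$, let $\mathcal S(T\mathbb S^{n-1})$ be the space of smooth complex functions on $T\mathbb S^{n-1}$ all of whose derivatives decrease, uniformly in $\xi$, faster than any power of $|x|$, and let $\mathcal S(\mathbb R^n;S^2\mathbb R^n)$ be the space of Schwartz fields $f=(f_{ij})$ of complex symmetric $2$-tensors. For $k=0,1,2,\dots$ put $$(I^kf)(x,\xi)=\int_{-\infty}^{\infty}\tau^k\sum_{i,j}f_{ij}(x+\tau\xi)\,\xi_i\xi_j\,d\tau,\qquad (x,\xi)\in T\mathbb S^{n-1}.$$ Let $\widehat g(y)=(2\pi)^{-n/2}\int_{\mathbb R^n} e^{-i\langle y,x\rangle}g(x)\,dx$ on $\mathbb R^n$ and $\widehat\varphi(y,\xi)=(2\pi)^{-(n-1)/2}\int_{\xi^\perp}e^{-i\langle y,x\rangle}\varphi(x,\xi)\,dx$ on $T\mathbb S^{n-1}$. Put $$\|f\|^2_{H^s_t(\mathbb R^n;S^2\mathbb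 R^n)}=\sum_{i,j}\int_{\mathbb R^n}|y|^{2t}(1+|y|^2)^{s-t}|\widehat f_{ij}(y)|^2\,dy,$$ and let the Hilbert space $H^s_t(\mathbb R^n;S^2\mathbb R^n)$ be the completion of $\mathcal S(\mathbb R^n;S^2\mathbb R^n)$ in this norm. For functions on $T\mathbb S^{n-1}$ and real $\sigma,\tau$ put $$(\varphi,\psi)_{H^{\sigma}_{\tau}}=\frac1{2\pi}\int_{\mathbb S^{n-1}}\int_{\xi^\perp}|y|^{2\tau}(1+|y|^2)^{\sigma-\tau}\,\widehat\varphi\,\overline{\widehat\psi}\;dy\,d\xi,\qquad \|\varphi\|^2_{H^\sigma_\tau}=(\varphi,\varphi)_{H^\sigma_\tau}.$$ Let $X_i$, $\Xi_i$ $(1\le i\le n)$ be the restrictions to $T\mathbb S^{n-1}$ of the vector fields $$\frac{\partial}{\partial x^i}-\xi_i\sum_p\xi_p\frac{\partial}{\partial x^p},\qquad \frac{\partial}{\partial\xi^i}-x_i\sum_p\xi_p\frac{\partial}{\partial x^p}-\xi_i\sum_p\xi_p\frac{\partial}{\partial\xi^p},$$ which are tangent to $T\mathbb S^{n-1}$,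 and define operators $Z,Q,W$ by $$|y|\,\widehat{Z\varphi}=\sum_i y_i\,\Xi_i\widehat\varphi,\qquad |y|^2\,\widehat{Q\varphi}=\sum_{i,j}y_iy_j\,\Xi_i\Xi_j\widehat\varphi,\qquad |y|\,\widehat{W\varphi}=\sum_i y_i\,X_i\widehat\varphi.$$ With $a_n=\Gamma\big(\tfrac{n-1}2\big)\big/\big(2\pi^{(n-1)/2}\big)$, put for $\varphi,\psi,\chi\in\mathcal S(T\mathbb S^{n-1})$ $$\begin{aligned} \|(\varphi,\psi,\chi)\|^2_{\mathcal H^{2,s}_t}=\frac{a_n}{4}\Big[&\|\chi\|^2_{H^{s+5/2}_{t+5/2}}+4\,\Im(\chi,Z\psi)_{H^{s+2}_{t+2}}+2\sum_i\|\Xi_i\psi\|^2_{H^{s+3/2}_{t+3/2}}+2\|\psi\|^2_{H^{s+3/2}_{t+3/2}}+2\|Z\psi\|^2_{H^{s+3/2}_{t+3/2}}\\ &+2\,\Re(\chi,W\varphi)_{H^{s+2}_{t+2}}-4\,\Re(\chi,\varphi)_{H^{s+3/2}_{t+3/2}}-2\,\Re(\chi,Q\varphi)_{H^{s+3/2}_{t+3/2}}-4\sum_i\Re(\Xi_i\psi,x_i\varphi)_{H^{s+3/2}_{t+3/2}}\\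 &+8\,\Im(Z\psi,\varphi)_{H^{s+1}_{t+1}}+4\,\Im(\psi,Z\varphi)_{H^{s+1}_{t+1}}+4\sum_i\Im(\Xi_i\psi,Z\Xi_i\varphi)_{H^{s+1}_{t+1}}+\sum_i\|x_i\varphi\|^2_{H^{s+3/2}_{t+3/2}}\\ &-2\sum_i\Im(x_i\varphi,Z\Xi_i\varphi)_{H^{s+1}_{t+1}}-4\,\Re(W\varphi,\varphi)_{H^{s+1}_{t+1}}+\sum_{i,j}\|\Xi_i\Xi_j\varphi\|^2_{H^{s+1/2}_{t+1/2}}\\ &+4\sum_i\Re(\Xi_i\Xi_i\varphi,\varphi)_{H^{s+1/2}_{t+1/2}}+\sum_i\|\Xi_i\varphi\|^2_{H^{s+1/2}_{t+1/2}}+4n\|\varphi\|^2_{H^{s+1/2}_{t+1/2}}\Big]. \end{aligned}$$ **Claim.** The right-hand side of the last formula is positive unless $(\varphi,\psi,\chi)=(0,0,0)$, and it is the square of the norm of an inner product on $\mathcal S(T\mathbb S^{n-1})\oplus\mathcal S(T\mathbb S^{n-1})\oplus\mathcal S(T\mathbb S^{n-1})$; let the Hilbert space $\mathcal H^{2,s}_t(T\mathbb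 S^{n-1})$ be the completion in this norm. The functions $I^kf$ belong to $\mathcal S(T\mathbb S^{n-1})$ for $f\in\mathcal S(\mathbb R^n;S^2\mathbb R^n)$, and the map $$\mathcal S(\mathbb R^n;S^2\mathbb R^n)\to\mathcal S(T\mathbb S^{n-1})\oplus\mathcal S(T\mathbb S^{n-1})\oplus\mathcal S(T\mathbb S^{n-1}),\qquad f\mapsto(I^0f,I^1f,I^2f)$$ extends (uniquely) to a linear isometric embedding $$H^s_t(\mathbb R^n;S^2\mathbb R^n)\to\mathcal H^{2,s}_t(T\mathbb S^{n-1}).$$ In other words, $\|f\|_{H^s_t(\mathbb R^n;S^2\mathbb R^n)}=\|(I^0f,I^1f,I^2f)\|_{\mathcal H^{2,s}_t(T\mathbb S^{n-1})}$ for all $f\in H^s_t(\mathbb R^n;S^2\mathbb R^n)$. -/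

import Mathlib

open scoped ContDiff SchwartzMap ComplexConjugate

noncomputable section

namespace MomentumRay

/-- Euclidean space `ℝⁿ`. -/
abbrev E (n : ℕ) : Type := EuclideanSpace ℝ (Fin n)

/-- `S²ℝⁿ`: the complex vector space of symmetric tensors `(u_{ij})` of rank two on `ℝⁿ`. -/
def SymTensor (n : ℕ) : Submodule ℂ (EuclideanSpace ℂ (Fin n × Fin n)) where
  carrier := {u | ∀ i j, u (i, j) = u (j, i)}
  zero_mem' := by intro i j; simp
  add_mem' := by
    intro u v hu hv i j
    simp [hu i j, hv i j]
  smul_mem' := by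
    intro c u hu i j
    simp [hu i j]

/-- `𝓢(ℝⁿ; S²ℝⁿ)`: smooth rapidly decaying symmetric tensor fields of rank two. -/
abbrev TensorField (n : ℕ) : Type := 𝓢(E n, SymTensor n)

/-- The coordinate `f_{ij}` of a tensor field. -/
def comp {n : ℕ} (f : TensorField n) (i j : Fin n) (x : E n) : ℂ :=
  (f x : EuclideanSpace ℂ (Fin n × Fin n)) (i, j)

/-- `T𝕊ⁿ⁻¹`: the pairs `(x, ξ)` with `|ξ| = 1` and `⟨x, ξ⟩ = 0`. -/
abbrev TSphere (n : ℕ) : Type := {p : E n × E n // ‖p.2‖ = 1 ∧ inner ℝ p.2 p.1 = 0}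

/-- The momentum ray transform
`(I^k f)(x, ξ) = ∫ t^k ∑ f_{ij}(x + tξ) ξ^i ξ^j dt`. -/
def rayTransform {n : ℕ} (k : ℕ) (f : TensorField n) (p : TSphere n) : ℂ :=
  ∫ t : ℝ, (t : ℂ) ^ k *
    ∑ i, ∑ j, comp f i j (p.1.1 + t • p.1.2) * (p.1.2 i : ℂ) * (p.1.2 j : ℂ)

/-- The smooth retraction
`(x, ξ) ↦ (x - ⟨ξ, x⟩ ξ / |ξ|², ξ / |ξ|)` of `ℝⁿ × (ℝⁿ \ {0})` onto `T𝕊ⁿ⁻¹`. -/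
def retract {n : ℕ} (p : E n × E n) (h : p.2 ≠ 0) : TSphere n :=
  ⟨(p.1 - (inner ℝ p.2 p.1 / ‖p.2‖ ^ 2) • p.2, ‖p.2‖⁻¹ • p.2), by
    have h' : ‖p.2‖ ≠ 0 := norm_ne_zero_iff.mpr h
    constructor
    · simp [norm_smul, h']
    · simp only [inner_smul_left, inner_sub_right, inner_smul_right, real_inner_self_eq_norm_sq]
      field_simp
      simp⟩

open Classical in
/-- The extension of a function on `T𝕊ⁿ⁻¹` to `ℝⁿ × (ℝⁿ \ {0})` through the retraction
(the value `0` at `ξ = 0` is never used). -/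
def extend {n : ℕ} (φ : TSphere n → ℂ) (p : E n × E n) : ℂ :=
  if h : p.2 ≠ 0 then φ (retract p h) else 0

theorem extend_add {n : ℕ} (φ ψ : TSphere n → ℂ) :
    extend (φ + ψ) = extend φ + extend ψ := by
  funext p
  by_cases h : p.2 = 0 <;> simp [extend, h]

theorem extend_smul {n : ℕ} (c : ℂ) (φ : TSphere n → ℂ) :
    extend (c • φ) = c • extend φ := by
  funext p
  by_cases h : p.2 = 0 <;> simp [extend, h]

theorem extend_zero {n : ℕ} : extend (0 : TSphere n → ℂ) = 0 := by
  funext p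
  simp [extend]

/-- The open set `ℝⁿ × (ℝⁿ \ {0})`. -/
def slit (n : ℕ) : Set (E n × E n) := {p | p.2 ≠ 0}

theorem isOpen_slit (n : ℕ) : IsOpen (slit n) :=
  isOpen_ne.preimage continuous_snd

theorem mem_slit {n : ℕ} (p : TSphere n) : p.1 ∈ slit n := by
  intro h
  have := p.2.1
  rw [h] at this
  simp at this

/-- The Schwartz space `𝓢(T𝕊ⁿ⁻¹)`: the smooth functions on `T𝕊ⁿ⁻¹` all of whose derivatives
decrease, uniformly in `ξ`, faster than any power of `|x|`. Derivatives are those of the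
extension through the retraction, taken at points of `T𝕊ⁿ⁻¹`. -/
def SchwartzTS (n : ℕ) : Submodule ℂ (TSphere n → ℂ) where
  carrier := {φ | ContDiffOn ℝ ∞ (extend φ) (slit n) ∧
    ∀ k l : ℕ, ∃ C : ℝ, ∀ p : TSphere n,
      ‖p.1.1‖ ^ k * ‖iteratedFDeriv ℝ l (extend φ) p.1‖ ≤ C}
  zero_mem' := by
    rw [Set.mem_ofPred_eq, extend_zero]
    refine ⟨contDiffOn_const, fun k l => ⟨0, fun p => ?_⟩⟩
    have : iteratedFDeriv ℝ l (0 : E n × E n → ℂ) = 0 := iteratedFDeriv_fun_zero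
    simp [this]
  add_mem' := by
    rintro φ ψ ⟨hφ, hφ'⟩ ⟨hψ, hψ'⟩
    rw [Set.mem_ofPred_eq, extend_add]
    refine ⟨hφ.add hψ, fun k l => ?_⟩
    obtain ⟨A, hA⟩ := hφ' k l
    obtain ⟨B, hB⟩ := hψ' k l
    refine ⟨A + B, fun p => ?_⟩
    have h1 : ContDiffAt ℝ l (extend φ) p.1 :=
      ((hφ.contDiffAt ((isOpen_slit n).mem_nhds (mem_slit p)))).of_le
        (by exact_mod_cast le_top)
    have h2 : ContDiffAt ℝ l (extend ψ) p.1 :=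
      ((hψ.contDiffAt ((isOpen_slit n).mem_nhds (mem_slit p)))).of_le
        (by exact_mod_cast le_top)
    rw [iteratedFDeriv_add_apply h1 h2]
    calc _ ≤ ‖p.1.1‖ ^ k * (‖iteratedFDeriv ℝ l (extend φ) p.1‖
            + ‖iteratedFDeriv ℝ l (extend ψ) p.1‖) := by
          gcongr; exact norm_add_le _ _
      _ ≤ A + B := by rw [mul_add]; exact add_le_add (hA p) (hB p)
  smul_mem' := by
    rintro c φ ⟨hφ, hφ'⟩
    rw [Set.mem_ofPred_eq, extend_smul]
    refine ⟨hφ.const_smul c, fun k l => ?_⟩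
    obtain ⟨A, hA⟩ := hφ' k l
    refine ⟨‖c‖ * A, fun p => ?_⟩
    have h1 : ContDiffAt ℝ l (extend φ) p.1 :=
      ((hφ.contDiffAt ((isOpen_slit n).mem_nhds (mem_slit p)))).of_le
        (by exact_mod_cast le_top)
    rw [iteratedFDeriv_const_smul_apply h1, norm_smul]
    calc _ = ‖c‖ * (‖p.1.1‖ ^ k * ‖iteratedFDeriv ℝ l (extend φ) p.1‖) := by ring
      _ ≤ ‖c‖ * A := by gcongr; exact hA p

/-- The operator `X_i`: differentiation along the vector field
`∂/∂x^i - ξ_i ξ^p ∂/∂x^p`, which is tangent to `T𝕊ⁿ⁻¹`. -/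
def opX {n : ℕ} (i : Fin n) (φ : TSphere n → ℂ) (p : TSphere n) : ℂ :=
  fderiv ℝ (extend φ) p.1 (EuclideanSpace.single i 1 - p.1.2 i • p.1.2, 0)

/-- The operator `Ξ_i`: differentiation along the vector field
`∂/∂ξ^i - x_i ξ^p ∂/∂x^p - ξ_i ξ^p ∂/∂ξ^p`, which is tangent to `T𝕊ⁿ⁻¹`. -/
def opXi {n : ℕ} (i : Fin n) (φ : TSphere n → ℂ) (p : TSphere n) : ℂ :=
  fderiv ℝ (extend φ) p.1
    (-(p.1.1 i • p.1.2), EuclideanSpace.single i 1 - p.1.2 i • p.1.2)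

/-- Multiplication by the coordinate `x_i` on `T𝕊ⁿ⁻¹`. -/
def mulX {n : ℕ} (i : Fin n) (φ : TSphere n → ℂ) (p : TSphere n) : ℂ :=
  (p.1.1 i : ℂ) * φ p

/-- The hyperplane `ξ^⊥`, with the Lebesgue measure of its Euclidean structure as `volume`. -/
abbrev hyperplane {n : ℕ} (ξ : E n) : Submodule ℝ (E n) := (ℝ ∙ ξ)ᗮ

/-- The point `(x, ξ)` of `T𝕊ⁿ⁻¹`, for `|ξ| = 1` and `x ∈ ξ^⊥`. -/
def tsPoint {n : ℕ} (ξ : E n) (hξ : ‖ξ‖ = 1) (x : hyperplane ξ) : TSphere n :=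
  ⟨((x : E n), ξ), hξ, Submodule.mem_orthogonal_singleton_iff_inner_right.mp x.2⟩

/-- The Fourier transform on `T𝕊ⁿ⁻¹`:
`φ̂(y, ξ) = (2π)^{-(n-1)/2} ∫_{ξ^⊥} e^{-i⟨y, x⟩} φ(x, ξ) dx`. -/
def hatTS {n : ℕ} (φ : TSphere n → ℂ) (p : TSphere n) : ℂ :=
  (((2 * Real.pi) ^ (-(((n : ℝ) - 1) / 2)) : ℝ) : ℂ) *
    ∫ x : hyperplane p.1.2,
      Complex.exp (-Complex.I * ((inner ℝ p.1.1 (x : E n) : ℝ) : ℂ)) *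
        φ (tsPoint p.1.2 p.2.1 x)

/-- The Fourier transform on `ℝⁿ`: `ĝ(y) = (2π)^{-n/2} ∫ e^{-i⟨y, x⟩} g(x) dx`. -/
def hatRn {n : ℕ} (g : E n → ℂ) (y : E n) : ℂ :=
  (((2 * Real.pi) ^ (-((n : ℝ) / 2)) : ℝ) : ℂ) *
    ∫ x : E n, Complex.exp (-Complex.I * ((inner ℝ y x : ℝ) : ℂ)) * g x

/-- The weight `r^{2t} (1 + r²)^{s-t}`. -/
def weight (s t r : ℝ) : ℝ := r ^ (2 * t) * (1 + r ^ 2) ^ (s - t)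

/-- `‖f‖²` in `H^s_t(ℝⁿ; S²ℝⁿ)`, for a Schwartz tensor field `f`:
`∑_{ij} ∫ |y|^{2t} (1 + |y|²)^{s-t} |f̂_{ij}(y)|² dy`. -/
def tensorNormSq {n : ℕ} (s t : ℝ) (f : TensorField n) : ℝ :=
  ∑ i, ∑ j, ∫ y : E n, weight s t ‖y‖ * ‖hatRn (comp f i j) y‖ ^ 2

/-- The inner product of `H^s_t(T𝕊ⁿ⁻¹)`, written in terms of the Fourier transforms
`u = φ̂`, `v = ψ̂`:
`(φ, ψ) = (2π)⁻¹ ∫_{𝕊ⁿ⁻¹} ∫_{ξ^⊥} |y|^{2t} (1 + |y|²)^{s-t} u(y, ξ) conj v(y, ξ) dy dξ`. -/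
def innerH {n : ℕ} (s t : ℝ) (u v : TSphere n → ℂ) : ℂ :=
  ((1 / (2 * Real.pi) : ℝ) : ℂ) *
    ∫ ξ : Metric.sphere (0 : E n) 1,
      (∫ y : hyperplane (ξ : E n),
        (weight s t ‖y‖ : ℂ) *
          (u (tsPoint ξ (mem_sphere_zero_iff_norm.mp ξ.2) y) *
            conj (v (tsPoint ξ (mem_sphere_zero_iff_norm.mp ξ.2) y))))
      ∂(MeasureTheory.volume : MeasureTheory.Measure (E n)).toSphere

/-- The square of the norm of `H^s_t(T𝕊ⁿ⁻¹)`, in terms of the Fourier transform `u = φ̂`. -/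
def normSqH {n : ℕ} (s t : ℝ) (u : TSphere n → ℂ) : ℝ :=
  1 / (2 * Real.pi) *
    ∫ ξ : Metric.sphere (0 : E n) 1,
      (∫ y : hyperplane (ξ : E n),
        weight s t ‖y‖ * ‖u (tsPoint ξ (mem_sphere_zero_iff_norm.mp ξ.2) y)‖ ^ 2)
      ∂(MeasureTheory.volume : MeasureTheory.Measure (E n)).toSphere

/-- The Fourier transform of `Zφ`: `|y|⁻¹ y^i (Ξ_i φ̂)(y, ξ)`. -/
def hatZ {n : ℕ} (φ : TSphere n → ℂ) (p : TSphere n) : ℂ :=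
  (∑ i, (p.1.1 i : ℂ) * opXi i (hatTS φ) p) / (‖p.1.1‖ : ℂ)

/-- The Fourier transform of `Qφ`: `|y|⁻² y^i y^j (Ξ_i Ξ_j φ̂)(y, ξ)`. -/
def hatQ {n : ℕ} (φ : TSphere n → ℂ) (p : TSphere n) : ℂ :=
  (∑ i, ∑ j, (p.1.1 i : ℂ) * (p.1.1 j : ℂ) * opXi i (opXi j (hatTS φ)) p) / (‖p.1.1‖ : ℂ) ^ 2

/-- The Fourier transform of `Wφ`: `|y|⁻¹ y^i (X_i φ̂)(y, ξ)`. -/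
def hatW {n : ℕ} (φ : TSphere n → ℂ) (p : TSphere n) : ℂ :=
  (∑ i, (p.1.1 i : ℂ) * opX i (hatTS φ) p) / (‖p.1.1‖ : ℂ)

/-- The constant `a_n = Γ((n-1)/2) / (2 π^{(n-1)/2})`. -/
def aConst (n : ℕ) : ℝ :=
  Real.Gamma (((n : ℝ) - 1) / 2) / (2 * Real.pi ^ (((n : ℝ) - 1) / 2))

/-- The expression `‖(φ, ψ, χ)‖²` that defines the norm of `ℋ^{2,s}_t(T𝕊ⁿ⁻¹)`. -/
def tripleNormSq {n : ℕ} (s t : ℝ) (φ ψ χ : TSphere n → ℂ) : ℝ :=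
  aConst n / 4 *
    (normSqH (s + 5 / 2) (t + 5 / 2) (hatTS χ)
      + 4 * (innerH (s + 2) (t + 2) (hatTS χ) (hatZ ψ)).im
      + 2 * ∑ i, normSqH (s + 3 / 2) (t + 3 / 2) (hatTS (opXi i ψ))
      + 2 * normSqH (s + 3 / 2) (t + 3 / 2) (hatTS ψ)
      + 2 * normSqH (s + 3 / 2) (t + 3 / 2) (hatZ ψ)
      + 2 * (innerH (s + 2) (t + 2) (hatTS χ) (hatW φ)).re
      - 4 * (innerH (s + 3 / 2) (t + 3 / 2) (hatTS χ) (hatTS φ)).re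
      - 2 * (innerH (s + 3 / 2) (t + 3 / 2) (hatTS χ) (hatQ φ)).re
      - 4 * ∑ i, (innerH (s + 3 / 2) (t + 3 / 2) (hatTS (opXi i ψ)) (hatTS (mulX i φ))).re
      + 8 * (innerH (s + 1) (t + 1) (hatZ ψ) (hatTS φ)).im
      + 4 * (innerH (s + 1) (t + 1) (hatTS ψ) (hatZ φ)).im
      + 4 * ∑ i, (innerH (s + 1) (t + 1) (hatTS (opXi i ψ)) (hatZ (opXi i φ))).im
      + ∑ i, normSqH (s + 3 / 2) (t + 3 / 2) (hatTS (mulX i φ))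
      - 2 * ∑ i, (innerH (s + 1) (t + 1) (hatTS (mulX i φ)) (hatZ (opXi i φ))).im
      - 4 * (innerH (s + 1) (t + 1) (hatW φ) (hatTS φ)).re
      + ∑ i, ∑ j, normSqH (s + 1 / 2) (t + 1 / 2) (hatTS (opXi i (opXi j φ)))
      + 4 * ∑ i, (innerH (s + 1 / 2) (t + 1 / 2) (hatTS (opXi i (opXi i φ))) (hatTS φ)).re
      + ∑ i, normSqH (s + 1 / 2) (t + 1 / 2) (hatTS (opXi i φ))
      + 4 * n * normSqH (s + 1 / 2) (t + 1 / 2) (hatTS φ))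

/-- `𝓢(T𝕊ⁿ⁻¹) ⊕ 𝓢(T𝕊ⁿ⁻¹) ⊕ 𝓢(T𝕊ⁿ⁻¹)`. -/
abbrev Triple (n : ℕ) : Type := SchwartzTS n × SchwartzTS n × SchwartzTS n

section Completion

variable {V : Type*} [AddCommGroup V] [Module ℂ V]

/-- The vector space `V` with the inner product `c` and its norm. -/
def WithInner (_c : InnerProductSpace.Core ℂ V) : Type _ := V

instance (c : InnerProductSpace.Core ℂ V) : NormedAddCommGroup (WithInner c) :=
  c.toNormedAddCommGroup

instance (c : InnerProductSpace.Core ℂ V) : InnerProductSpace ℂ (WithInner c) :=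
  InnerProductSpace.ofCore c.toCore

/-- The Hilbert space obtained by completing a complex vector space with respect to the norm
of a positive-definite inner product. -/
abbrev HilbertCompletion (c : InnerProductSpace.Core ℂ V) : Type _ :=
  UniformSpace.Completion (WithInner c)

/-- The identity map of `V` onto `V` with the inner product `c`. -/
def toWithInner (c : InnerProductSpace.Core ℂ V) : V →ₗ[ℂ] WithInner c where
  toFun v := v
  map_add' _ _ := rfl
  map_smul' _ _ := rfl

/-- The canonical map of `V` into its completion. -/
def toHilbert (c : InnerProductSpace.Core ℂ V) : V →ₗ[ℂ] HilbertCompletion c :=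
  (UniformSpace.Completion.toComplₗᵢ (𝕜 := ℂ) (E := WithInner c)).toLinearMap ∘ₗ toWithInner c

end Completion

end MomentumRay

end

/-! The nineteen terms of the norm are the expansion of a single square. With `u`, `v`, `w` the
Fourier transforms of `φ`, `ψ`, `χ`, let `G` (`symbolG`, `hatG`) be the matrix `Ξ_iΞ_j u + 2 ξ_j Ξ_i
u + ξ_i Ξ_j u + 2u δ_ij - i v (y_i ξ_j + ξ_i y_j) - i (y_i Ξ_j v + y_j Ξ_i v) - w y_i y_j - y_i X_j
u`. Then the norm squared is `a_n/4 · (2π)⁻¹ ∫∫ |y|^{2t+1} (1+|y|²)^{s-t} |G|² dy dξ`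
(`tripleNormSq_eq`). The algebra is `pairing_symbolG`; it uses that the jets are tangential and that
the commutator of `Ξ_i` and `Ξ_j` is known (`jetRelations`). The assumption `t > -n/2` is what makes
the weight integrable at `y = 0` on the `(n-1)`-dimensional hyperplanes.

Definiteness is triangular. If `G = 0` almost everywhere, then `ξ·Gξ = 2u` forces `φ = 0`; next
`y·Gξ = -i|y|² v` forces `ψ = 0`; finally `y·Gy = -|y|⁴ w` forces `χ = 0` (`eq_zero_of_hatG_ae`).
The inner product is the corresponding Hermitian pairing of two `G`'s.

For the isometry, let `F` be the Fourier transform of `f`. The slice theorem (`hatTS_rayTransform`)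
gives, for `I⁰f`, `I¹f`, `I²f`, the transforms `√(2π) F(ξ,ξ)`, `i√(2π) (∂_ξ F)(ξ,ξ)` and `-√(2π)
(∂_ξ² F)(ξ,ξ)` at `y`. Inserted into `G`, all derivatives of `F` cancel and `G = 2√(2π) F(y)`,
independent of `ξ` (`hatG_rayTransform`). Integrating a function of `y` over the pairs `(y, ξ)`
gives the area of `𝕊ⁿ⁻²` times its integral against `|y|⁻¹ dy` (`integral_fst_tsMeasure`). Here
`|y|⁻¹` removes the extra power in the weight, and `a_n` is the inverse of that area. The norms
therefore agree on Schwartz fields (`tripleNormSq_rayTransform`), and the rest is extension by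
density.

The analytic tool is `lift`: a function on `T𝕊ⁿ⁻¹` is extended through the retraction and damped by
a Gaussian along `ξ`. Its Fourier integral over the moving hyperplane `ξ^⊥` becomes an integral over
the fixed space `ℝⁿ`, which can be differentiated in `ξ`; this is how the Fourier transform is shown
to commute with `Ξ_i` (`hatTS_opXi`). -/

noncomputable section

namespace MomentumRay

/-! ### Growth and decay classes of ambient functions along `T𝕊ⁿ⁻¹`, and the retraction. -/

section Symbols

variable {n : ℕ} {F G H : Type*} [NormedAddCommGroup F] [NormedSpace ℝ F]
  [NormedAddCommGroup G] [NormedSpace ℝ G] [NormedAddCommGroup H] [NormedSpace ℝ H]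

/-- Smooth maps on `ℝⁿ × (ℝⁿ \ {0})` whose derivatives grow at most polynomially in `x` along
`T𝕊ⁿ⁻¹`. -/
def GrowTS (Φ : E n × E n → F) : Prop :=
  ContDiffOn ℝ ∞ Φ (slit n) ∧ ∀ l : ℕ, ∃ (k : ℕ) (C : ℝ), ∀ p : TSphere n,
    ‖iteratedFDeriv ℝ l Φ p.1‖ ≤ C * (1 + ‖p.1.1‖) ^ k

/-- Smooth maps on `ℝⁿ × (ℝⁿ \ {0})` whose derivatives decay faster than any power of `x` along
`T𝕊ⁿ⁻¹`. -/
def RapidTS (Φ : E n × E n → F) : Prop :=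
  ContDiffOn ℝ ∞ Φ (slit n) ∧ ∀ k l : ℕ, ∃ C : ℝ, ∀ p : TSphere n,
    (1 + ‖p.1.1‖) ^ k * ‖iteratedFDeriv ℝ l Φ p.1‖ ≤ C

theorem one_add_pow_le (k : ℕ) {r : ℝ} (hr : 0 ≤ r) : (1 + r) ^ k ≤ 2 ^ k * (1 + r ^ k) := by
  rcases le_total r 1 with h | h
  · calc (1 + r) ^ k ≤ 2 ^ k := by gcongr; linarith
      _ ≤ 2 ^ k * (1 + r ^ k) := le_mul_of_one_le_right (by positivity)
          (by linarith [pow_nonneg hr k])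
  · calc (1 + r) ^ k ≤ (2 * r) ^ k := by gcongr; linarith
      _ = 2 ^ k * r ^ k := mul_pow _ _ _
      _ ≤ 2 ^ k * (1 + r ^ k) := by gcongr; linarith

/-- The powers `|x|⁰` and `|x|^k` together control `(1+|x|)^k`. The weight `1+|x|` is preferable
because polynomially growing factors are absorbed by raising its exponent. -/
theorem mem_SchwartzTS_iff {φ : TSphere n → ℂ} : φ ∈ SchwartzTS n ↔ RapidTS (extend φ) := by
  refine and_congr_right fun _ => ⟨fun h k l => ?_, fun h k l => ?_⟩
  · obtain ⟨A, hA⟩ := h 0 l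
    obtain ⟨B, hB⟩ := h k l
    refine ⟨2 ^ k * (A + B), fun p => ?_⟩
    have h1 := hA p
    have h2 := hB p
    rw [pow_zero, one_mul] at h1
    calc _ ≤ (2 ^ k * (1 + ‖p.1.1‖ ^ k)) * ‖iteratedFDeriv ℝ l (extend φ) p.1‖ := by
          gcongr; exact one_add_pow_le k (norm_nonneg _)
      _ = 2 ^ k * (‖iteratedFDeriv ℝ l (extend φ) p.1‖
            + ‖p.1.1‖ ^ k * ‖iteratedFDeriv ℝ l (extend φ) p.1‖) := by ring
      _ ≤ _ := by gcongr
  · obtain ⟨C, hC⟩ := h k l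
    refine ⟨C, fun p => le_trans ?_ (hC p)⟩
    gcongr
    linarith

theorem uniqueDiffOn_slit : UniqueDiffOn ℝ (slit n) := (isOpen_slit n).uniqueDiffOn

theorem iteratedFDerivWithin_slit (l : ℕ) (Φ : E n × E n → F) (p : TSphere n) :
    iteratedFDerivWithin ℝ l Φ (slit n) p.1 = iteratedFDeriv ℝ l Φ p.1 :=
  iteratedFDerivWithin_of_isOpen l (isOpen_slit n) (mem_slit p)

theorem natCast_le_infty (l : ℕ) : (l : ℕ∞ω) ≤ ∞ := by exact_mod_cast le_top

/-- One exponent and one constant serve all orders up to `l`. The normalization `1 ≤ C` is what lets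
`C` be bounded by its own powers in the chain rule estimate of `RapidTS.comp_ret`. -/
theorem GrowTS.uniform {Φ : E n × E n → F} (h : GrowTS Φ) (l : ℕ) :
    ∃ (k : ℕ) (C : ℝ), 1 ≤ C ∧ ∀ i ≤ l, ∀ p : TSphere n,
      ‖iteratedFDeriv ℝ i Φ p.1‖ ≤ C * (1 + ‖p.1.1‖) ^ k := by
  choose k C hC using h.2
  refine ⟨∑ i ∈ Finset.range (l + 1), k i, 1 + ∑ i ∈ Finset.range (l + 1), |C i|, ?_,
    fun i hi p => (hC i p).trans ?_⟩
  · linarith [Finset.sum_nonneg fun i (_ : i ∈ Finset.range (l + 1)) => abs_nonneg (C i)]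
  · have hi' : i ∈ Finset.range (l + 1) := Finset.mem_range.mpr (by omega)
    have h1 : C i ≤ 1 + ∑ i ∈ Finset.range (l + 1), |C i| := by
      have := Finset.single_le_sum (f := fun i => |C i|) (fun i _ => abs_nonneg (C i)) hi'
      have := le_abs_self (C i)
      linarith
    have h2 : k i ≤ ∑ i ∈ Finset.range (l + 1), k i :=
      Finset.single_le_sum (f := k) (fun i _ => Nat.zero_le _) hi'
    have h3 : (1 : ℝ) ≤ 1 + ‖p.1.1‖ := by linarith [norm_nonneg p.1.1]
    have h4 := pow_le_pow_right₀ h3 h2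
    have h5 : 0 ≤ 1 + ∑ i ∈ Finset.range (l + 1), |C i| := by positivity
    gcongr

theorem RapidTS.uniform {Φ : E n × E n → F} (h : RapidTS Φ) (k l : ℕ) :
    ∃ C : ℝ, 0 ≤ C ∧ ∀ i ≤ l, ∀ p : TSphere n,
      (1 + ‖p.1.1‖) ^ k * ‖iteratedFDeriv ℝ i Φ p.1‖ ≤ C := by
  choose C hC using h.2 k
  refine ⟨∑ i ∈ Finset.range (l + 1), |C i|, by positivity, fun i hi p => (hC i p).trans ?_⟩
  exact (le_abs_self _).trans (Finset.single_le_sum (f := fun i => |C i|)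
    (fun i _ => abs_nonneg (C i)) (Finset.mem_range.mpr (by omega)))

/-- Leibniz rule. A general bilinear `B` covers scalar multiplication, inner products and the
application of a derivative to a vector field in one statement. -/
theorem GrowTS.bilinear {Φ : E n × E n → F} {Ψ : E n × E n → G} (hΦ : GrowTS Φ) (hΨ : GrowTS Ψ)
    (B : F →L[ℝ] G →L[ℝ] H) : GrowTS fun p => B (Φ p) (Ψ p) := by
  refine ⟨(B.contDiff.comp_contDiffOn hΦ.1).clm_apply hΨ.1, fun l => ?_⟩
  obtain ⟨k, C, hC1, hC⟩ := hΦ.uniform l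
  obtain ⟨k', C', hC1', hC'⟩ := hΨ.uniform l
  refine ⟨k + k', ‖B‖ * ∑ i ∈ Finset.range (l + 1), (l.choose i : ℝ) * C * C', fun p => ?_⟩
  have := B.norm_iteratedFDerivWithin_le_of_bilinear hΦ.1 hΨ.1 uniqueDiffOn_slit (mem_slit p)
    (natCast_le_infty l)
  simp only [iteratedFDerivWithin_slit] at this
  refine this.trans ?_
  rw [mul_assoc, Finset.sum_mul]
  refine mul_le_mul_of_nonneg_left (Finset.sum_le_sum fun i hi => ?_) (norm_nonneg B)
  calc (l.choose i : ℝ) * ‖iteratedFDeriv ℝ i Φ p.1‖ * ‖iteratedFDeriv ℝ (l - i) Ψ p.1‖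
      ≤ (l.choose i : ℝ) * (C * (1 + ‖p.1.1‖) ^ k) * (C' * (1 + ‖p.1.1‖) ^ k') := by
        gcongr
        · exact hC i (by simpa [Nat.lt_succ_iff] using hi) p
        · exact hC' (l - i) (by omega) p
    _ = _ := by rw [pow_add]; ring

theorem RapidTS.bilinear {Φ : E n × E n → F} {Ψ : E n × E n → G} (hΦ : RapidTS Φ)
    (hΨ : GrowTS Ψ) (B : F →L[ℝ] G →L[ℝ] H) : RapidTS fun p => B (Φ p) (Ψ p) := by
  refine ⟨(B.contDiff.comp_contDiffOn hΦ.1).clm_apply hΨ.1, fun m l => ?_⟩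
  obtain ⟨k', C', hC1', hC'⟩ := hΨ.uniform l
  obtain ⟨C, hC0, hC⟩ := hΦ.uniform (m + k') l
  refine ⟨‖B‖ * ∑ i ∈ Finset.range (l + 1), (l.choose i : ℝ) * C * C', fun p => ?_⟩
  have := B.norm_iteratedFDerivWithin_le_of_bilinear hΦ.1 hΨ.1 uniqueDiffOn_slit (mem_slit p)
    (natCast_le_infty l)
  simp only [iteratedFDerivWithin_slit] at this
  calc _ ≤ (1 + ‖p.1.1‖) ^ m * _ := mul_le_mul_of_nonneg_left this (by positivity)
    _ = ‖B‖ * ∑ i ∈ Finset.range (l + 1), (1 + ‖p.1.1‖) ^ m * ((l.choose i : ℝ) *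
        ‖iteratedFDeriv ℝ i Φ p.1‖ * ‖iteratedFDeriv ℝ (l - i) Ψ p.1‖) := by
        rw [← Finset.mul_sum]; ring
    _ ≤ _ := by
      refine mul_le_mul_of_nonneg_left (Finset.sum_le_sum fun i hi => ?_) (norm_nonneg B)
      calc _ ≤ (1 + ‖p.1.1‖) ^ m * ((l.choose i : ℝ) * ‖iteratedFDeriv ℝ i Φ p.1‖ *
            (C' * (1 + ‖p.1.1‖) ^ k')) := by
            gcongr
            exact hC' (l - i) (by omega) p
        _ = (l.choose i : ℝ) * ((1 + ‖p.1.1‖) ^ (m + k') * ‖iteratedFDeriv ℝ i Φ p.1‖) * C' := by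
            rw [pow_add]; ring
        _ ≤ _ := by
            gcongr
            exact hC i (by simpa [Nat.lt_succ_iff] using hi) p

theorem iteratedFDeriv_add_TS {Φ Ψ : E n × E n → F} (hΦ : ContDiffOn ℝ ∞ Φ (slit n))
    (hΨ : ContDiffOn ℝ ∞ Ψ (slit n)) (l : ℕ) (p : TSphere n) :
    iteratedFDeriv ℝ l (fun q => Φ q + Ψ q) p.1 =
      iteratedFDeriv ℝ l Φ p.1 + iteratedFDeriv ℝ l Ψ p.1 := by
  have h (Θ : E n × E n → F) (hΘ : ContDiffOn ℝ ∞ Θ (slit n)) : ContDiffAt ℝ l Θ p.1 :=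
    (hΘ.contDiffAt ((isOpen_slit n).mem_nhds (mem_slit p))).of_le (natCast_le_infty l)
  exact iteratedFDeriv_add_apply (h Φ hΦ) (h Ψ hΨ)

theorem GrowTS.add {Φ Ψ : E n × E n → F} (hΦ : GrowTS Φ) (hΨ : GrowTS Ψ) :
    GrowTS fun p => Φ p + Ψ p := by
  refine ⟨hΦ.1.add hΨ.1, fun l => ?_⟩
  obtain ⟨k, C, hC1, hC⟩ := hΦ.uniform l
  obtain ⟨k', C', hC1', hC'⟩ := hΨ.uniform l
  refine ⟨k + k', C + C', fun p => ?_⟩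
  have h3 : (1 : ℝ) ≤ 1 + ‖p.1.1‖ := by linarith [norm_nonneg p.1.1]
  rw [iteratedFDeriv_add_TS hΦ.1 hΨ.1]
  calc _ ≤ C * (1 + ‖p.1.1‖) ^ k + C' * (1 + ‖p.1.1‖) ^ k' :=
        (norm_add_le _ _).trans (add_le_add (hC l le_rfl p) (hC' l le_rfl p))
    _ ≤ C * (1 + ‖p.1.1‖) ^ (k + k') + C' * (1 + ‖p.1.1‖) ^ (k + k') := by
        gcongr <;> first | exact h3 | omega
    _ = _ := by ring

theorem RapidTS.add {Φ Ψ : E n × E n → F} (hΦ : RapidTS Φ) (hΨ : RapidTS Ψ) :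
    RapidTS fun p => Φ p + Ψ p := by
  refine ⟨hΦ.1.add hΨ.1, fun k l => ?_⟩
  obtain ⟨C, hC⟩ := hΦ.2 k l
  obtain ⟨C', hC'⟩ := hΨ.2 k l
  refine ⟨C + C', fun p => ?_⟩
  rw [iteratedFDeriv_add_TS hΦ.1 hΨ.1]
  calc _ ≤ (1 + ‖p.1.1‖) ^ k * (‖iteratedFDeriv ℝ l Φ p.1‖ + ‖iteratedFDeriv ℝ l Ψ p.1‖) := by
        gcongr; exact norm_add_le _ _
    _ ≤ _ := by rw [mul_add]; exact add_le_add (hC p) (hC' p)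

theorem growTS_const (c : F) : GrowTS fun _ : E n × E n => c := by
  refine ⟨contDiffOn_const, fun l => ⟨0, ‖c‖, fun p => ?_⟩⟩
  rcases l with _ | l
  · simp
  · simp [iteratedFDeriv_const_of_ne]

theorem GrowTS.clm_comp {Φ : E n × E n → F} (hΦ : GrowTS Φ) (A : F →L[ℝ] G) :
    GrowTS fun p => A (Φ p) := by
  simpa using hΦ.bilinear (growTS_const (n := n) (1 : ℝ)) ((ContinuousLinearMap.lsmul ℝ ℝ).flip.comp A)

theorem RapidTS.sum {ι : Type*} (s : Finset ι) {Φ : ι → E n × E n → F}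
    (h : ∀ i ∈ s, RapidTS (Φ i)) : RapidTS fun p => ∑ i ∈ s, Φ i p := by
  classical
  induction s using Finset.induction_on with
  | empty =>
    refine ⟨by simpa using contDiffOn_const, fun k l => ⟨0, fun p => ?_⟩⟩
    simp only [Finset.sum_empty]
    rw [show iteratedFDeriv ℝ l (fun _ : E n × E n => (0 : F)) = 0 from iteratedFDeriv_fun_zero]
    simp
  | insert a s ha ih =>
    simp only [Finset.sum_insert ha]
    exact (h a (by simp)).add (ih fun i hi => h i (by simp [hi]))

theorem growTS_clm (A : E n × E n →L[ℝ] F) : GrowTS fun p => A p := by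
  refine ⟨A.contDiff.contDiffOn, fun l => ?_⟩
  rcases l with _ | _ | l
  · refine ⟨1, ‖A‖, fun p => ?_⟩
    rw [norm_iteratedFDeriv_zero]
    refine (A.le_opNorm p.1).trans ?_
    gcongr
    rw [pow_one]
    refine max_le (by linarith) ?_
    rw [p.2.1]; linarith [norm_nonneg p.1.1]
  · refine ⟨0, ‖A‖, fun p => ?_⟩
    rw [norm_iteratedFDeriv_one]
    simp
  · refine ⟨0, 0, fun p => ?_⟩
    have : ‖iteratedFDeriv ℝ (l + 1 + 1) (fun p => A p) p.1‖ = 0 := by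
      rw [← norm_iteratedFDeriv_fderiv]
      have : fderiv ℝ (fun p => A p) = fun _ => A := by ext1 p; exact A.fderiv
      rw [this, iteratedFDeriv_const_of_ne (by omega)]
      simp
    simp [this]

/-- Translation invariance in `x` makes every derivative independent of `x`, and compactness of the
sphere bounds it in `ξ`. -/
theorem growTS_snd_comp {h : E n → F} (hh : ContDiffOn ℝ ∞ h {ξ | ξ ≠ 0}) :
    GrowTS fun p : E n × E n => h p.2 := by
  have hs : ContDiffOn ℝ ∞ (fun p : E n × E n => h p.2) (slit n) :=
    hh.comp contDiff_snd.contDiffOn fun p hp => hp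
  refine ⟨hs, fun l => ⟨0, ?_⟩⟩
  have hc : ContinuousOn (iteratedFDeriv ℝ l (fun p : E n × E n => h p.2)) (slit n) := by
    refine (hs.continuousOn_iteratedFDerivWithin (natCast_le_infty l) uniqueDiffOn_slit).congr ?_
    exact fun p hp => (iteratedFDerivWithin_of_isOpen l (isOpen_slit n) hp).symm
  have hK : IsCompact (({0} : Set (E n)) ×ˢ Metric.sphere (0 : E n) 1) :=
    isCompact_singleton.prod (isCompact_sphere _ _)
  obtain ⟨C, hC⟩ := hK.exists_bound_of_continuousOn (hc.mono (by
    rintro ⟨x, ξ⟩ ⟨-, hξ⟩ h0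
    simp only at h0
    simp [h0] at hξ))
  refine ⟨C, fun p => ?_⟩
  have hinv := iteratedFDeriv_comp_add_right (𝕜 := ℝ) (f := fun p : E n × E n => h p.2) l
    (p.1.1, (0 : E n)) (0, p.1.2)
  simp only [Prod.snd_add, add_zero, Prod.mk_add_mk, zero_add] at hinv
  rw [pow_zero, mul_one]
  have : iteratedFDeriv ℝ l (fun p : E n × E n => h p.2) p.1 =
      iteratedFDeriv ℝ l (fun p : E n × E n => h p.2) (0, p.1.2) := hinv.symm
  rw [this]
  exact hC _ ⟨rfl, mem_sphere_zero_iff_norm.mpr p.2.1⟩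

theorem RapidTS.fderiv {Φ : E n × E n → F} (hΦ : RapidTS Φ) : RapidTS (fderiv ℝ Φ) := by
  refine ⟨?_, fun k l => ?_⟩
  · exact hΦ.1.fderiv_of_isOpen (isOpen_slit n) (by simp)
  · obtain ⟨C, hC⟩ := hΦ.2 k (l + 1)
    exact ⟨C, fun p => by rw [norm_iteratedFDeriv_fderiv]; exact hC p⟩

/-- The retraction onto `T𝕊ⁿ⁻¹` as a map into `ℝⁿ × ℝⁿ`. -/
def ret (p : E n × E n) : E n × E n :=
  (p.1 - (inner ℝ p.2 p.1 / ‖p.2‖ ^ 2) • p.2, ‖p.2‖⁻¹ • p.2)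

theorem ret_eq (p : TSphere n) : ret p.1 = p.1 := by
  obtain ⟨⟨x, ξ⟩, h1, h2⟩ := p
  simp only at h1 h2
  simp [ret, h1, h2]

theorem growTS_ret : GrowTS (ret (n := n)) := by
  have hx : GrowTS fun p : E n × E n => p.1 := growTS_clm (ContinuousLinearMap.fst ℝ _ _)
  have hξ : GrowTS fun p : E n × E n => p.2 := growTS_clm (ContinuousLinearMap.snd ℝ _ _)
  have hinv : GrowTS fun p : E n × E n => ‖p.2‖⁻¹ :=
    growTS_snd_comp (h := fun ξ => ‖ξ‖⁻¹) (contDiffOn_id.norm ℝ (fun _ h => h) |>.inv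
      fun _ h => norm_ne_zero_iff.mpr h)
  have hη : GrowTS fun p : E n × E n => ‖p.2‖⁻¹ • p.2 :=
    hinv.bilinear hξ (ContinuousLinearMap.lsmul ℝ ℝ)
  have h1 : GrowTS fun p : E n × E n => inner ℝ (‖p.2‖⁻¹ • p.2) p.1 := hη.bilinear hx (innerSL ℝ)
  have h2 : GrowTS fun p : E n × E n => (inner ℝ (‖p.2‖⁻¹ • p.2) p.1) • (‖p.2‖⁻¹ • p.2) :=
    h1.bilinear hη (ContinuousLinearMap.lsmul ℝ ℝ)
  have h3 := (hx.add (h2.clm_comp (-ContinuousLinearMap.id ℝ (E n)))).clm_comp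
    (ContinuousLinearMap.inl ℝ (E n) (E n))
  have h4 := hη.clm_comp (ContinuousLinearMap.inr ℝ (E n) (E n))
  convert h3.add h4 using 1
  ext1 p
  simp only [ret, ContinuousLinearMap.inl_apply, ContinuousLinearMap.inr_apply, Prod.mk_add_mk,
    add_zero, zero_add, inner_smul_left, smul_smul, neg_apply,
    ContinuousLinearMap.id_apply, sub_eq_add_neg]
  congr 4
  simp
  ring

theorem mapsTo_ret : Set.MapsTo (ret (n := n)) (slit n) (slit n) := by
  intro p hp
  exact smul_ne_zero (inv_ne_zero (norm_ne_zero_iff.mpr hp)) hp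

/-- Faà di Bruno estimate at a point fixed by `ret`. Derivatives of `ret` contribute at most `l`
factors of size `(1+|x|)^k`, paid for by asking decay of order `m + k * l` from `Φ`. -/
theorem RapidTS.comp_ret {Φ : E n × E n → F} (hΦ : RapidTS Φ) : RapidTS (Φ ∘ ret) := by
  refine ⟨hΦ.1.comp growTS_ret.1 mapsTo_ret, fun m l => ?_⟩
  obtain ⟨k, D, hD1, hD⟩ := (growTS_ret (n := n)).uniform l
  obtain ⟨C, hC0, hC⟩ := hΦ.uniform (m + k * l) l
  refine ⟨l.factorial * C * D ^ l, fun p => ?_⟩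
  have h3 : (1 : ℝ) ≤ 1 + ‖p.1.1‖ := by linarith [norm_nonneg p.1.1]
  have hD' : (1 : ℝ) ≤ D * (1 + ‖p.1.1‖) ^ k := one_le_mul_of_one_le_of_one_le hD1 (one_le_pow₀ h3)
  have key := norm_iteratedFDerivWithin_comp_le (x := p.1) (n := l)
    (C := C / (1 + ‖p.1.1‖) ^ (m + k * l))
    (D := D * (1 + ‖p.1.1‖) ^ k) hΦ.1 growTS_ret.1 (natCast_le_infty l) uniqueDiffOn_slit
    uniqueDiffOn_slit mapsTo_ret (mem_slit p)
    (fun i hi => by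
      rw [ret_eq, iteratedFDerivWithin_slit, le_div_iff₀ (by positivity), mul_comm]
      exact hC i hi p)
    (fun i hi1 hi => by
      rw [iteratedFDerivWithin_slit]
      exact (hD i hi p).trans (le_self_pow₀ hD' (by omega)))
  rw [iteratedFDerivWithin_slit] at key
  calc _ ≤ (1 + ‖p.1.1‖) ^ m * _ := mul_le_mul_of_nonneg_left key (by positivity)
    _ = _ := by
      rw [mul_pow, ← pow_mul, pow_add]
      field_simp

theorem extend_apply {φ : TSphere n → ℂ} {p : E n × E n} (hp : p ∈ slit n) :
    extend φ p = φ (retract p hp) := dif_pos hp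

theorem retract_coe {p : E n × E n} (hp : p ∈ slit n) : (retract p hp).1 = ret p := rfl

theorem retract_self (p : TSphere n) : retract p.1 (mem_slit p) = p :=
  Subtype.ext (ret_eq p)

theorem extend_coe (φ : TSphere n → ℂ) (p : TSphere n) : extend φ p.1 = φ p := by
  rw [extend_apply (mem_slit p), retract_self]

theorem extend_eqOn {φ : TSphere n → ℂ} {Φ : E n × E n → ℂ} (h : ∀ p : TSphere n, φ p = Φ p.1) :
    Set.EqOn (extend φ) (Φ ∘ ret) (slit n) := fun p hp => by
  rw [extend_apply hp, h, retract_coe, Function.comp]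

theorem iteratedFDeriv_congr_slit {Φ Ψ : E n × E n → F} (h : Set.EqOn Φ Ψ (slit n)) (l : ℕ)
    (p : TSphere n) : iteratedFDeriv ℝ l Φ p.1 = iteratedFDeriv ℝ l Ψ p.1 := by
  rw [← iteratedFDerivWithin_slit, ← iteratedFDerivWithin_slit]
  exact iteratedFDerivWithin_congr h (mem_slit p) l

theorem RapidTS.congr {Φ Ψ : E n × E n → F} (hΦ : RapidTS Φ) (h : Set.EqOn Ψ Φ (slit n)) :
    RapidTS Ψ := by
  refine ⟨hΦ.1.congr h, fun k l => ?_⟩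
  obtain ⟨C, hC⟩ := hΦ.2 k l
  exact ⟨C, fun p => by rw [iteratedFDeriv_congr_slit h]; exact hC p⟩

/-- Membership may be tested on any ambient representative, not only on the canonical extension,
since the latter is the representative composed with `ret`. -/
theorem RapidTS.mem_SchwartzTS {φ : TSphere n → ℂ} {Φ : E n × E n → ℂ} (hΦ : RapidTS Φ)
    (h : ∀ p : TSphere n, φ p = Φ p.1) : φ ∈ SchwartzTS n :=
  mem_SchwartzTS_iff.mpr (hΦ.comp_ret.congr (extend_eqOn h))

end Symbols

/-! ### The tangent fields `X_i`, `Ξ_i`: action on Schwartz functions and commutation relations. -/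

section Operators

variable {n : ℕ} {F : Type*} [NormedAddCommGroup F] [NormedSpace ℝ F]

/-- The vector field of `opX i`. -/
def fieldX (i : Fin n) (p : E n × E n) : E n × E n :=
  (EuclideanSpace.single i 1 - p.2 i • p.2, 0)

/-- The vector field of `opXi i`. -/
def fieldXi (i : Fin n) (p : E n × E n) : E n × E n :=
  (-(p.1 i • p.2), EuclideanSpace.single i 1 - p.2 i • p.2)

theorem opX_apply (i : Fin n) (φ : TSphere n → ℂ) (p : TSphere n) :
    opX i φ p = fderiv ℝ (extend φ) p.1 (fieldX i p.1) := rfl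

theorem opXi_apply (i : Fin n) (φ : TSphere n → ℂ) (p : TSphere n) :
    opXi i φ p = fderiv ℝ (extend φ) p.1 (fieldXi i p.1) := rfl

theorem growTS_x_coord (i : Fin n) : GrowTS fun p : E n × E n => p.1 i :=
  growTS_clm ((EuclideanSpace.proj i : E n →L[ℝ] ℝ).comp (ContinuousLinearMap.fst ℝ _ _))

theorem growTS_xi_coord (i : Fin n) : GrowTS fun p : E n × E n => p.2 i :=
  growTS_clm ((EuclideanSpace.proj i : E n →L[ℝ] ℝ).comp (ContinuousLinearMap.snd ℝ _ _))

theorem growTS_xi : GrowTS fun p : E n × E n => p.2 := growTS_clm (ContinuousLinearMap.snd ℝ _ _)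

theorem growTS_dir (i : Fin n) :
    GrowTS fun p : E n × E n => (EuclideanSpace.single i 1 - p.2 i • p.2 : E n) := by
  have := (growTS_const (n := n) (EuclideanSpace.single i (1 : ℝ) : E n)).add
    (((growTS_xi_coord i).bilinear growTS_xi (ContinuousLinearMap.lsmul ℝ ℝ)).clm_comp
      (-ContinuousLinearMap.id ℝ (E n)))
  simpa [sub_eq_add_neg] using this

theorem growTS_fieldX (i : Fin n) : GrowTS (fieldX (n := n) i) :=
  (growTS_dir i).clm_comp (ContinuousLinearMap.inl ℝ (E n) (E n))

theorem growTS_fieldXi (i : Fin n) : GrowTS (fieldXi (n := n) i) := by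
  have h := ((growTS_x_coord i).bilinear growTS_xi (ContinuousLinearMap.lsmul ℝ ℝ)).clm_comp
      (-ContinuousLinearMap.id ℝ (E n))
  have := (h.clm_comp (ContinuousLinearMap.inl ℝ (E n) (E n))).add
    ((growTS_dir i).clm_comp (ContinuousLinearMap.inr ℝ (E n) (E n)))
  convert this using 1
  ext1 p
  simp [fieldXi]

theorem RapidTS.fderiv_field {Φ : E n × E n → ℂ} (hΦ : RapidTS Φ) {V : E n × E n → E n × E n}
    (hV : GrowTS V) : RapidTS fun p => _root_.fderiv ℝ Φ p (V p) :=
  hΦ.fderiv.bilinear hV (ContinuousLinearMap.id ℝ _)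

theorem opX_mem (i : Fin n) {φ : TSphere n → ℂ} (hφ : φ ∈ SchwartzTS n) :
    opX i φ ∈ SchwartzTS n :=
  ((mem_SchwartzTS_iff.mp hφ).fderiv_field (growTS_fieldX i)).mem_SchwartzTS fun _ => rfl

theorem opXi_mem (i : Fin n) {φ : TSphere n → ℂ} (hφ : φ ∈ SchwartzTS n) :
    opXi i φ ∈ SchwartzTS n :=
  ((mem_SchwartzTS_iff.mp hφ).fderiv_field (growTS_fieldXi i)).mem_SchwartzTS fun _ => rfl

theorem mulX_mem (i : Fin n) {φ : TSphere n → ℂ} (hφ : φ ∈ SchwartzTS n) :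
    mulX i φ ∈ SchwartzTS n :=
  ((mem_SchwartzTS_iff.mp hφ).bilinear (growTS_x_coord i)
    (ContinuousLinearMap.lsmul ℝ ℝ).flip).mem_SchwartzTS fun p => by
      simp [mulX, extend_coe]

/-- Multiplication by the coordinate `ξ_i` on `T𝕊ⁿ⁻¹`. -/
def mulXi (i : Fin n) (φ : TSphere n → ℂ) (p : TSphere n) : ℂ := (p.1.2 i : ℂ) * φ p

theorem mulXi_mem (i : Fin n) {φ : TSphere n → ℂ} (hφ : φ ∈ SchwartzTS n) :
    mulXi i φ ∈ SchwartzTS n :=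
  ((mem_SchwartzTS_iff.mp hφ).bilinear (growTS_xi_coord i)
    (ContinuousLinearMap.lsmul ℝ ℝ).flip).mem_SchwartzTS fun p => by
      simp [mulXi, extend_coe]

/-- The hypotheses are the linearized constraints `|ξ| = 1` and `⟨x, ξ⟩ = 0`. Along the line `p + t
v` these constraints are violated only by multiples of `t²`, so the retraction moves the line only
to second order. -/
theorem hasFDerivAt_ret_tangent (p : TSphere n) {v : E n × E n} (h2 : inner ℝ p.1.2 v.2 = 0)
    (h1 : inner ℝ p.1.2 v.1 + inner ℝ v.2 p.1.1 = 0) : fderiv ℝ ret p.1 v = v := by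
  obtain ⟨⟨x, ξ⟩, hξ, hx⟩ := p
  obtain ⟨a, b⟩ := v
  simp only at hξ hx h1 h2
  have hd : DifferentiableAt ℝ (ret (n := n)) (x, ξ) :=
    (growTS_ret.1.contDiffAt ((isOpen_slit n).mem_nhds (mem_slit ⟨(x, ξ), hξ, hx⟩))).differentiableAt
      (by simp)
  have hline : HasDerivAt (fun t : ℝ => ((x, ξ) : E n × E n) + t • (a, b)) (a, b) 0 := by
    simpa using ((hasDerivAt_id (0 : ℝ)).smul_const ((a, b) : E n × E n)).const_add (x, ξ)
  have hc : HasDerivAt (fun t : ℝ => ret (((x, ξ) : E n × E n) + t • (a, b)))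
      (fderiv ℝ ret (x, ξ) (a, b)) 0 := by
    have hd' : HasFDerivAt (ret (n := n)) (fderiv ℝ ret (x, ξ))
        (((x, ξ) : E n × E n) + (0 : ℝ) • (a, b)) := by simpa using hd.hasFDerivAt
    exact hd'.comp_hasDerivAt (0 : ℝ) hline
  have hn (t : ℝ) : ‖ξ + t • b‖ ^ 2 = 1 + t ^ 2 * ‖b‖ ^ 2 := by
    rw [norm_add_sq_real, inner_smul_right, h2, norm_smul, hξ, mul_pow]
    simp
  have hn' (t : ℝ) : ‖ξ + t • b‖ = √(1 + t ^ 2 * ‖b‖ ^ 2) := by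
    rw [← hn, Real.sqrt_sq (norm_nonneg _)]
  have hi (t : ℝ) : inner ℝ (ξ + t • b) (x + t • a) = t ^ 2 * inner ℝ b a := by
    simp only [inner_add_left, inner_add_right, inner_smul_left, inner_smul_right]
    simp only [conj_trivial]
    linear_combination hx + t * h1
  have hform : (fun t : ℝ => ret (((x, ξ) : E n × E n) + t • (a, b))) = fun t : ℝ =>
      ((x + t • a) - (t ^ 2 * inner ℝ b a / (1 + t ^ 2 * ‖b‖ ^ 2)) • (ξ + t • b),
        (√(1 + t ^ 2 * ‖b‖ ^ 2))⁻¹ • (ξ + t • b)) := by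
    funext t
    simp only [ret, Prod.fst_add, Prod.snd_add, Prod.smul_fst, Prod.smul_snd, hi, hn']
    rw [← hn', hn]
  rw [hform] at hc
  have hA : HasDerivAt (fun t : ℝ => x + t • a) a 0 := by
    simpa using ((hasDerivAt_id (0 : ℝ)).smul_const a).const_add x
  have hB : HasDerivAt (fun t : ℝ => ξ + t • b) b 0 := by
    simpa using ((hasDerivAt_id (0 : ℝ)).smul_const b).const_add ξ
  have hsq : HasDerivAt (fun t : ℝ => 1 + t ^ 2 * ‖b‖ ^ 2) 0 0 := by
    simpa using (((hasDerivAt_id (0 : ℝ)).pow 2).mul_const (‖b‖ ^ 2)).const_add 1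
  have hnum : HasDerivAt (fun t : ℝ => t ^ 2 * inner ℝ b a) 0 0 := by
    simpa using ((hasDerivAt_id (0 : ℝ)).pow 2).mul_const (inner ℝ b a)
  have hq : HasDerivAt (fun t : ℝ => t ^ 2 * inner ℝ b a / (1 + t ^ 2 * ‖b‖ ^ 2)) 0 0 := by
    have := hnum.div hsq (by simp)
    simp only [zero_mul, mul_zero, sub_self, zero_div] at this
    exact this
  have hs : HasDerivAt (fun t : ℝ => (√(1 + t ^ 2 * ‖b‖ ^ 2))⁻¹) 0 0 := by
    have := (hsq.sqrt (by simp)).inv (by simp)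
    simp only [zero_div, neg_zero] at this
    exact this
  have hfin := (hA.sub (hq.smul hB)).prodMk (hs.smul hB)
  have := hc.unique hfin
  simpa using this

/-- Tangential derivatives do not depend on the ambient representative. Hence `X_i` and `Ξ_i` can be
computed with whichever formula for the function is convenient. -/
theorem hasFDerivAt_extend_tangent {φ : TSphere n → ℂ} {Φ : E n × E n → ℂ}
    (h : ∀ p : TSphere n, φ p = Φ p.1) (p : TSphere n) (hΦ : DifferentiableAt ℝ Φ p.1) :
    DifferentiableAt ℝ (extend φ) p.1 ∧ ∀ v : E n × E n, inner ℝ p.1.2 v.2 = 0 →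
      inner ℝ p.1.2 v.1 + inner ℝ v.2 p.1.1 = 0 →
        fderiv ℝ (extend φ) p.1 v = fderiv ℝ Φ p.1 v := by
  have hd : DifferentiableAt ℝ (ret (n := n)) p.1 :=
    (growTS_ret.1.contDiffAt ((isOpen_slit n).mem_nhds (mem_slit p))).differentiableAt (by simp)
  have hev : extend φ =ᶠ[nhds p.1] Φ ∘ ret :=
    Filter.eventually_of_mem ((isOpen_slit n).mem_nhds (mem_slit p)) fun q hq => extend_eqOn h hq
  have hΦ' : DifferentiableAt ℝ Φ (ret p.1) := by rwa [ret_eq]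
  refine ⟨(hΦ'.comp _ hd).congr_of_eventuallyEq hev, fun v h2 h1 => ?_⟩
  rw [hev.fderiv_eq, fderiv_comp _ hΦ' hd, ContinuousLinearMap.comp_apply,
    hasFDerivAt_ret_tangent p h2 h1, ret_eq]

theorem inner_single_coord (i : Fin n) (x : E n) :
    inner ℝ x (EuclideanSpace.single i 1) = x i := by
  simp [EuclideanSpace.inner_single_right]

theorem inner_dir (i : Fin n) (p : TSphere n) :
    inner ℝ p.1.2 (EuclideanSpace.single i 1 - p.1.2 i • p.1.2 : E n) = 0 := by
  rw [inner_sub_right, inner_single_coord, inner_smul_right, real_inner_self_eq_norm_sq, p.2.1]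
  simp

theorem inner_dir_x (i : Fin n) (p : TSphere n) :
    inner ℝ (EuclideanSpace.single i 1 - p.1.2 i • p.1.2 : E n) p.1.1 = p.1.1 i := by
  rw [inner_sub_left, real_inner_comm, inner_single_coord, inner_smul_left, p.2.2]
  simp

theorem opX_eq_fderiv {φ : TSphere n → ℂ} {Φ : E n × E n → ℂ} (h : ∀ p : TSphere n, φ p = Φ p.1)
    (p : TSphere n) (hΦ : DifferentiableAt ℝ Φ p.1) (i : Fin n) :
    opX i φ p = fderiv ℝ Φ p.1 (fieldX i p.1) :=
  (hasFDerivAt_extend_tangent h p hΦ).2 _ (by simp) (by simp [inner_dir i p])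

theorem opXi_eq_fderiv {φ : TSphere n → ℂ} {Φ : E n × E n → ℂ} (h : ∀ p : TSphere n, φ p = Φ p.1)
    (p : TSphere n) (hΦ : DifferentiableAt ℝ Φ p.1) (i : Fin n) :
    opXi i φ p = fderiv ℝ Φ p.1 (fieldXi i p.1) :=
  (hasFDerivAt_extend_tangent h p hΦ).2 _ (inner_dir i p) (by
    simp only [inner_dir_x, inner_neg_right, inner_smul_right,
      real_inner_self_eq_norm_sq, p.2.1]
    ring)

theorem contDiffAt_extend {φ : TSphere n → ℂ} (hφ : φ ∈ SchwartzTS n) (p : TSphere n) :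
    ContDiffAt ℝ ∞ (extend φ) p.1 :=
  hφ.1.contDiffAt ((isOpen_slit n).mem_nhds (mem_slit p))

theorem differentiableAt_extend {φ : TSphere n → ℂ} (hφ : φ ∈ SchwartzTS n) (p : TSphere n) :
    DifferentiableAt ℝ (extend φ) p.1 :=
  (contDiffAt_extend hφ p).differentiableAt (by simp)

theorem differentiableAt_fderiv_extend {φ : TSphere n → ℂ} (hφ : φ ∈ SchwartzTS n)
    (p : TSphere n) : DifferentiableAt ℝ (fderiv ℝ (extend φ)) p.1 :=
  ((contDiffAt_extend hφ p).fderiv_right (m := 1) (by norm_cast)).differentiableAt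
    one_ne_zero

theorem hasFDerivAt_fieldXi (i : Fin n) (p : E n × E n) :
    ∃ L : E n × E n →L[ℝ] E n × E n, HasFDerivAt (fieldXi i) L p ∧ ∀ w,
      L w = (-(w.1 i • p.2) - p.1 i • w.2, -(w.2 i • p.2) - p.2 i • w.2) := by
  have hx : HasFDerivAt (fun p : E n × E n => p.1 i)
      ((EuclideanSpace.proj i : E n →L[ℝ] ℝ).comp (ContinuousLinearMap.fst ℝ _ _)) p :=
    ((EuclideanSpace.proj i : E n →L[ℝ] ℝ).comp (ContinuousLinearMap.fst ℝ (E n) (E n))).hasFDerivAt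
  have hxi : HasFDerivAt (fun p : E n × E n => p.2 i)
      ((EuclideanSpace.proj i : E n →L[ℝ] ℝ).comp (ContinuousLinearMap.snd ℝ _ _)) p :=
    ((EuclideanSpace.proj i : E n →L[ℝ] ℝ).comp (ContinuousLinearMap.snd ℝ (E n) (E n))).hasFDerivAt
  have hs : HasFDerivAt (fun p : E n × E n => p.2) (ContinuousLinearMap.snd ℝ _ _) p :=
    (ContinuousLinearMap.snd ℝ (E n) (E n)).hasFDerivAt
  refine ⟨_, (hx.smul hs).neg.prodMk ((hasFDerivAt_const _ p).sub (hxi.smul hs)), fun w => ?_⟩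
  simp
  constructor <;> abel

/-- Product rule: the last term is the derivative of the field `Ξ_j` in the direction `Ξ_i`. The
Hessian term being symmetric, only this one enters the commutator. -/
theorem opXi_opXi {φ : TSphere n → ℂ} (hφ : φ ∈ SchwartzTS n) (i j : Fin n) (p : TSphere n) :
    opXi i (opXi j φ) p =
      fderiv ℝ (fderiv ℝ (extend φ)) p.1 (fieldXi i p.1) (fieldXi j p.1) +
      fderiv ℝ (extend φ) p.1
        (-((fieldXi i p.1).1 j • p.1.2) - p.1.1 j • (fieldXi i p.1).2,
          -((fieldXi i p.1).2 j • p.1.2) - p.1.2 j • (fieldXi i p.1).2) := by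
  obtain ⟨L, hL, hLw⟩ := hasFDerivAt_fieldXi j p.1
  have h1 := (differentiableAt_fderiv_extend hφ p).hasFDerivAt.clm_apply hL
  rw [opXi_eq_fderiv (φ := opXi j φ) (Φ := fun q => fderiv ℝ (extend φ) q (fieldXi j q))
    (fun _ => rfl) p h1.differentiableAt, h1.fderiv, ← hLw]
  simp [add_comm]

theorem fderiv_extend_isSymm {φ : TSphere n → ℂ} (hφ : φ ∈ SchwartzTS n) (p : TSphere n)
    (v w : E n × E n) :
    fderiv ℝ (fderiv ℝ (extend φ)) p.1 v w = fderiv ℝ (fderiv ℝ (extend φ)) p.1 w v :=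
  ((contDiffAt_extend hφ p).isSymmSndFDerivAt (by simpa using natCast_le_infty 2)) v w

theorem opX_mulX {φ : TSphere n → ℂ} (hφ : φ ∈ SchwartzTS n) (i j : Fin n) (p : TSphere n) :
    opX i (mulX j φ) p = (((if i = j then 1 else 0) - p.1.2 i * p.1.2 j : ℝ) : ℂ) * φ p
      + (p.1.1 j : ℂ) * opX i φ p := by
  have hx : HasFDerivAt (fun p : E n × E n => p.1 j)
      ((EuclideanSpace.proj j : E n →L[ℝ] ℝ).comp (ContinuousLinearMap.fst ℝ _ _)) p.1 :=
    ((EuclideanSpace.proj j : E n →L[ℝ] ℝ).comp (ContinuousLinearMap.fst ℝ (E n) (E n))).hasFDerivAt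
  have h : HasFDerivAt (fun q : E n × E n => q.1 j • extend φ q) _ p.1 :=
    hx.smul (differentiableAt_extend hφ p).hasFDerivAt
  rw [opX_eq_fderiv (Φ := fun q => q.1 j • extend φ q)
    (fun q => by simp [mulX, extend_coe]) p h.differentiableAt, h.fderiv]
  simp only [add_apply, smul_apply, ContinuousLinearMap.smulRight_apply,
    ContinuousLinearMap.comp_apply, ContinuousLinearMap.coe_fst', PiLp.proj_apply,
    extend_coe, ← opX_apply, Complex.real_smul]
  rw [add_comm]
  congr 3
  simp [fieldX, eq_comm]

/-- The Hessians cancel and the bracket of the two fields remains. The coordinates are placed inside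
`X_j (x_i φ)` so that the Fourier transform applies term by term; the price, `δ_ij - ξ_i ξ_j`, is
symmetric and cancels. -/
theorem opXi_commutator {φ : TSphere n → ℂ} (hφ : φ ∈ SchwartzTS n) (i j : Fin n)
    (p : TSphere n) :
    opXi i (opXi j φ) p - opXi j (opXi i φ) p =
      mulXi i (opXi j φ) p - mulXi j (opXi i φ) p + opX j (mulX i φ) p - opX i (mulX j φ) p := by
  rw [opXi_opXi hφ, opXi_opXi hφ, fderiv_extend_isSymm hφ, opX_mulX hφ, opX_mulX hφ, mulXi, mulXi,
    opXi_apply, opXi_apply, opX_apply, opX_apply]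
  simp only [← Complex.real_smul, ← map_smul]
  have e : (if i = j then (1 : ℝ) else 0) - p.1.2 i * p.1.2 j =
      (if j = i then (1 : ℝ) else 0) - p.1.2 j * p.1.2 i := by
    simp only [eq_comm (a := i) (b := j)]; ring
  rw [e]
  simp only [add_sub_add_left_eq_sub, ← map_sub]
  rw [add_sub_assoc, add_sub_add_left_eq_sub, ← map_sub, ← map_add]
  congr 1
  ext k <;> simp [fieldX, fieldXi, eq_comm (a := j) (b := i)]
  all_goals ring

theorem sum_xi_fieldXi (p : TSphere n) : ∑ j, p.1.2 j • fieldXi j p.1 = 0 := by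
  have h1 : ∑ j, p.1.2 j * p.1.1 j = 0 := by
    have := p.2.2
    simpa [PiLp.inner_apply, mul_comm] using this
  have h2 : ∑ j, p.1.2 j * p.1.2 j = 1 := by
    have : inner ℝ p.1.2 p.1.2 = 1 := by rw [real_inner_self_eq_norm_sq, p.2.1]; norm_num
    simpa only [PiLp.inner_apply, RCLike.inner_apply, conj_trivial] using this
  ext k
  · simp only [fieldXi, Prod.smul_mk, Prod.fst_sum, WithLp.ofLp_sum, Finset.sum_apply]
    simp only [PiLp.smul_apply, PiLp.neg_apply, smul_eq_mul, mul_neg, Finset.sum_neg_distrib,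
      ← mul_assoc, ← Finset.sum_mul, h1]
    simp
  · simp only [fieldXi, Prod.smul_mk, Prod.snd_sum, WithLp.ofLp_sum, Finset.sum_apply]
    simp only [PiLp.smul_apply, PiLp.sub_apply, smul_eq_mul, mul_sub, Finset.sum_sub_distrib,
      ← mul_assoc, ← Finset.sum_mul, h2]
    simp

theorem sum_xi_opXi (φ : TSphere n → ℂ) (p : TSphere n) :
    ∑ j, (p.1.2 j : ℂ) * opXi j φ p = 0 := by
  simp only [opXi_apply, ← Complex.real_smul, ← map_smul, ← map_sum, sum_xi_fieldXi, map_zero]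

theorem sum_xi_opX (φ : TSphere n → ℂ) (p : TSphere n) :
    ∑ j, (p.1.2 j : ℂ) * opX j φ p = 0 := by
  have h : ∑ j, p.1.2 j • fieldX j p.1 = 0 := by
    have h := congrArg Prod.snd (sum_xi_fieldXi p)
    rw [Prod.snd_sum] at h
    ext k
    · rw [Prod.fst_sum]
      exact congrArg (fun v : E n => v k) h
    · simp [fieldX, Prod.snd_sum]
  simp only [opX_apply, ← Complex.real_smul, ← map_smul, ← map_sum, h, map_zero]

/-- Applying `Ξ_i` to `∑ ξ_j Ξ_j φ = 0` produces this, because `Ξ_i ξ_j = δ_ij - ξ_i ξ_j`.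
Contraction in the second index is thus not zero, in contrast with the first. -/
theorem sum_xi_opXi_opXi {φ : TSphere n → ℂ} (hφ : φ ∈ SchwartzTS n) (i : Fin n) (p : TSphere n) :
    ∑ j, (p.1.2 j : ℂ) * opXi i (opXi j φ) p = -opXi i φ p := by
  have h1 : ∀ v : E n, inner ℝ p.1.2 v = ∑ j, p.1.2 j * v j := fun v => by
    simp [PiLp.inner_apply, mul_comm]
  have hx := p.2.2
  rw [h1] at hx
  have hξ : ∑ j, p.1.2 j * p.1.2 j = 1 := by
    rw [← h1, real_inner_self_eq_norm_sq, p.2.1]; norm_num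
  have hd : ∑ j, p.1.2 j * (fieldXi i p.1).2 j = 0 := by rw [← h1]; exact inner_dir i p
  have hd1 : ∑ j, p.1.2 j * (fieldXi i p.1).1 j = -p.1.1 i := by
    rw [← h1, fieldXi]
    simp [inner_smul_right, p.2.1]
  simp only [opXi_opXi hφ, mul_add, Finset.sum_add_distrib, ← Complex.real_smul, ← map_smul,
    ← map_sum, sum_xi_fieldXi, map_zero, zero_add]
  rw [opXi_apply, ← map_neg]
  congr 1
  ext k
  · simp only [Prod.smul_mk, Prod.fst_sum, WithLp.ofLp_sum, Finset.sum_apply, PiLp.smul_apply,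
      PiLp.sub_apply, PiLp.neg_apply, smul_eq_mul, mul_sub, mul_neg, Finset.sum_sub_distrib,
      Finset.sum_neg_distrib, ← mul_assoc, ← Finset.sum_mul, hx, hd1]
    simp [fieldXi]
  · simp only [Prod.smul_mk, Prod.snd_sum, WithLp.ofLp_sum, Finset.sum_apply, PiLp.smul_apply,
      PiLp.sub_apply, PiLp.neg_apply, smul_eq_mul, mul_sub, mul_neg, Finset.sum_sub_distrib,
      Finset.sum_neg_distrib, ← mul_assoc, ← Finset.sum_mul, hξ, hd]
    simp [fieldXi]

end Operators

/-! ### The momentum ray transforms of Schwartz fields are Schwartz functions on `T𝕊ⁿ⁻¹`. -/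

section RayTransform

open MeasureTheory

variable {n : ℕ} {F : Type} [NormedAddCommGroup F] [NormedSpace ℝ F]

/-- The weighted line integral `∫ τ^k g(x + τξ) dτ`. -/
def lineMoment (k : ℕ) (g : 𝓢(E n, F)) (p : E n × E n) : F :=
  ∫ τ : ℝ, τ ^ k • g (p.1 + τ • p.2)

theorem schwartz_decay {V W : Type*} [NormedAddCommGroup V] [NormedSpace ℝ V]
    [NormedAddCommGroup W] [NormedSpace ℝ W] (g : 𝓢(V, W)) (N : ℕ) :
    ∃ C : ℝ, 0 ≤ C ∧ ∀ z, ‖g z‖ ≤ C * ((1 + ‖z‖) ^ N)⁻¹ := by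
  refine ⟨2 ^ N * (Finset.Iic (N, 0)).sup (fun m => SchwartzMap.seminorm ℝ m.1 m.2) g,
    by positivity, fun z => ?_⟩
  have := SchwartzMap.one_add_le_sup_seminorm_apply (𝕜 := ℝ) (m := (N, 0)) le_rfl le_rfl g z
  rw [norm_iteratedFDeriv_zero] at this
  rw [← div_eq_mul_inv, le_div_iff₀ (by positivity), mul_comm]
  exact this

theorem integrable_inv_one_add_pow {V : Type*} [NormedAddCommGroup V] [NormedSpace ℝ V]
    [FiniteDimensional ℝ V] [MeasurableSpace V] [BorelSpace V] (μ : Measure V)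
    [μ.IsAddHaarMeasure] {N : ℕ} (hN : Module.finrank ℝ V < N) :
    Integrable (fun x : V => ((1 + ‖x‖) ^ N)⁻¹) μ := by
  have := integrable_one_add_norm (E := V) (μ := μ) (r := N) (by exact_mod_cast hN)
  refine this.congr (Filter.Eventually.of_forall fun x => ?_)
  simp only
  rw [Real.rpow_neg (by positivity), Real.rpow_natCast]

theorem integrable_inv_one_add_abs_sq : Integrable fun τ : ℝ => ((1 + |τ|) ^ 2)⁻¹ := by
  simpa using integrable_inv_one_add_pow (V := ℝ) volume (N := 2) (by simp)

theorem one_add_abs_le {c R τ : ℝ} (hc : 0 < c) {x ξ : E n} (hξ : c ≤ ‖ξ‖)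
    (hx : ‖x‖ ≤ R) : 1 + |τ| ≤ (1 + (R + 1) / c) * (1 + ‖x + τ • ξ‖) := by
  have h1 : |τ| * c ≤ ‖x + τ • ξ‖ + R := by
    calc |τ| * c ≤ |τ| * ‖ξ‖ := by gcongr
      _ = ‖τ • ξ‖ := by rw [norm_smul, Real.norm_eq_abs]
      _ = ‖(x + τ • ξ) - x‖ := by congr 1; abel
      _ ≤ ‖x + τ • ξ‖ + ‖x‖ := norm_sub_le _ _
      _ ≤ _ := by gcongr
  have h2 : |τ| ≤ (‖x + τ • ξ‖ + R) / c := by rwa [le_div_iff₀ hc]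
  have hR : 0 ≤ R := (norm_nonneg x).trans hx
  have h3 : (‖x + τ • ξ‖ + R) / c ≤ (R + 1) / c * (1 + ‖x + τ • ξ‖) := by
    rw [div_mul_eq_mul_div]
    gcongr
    nlinarith [norm_nonneg (x + τ • ξ)]
  linarith [norm_nonneg (x + τ • ξ)]

/-- For `ξ` away from `0` and `x` bounded, `1+|τ|` is controlled by `1+|x+τξ|`. Of the `k + 2`
powers of decay, `k` pay for `τ^k` and two for integrability in `τ`. -/
theorem line_bound (g : 𝓢(E n, F)) (k : ℕ) {c R : ℝ} (hc : 0 < c) (hR : 0 ≤ R) :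
    ∃ C : ℝ, 0 ≤ C ∧ ∀ x ξ : E n, c ≤ ‖ξ‖ → ‖x‖ ≤ R → ∀ τ : ℝ,
      ‖τ ^ k • g (x + τ • ξ)‖ ≤ C * ((1 + |τ|) ^ 2)⁻¹ := by
  obtain ⟨C, hC0, hC⟩ := schwartz_decay g (k + 2)
  refine ⟨C * (1 + (R + 1) / c) ^ (k + 2), by positivity, fun x ξ hξ hx τ => ?_⟩
  have h1 := one_add_abs_le (τ := τ) hc hξ hx
  have h2 := pow_le_pow_left₀ (by positivity) h1 (k + 2)
  rw [mul_pow] at h2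
  have hτ : |τ| ^ k ≤ (1 + |τ|) ^ k := by gcongr; linarith
  calc ‖τ ^ k • g (x + τ • ξ)‖ = |τ| ^ k * ‖g (x + τ • ξ)‖ := by
        rw [norm_smul, norm_pow, Real.norm_eq_abs]
    _ ≤ (1 + |τ|) ^ k * (C * ((1 + ‖x + τ • ξ‖) ^ (k + 2))⁻¹) := by
        gcongr
        exact hC _
    _ ≤ _ := by
        rw [← div_eq_mul_inv, ← div_eq_mul_inv, mul_div_assoc', div_le_div_iff₀ (by positivity)
          (by positivity)]
        calc (1 + |τ|) ^ k * C * (1 + |τ|) ^ 2 = C * (1 + |τ|) ^ (k + 2) := by ring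
          _ ≤ C * ((1 + (R + 1) / c) ^ (k + 2) * (1 + ‖x + τ • ξ‖) ^ (k + 2)) := by gcongr
          _ = _ := by ring

theorem aestronglyMeasurable_line (g : 𝓢(E n, F)) (k : ℕ) (p : E n × E n) :
    AEStronglyMeasurable (fun τ : ℝ => τ ^ k • g (p.1 + τ • p.2)) := by
  have : Continuous fun τ : ℝ => τ ^ k • g (p.1 + τ • p.2) := by
    have := g.continuous
    fun_prop
  exact this.aestronglyMeasurable

theorem integrable_line (g : 𝓢(E n, F)) (k : ℕ) {p : E n × E n} (hp : p ∈ slit n) :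
    Integrable fun τ : ℝ => τ ^ k • g (p.1 + τ • p.2) := by
  obtain ⟨C, hC0, hC⟩ := line_bound g k (norm_pos_iff.mpr hp) (norm_nonneg p.1)
  exact (integrable_inv_one_add_abs_sq.const_mul C).mono' (aestronglyMeasurable_line g k p)
    (Filter.Eventually.of_forall fun τ => hC _ _ le_rfl le_rfl τ)

/-- Precomposition with the first projection. -/
def preFst (n : ℕ) (F : Type) [NormedAddCommGroup F] [NormedSpace ℝ F] :
    (E n →L[ℝ] F) →L[ℝ] (E n × E n →L[ℝ] F) :=
  (ContinuousLinearMap.compL ℝ (E n × E n) (E n) F).flip (ContinuousLinearMap.fst ℝ (E n) (E n))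

/-- Precomposition with the second projection. -/
def preSnd (n : ℕ) (F : Type) [NormedAddCommGroup F] [NormedSpace ℝ F] :
    (E n →L[ℝ] F) →L[ℝ] (E n × E n →L[ℝ] F) :=
  (ContinuousLinearMap.compL ℝ (E n × E n) (E n) F).flip (ContinuousLinearMap.snd ℝ (E n) (E n))

/-- Differentiation in `ξ` brings down a factor `τ`, hence the moment of order `k + 1`. The
derivative is again built from line moments, of a function with values in a space of linear maps;
the general target `F` allows an induction on the order of differentiation. -/
theorem hasFDerivAt_lineMoment [CompleteSpace F] (g : 𝓢(E n, F)) (k : ℕ) {p : E n × E n}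
    (hp : p ∈ slit n) :
    HasFDerivAt (lineMoment k g)
      (preFst n F (lineMoment k (SchwartzMap.fderivCLM ℝ (E n) F g) p) +
        preSnd n F (lineMoment (k + 1) (SchwartzMap.fderivCLM ℝ (E n) F g) p)) p := by
  have hp0 : 0 < ‖p.2‖ := norm_pos_iff.mpr hp
  set D := SchwartzMap.fderivCLM ℝ (E n) F g with hD
  -- On the ball of radius `‖p.2‖ / 2` about `p` the direction stays at least `‖p.2‖ / 2` in norm,
  -- so the integrals are uniformly dominated.
  obtain ⟨C, hC0, hC⟩ := line_bound D k (c := ‖p.2‖ / 2) (R := ‖p.1‖ + ‖p.2‖ / 2)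
    (by positivity) (by positivity)
  obtain ⟨C', hC0', hC'⟩ := line_bound D (k + 1) (c := ‖p.2‖ / 2) (R := ‖p.1‖ + ‖p.2‖ / 2)
    (by positivity) (by positivity)
  have key := hasFDerivAt_integral_of_dominated_of_fderiv_le (μ := (volume : Measure ℝ)) (𝕜 := ℝ)
    (F := fun (q : E n × E n) (τ : ℝ) => τ ^ k • g (q.1 + τ • q.2))
    (F' := fun q τ => preFst n F (τ ^ k • D (q.1 + τ • q.2)) +
      preSnd n F (τ ^ (k + 1) • D (q.1 + τ • q.2)))
    (x₀ := p) (s := Metric.ball p (‖p.2‖ / 2))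
    (bound := fun τ => (‖preFst n F‖ * C + ‖preSnd n F‖ * C') * ((1 + |τ|) ^ 2)⁻¹)
    (Metric.ball_mem_nhds _ (by positivity))
    (Filter.Eventually.of_forall fun q => aestronglyMeasurable_line g k q)
    (integrable_line g k hp)
    (((preFst n F).integrable_comp (integrable_line D k hp)).add
      ((preSnd n F).integrable_comp (integrable_line D (k + 1) hp))).aestronglyMeasurable
    (Filter.Eventually.of_forall fun τ q hq => by
      have hq' : ‖q - p‖ < ‖p.2‖ / 2 := by simpa [dist_eq_norm] using hq
      have h1 : ‖q.1 - p.1‖ ≤ ‖q - p‖ := norm_fst_le (q - p)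
      have h2 : ‖q.2 - p.2‖ ≤ ‖q - p‖ := norm_snd_le (q - p)
      have h3 : ‖q.1‖ ≤ ‖p.1‖ + ‖p.2‖ / 2 := by
        have := norm_le_norm_add_norm_sub p.1 q.1
        rw [norm_sub_rev] at this
        linarith
      have h4 : ‖p.2‖ / 2 ≤ ‖q.2‖ := by
        have := norm_le_norm_add_norm_sub q.2 p.2
        linarith
      calc _ ≤ ‖preFst n F‖ * ‖τ ^ k • D (q.1 + τ • q.2)‖ +
            ‖preSnd n F‖ * ‖τ ^ (k + 1) • D (q.1 + τ • q.2)‖ :=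
            (norm_add_le _ _).trans (add_le_add ((preFst n F).le_opNorm _)
              ((preSnd n F).le_opNorm _))
        _ ≤ ‖preFst n F‖ * (C * ((1 + |τ|) ^ 2)⁻¹) + ‖preSnd n F‖ * (C' * ((1 + |τ|) ^ 2)⁻¹) := by
            gcongr
            · exact hC _ _ h4 h3 τ
            · exact hC' _ _ h4 h3 τ
        _ = _ := by ring)
    (integrable_inv_one_add_abs_sq.const_mul _)
    (Filter.Eventually.of_forall fun τ q _ => by
      have hl : HasFDerivAt (fun q : E n × E n => q.1 + τ • q.2)
          (ContinuousLinearMap.fst ℝ (E n) (E n) + τ • ContinuousLinearMap.snd ℝ (E n) (E n)) q :=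
        (ContinuousLinearMap.fst ℝ (E n) (E n) +
          τ • ContinuousLinearMap.snd ℝ (E n) (E n)).hasFDerivAt
      have := (((g.hasFDerivAt (q.1 + τ • q.2)).comp q hl).const_smul (τ ^ k))
      refine this.congr_fderiv ?_
      ext v
      · simp [preFst, preSnd, hD, SchwartzMap.fderivCLM_apply]
      · simp [preFst, preSnd, hD, SchwartzMap.fderivCLM_apply, pow_succ, mul_smul])
  rw [integral_add ((preFst n F).integrable_comp (integrable_line D k hp))
    ((preSnd n F).integrable_comp (integrable_line D (k + 1) hp)),
    (preFst n F).integral_comp_comm (integrable_line D k hp),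
    (preSnd n F).integral_comp_comm (integrable_line D (k + 1) hp)] at key
  exact key

theorem contDiffOn_lineMoment (l : ℕ) : ∀ (F : Type) [NormedAddCommGroup F] [NormedSpace ℝ F]
    [CompleteSpace F] (g : 𝓢(E n, F)) (k : ℕ), ContDiffOn ℝ l (lineMoment k g) (slit n) := by
  induction l with
  | zero =>
    intro F _ _ _ g k
    exact contDiffOn_zero.mpr fun p hp =>
      (hasFDerivAt_lineMoment g k hp).continuousAt.continuousWithinAt
  | succ l ih =>
    intro F _ _ _ g k
    push_cast
    rw [contDiffOn_succ_iff_fderiv_of_isOpen (isOpen_slit n)]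
    refine ⟨fun p hp => (hasFDerivAt_lineMoment g k hp).differentiableAt.differentiableWithinAt,
      by simp, ?_⟩
    refine ContDiffOn.congr ?_ fun p hp => (hasFDerivAt_lineMoment g k hp).fderiv
    exact ((preFst n F).contDiff.comp_contDiffOn (ih _ _ _)).add
      ((preSnd n F).contDiff.comp_contDiffOn (ih _ _ _))

theorem norm_sq_add_smul (p : TSphere n) (τ : ℝ) :
    ‖p.1.1 + τ • p.1.2‖ ^ 2 = ‖p.1.1‖ ^ 2 + τ ^ 2 := by
  rw [norm_add_sq_real, inner_smul_right, real_inner_comm, p.2.2, norm_smul, p.2.1]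
  simp

/-- Orthogonality gives `|x+τξ|² = |x|²+τ²`, so `|x+τξ|` dominates both `|x|` and `|τ|`. The decay
of `g` is split between the factor `(1+|x|)^m` and an integrable function of `τ`. -/
theorem lineMoment_bound (g : 𝓢(E n, F)) (k m : ℕ) :
    ∃ C : ℝ, ∀ p : TSphere n, (1 + ‖p.1.1‖) ^ m * ‖lineMoment k g p.1‖ ≤ C := by
  obtain ⟨C, hC0, hC⟩ := schwartz_decay g (m + (k + 2))
  refine ⟨C * ∫ τ : ℝ, ((1 + |τ|) ^ 2)⁻¹, fun p => ?_⟩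
  rw [← integral_const_mul, ← Real.norm_of_nonneg (by positivity : 0 ≤ (1 + ‖p.1.1‖) ^ m),
    ← norm_smul, lineMoment, ← integral_smul]
  refine norm_integral_le_of_norm_le (integrable_inv_one_add_abs_sq.const_mul C)
    (Filter.Eventually.of_forall fun τ => ?_)
  have hsq := norm_sq_add_smul p τ
  have h1 : ‖p.1.1‖ ≤ ‖p.1.1 + τ • p.1.2‖ :=
    abs_le_of_sq_le_sq' (by nlinarith [sq_nonneg τ]) (norm_nonneg _) |>.2
  have h2 : |τ| ≤ ‖p.1.1 + τ • p.1.2‖ :=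
    abs_le_of_sq_le_sq (by nlinarith [sq_nonneg ‖p.1.1‖]) (norm_nonneg _)
  rw [norm_smul, norm_smul, norm_pow, norm_pow, Real.norm_eq_abs, Real.norm_eq_abs,
    abs_of_nonneg (by positivity : 0 ≤ 1 + ‖p.1.1‖)]
  have hτ : |τ| ^ k ≤ (1 + |τ|) ^ k := by gcongr; linarith
  calc (1 + ‖p.1.1‖) ^ m * (|τ| ^ k * ‖g (p.1.1 + τ • p.1.2)‖)
      ≤ (1 + ‖p.1.1‖) ^ m * ((1 + |τ|) ^ k *
          (C * ((1 + ‖p.1.1 + τ • p.1.2‖) ^ (m + (k + 2)))⁻¹)) := by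
        gcongr
        exact hC _
    _ ≤ (1 + ‖p.1.1‖) ^ m * ((1 + |τ|) ^ k *
          (C * ((1 + ‖p.1.1‖) ^ m * (1 + |τ|) ^ (k + 2))⁻¹)) := by
        rw [pow_add (1 + ‖p.1.1 + τ • p.1.2‖)]
        gcongr
    _ = _ := by
        field_simp
        ring

theorem RapidTS.of_lineMoment_bounds (l : ℕ) : ∀ (F : Type) [NormedAddCommGroup F]
    [NormedSpace ℝ F] [CompleteSpace F] (g : 𝓢(E n, F)) (k m : ℕ),
    ∃ C : ℝ, ∀ p : TSphere n, (1 + ‖p.1.1‖) ^ m * ‖iteratedFDeriv ℝ l (lineMoment k g) p.1‖ ≤ C := by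
  induction l with
  | zero =>
    intro F _ _ _ g k m
    simpa using lineMoment_bound g k m
  | succ l ih =>
    intro F _ _ _ g k m
    set D := SchwartzMap.fderivCLM ℝ (E n) F g with hD
    obtain ⟨A, hA⟩ := ih _ D k m
    obtain ⟨B, hB⟩ := ih _ D (k + 1) m
    refine ⟨‖preFst n F‖ * A + ‖preSnd n F‖ * B, fun p => ?_⟩
    have hcd (k' : ℕ) : ContDiffAt ℝ l (lineMoment k' D) p.1 :=
      (contDiffOn_lineMoment l _ D k').contDiffAt ((isOpen_slit n).mem_nhds (mem_slit p))
    have heq : Set.EqOn (_root_.fderiv ℝ (lineMoment k g)) (fun q => preFst n F (lineMoment k D q) +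
        preSnd n F (lineMoment (k + 1) D q)) (slit n) := fun q hq =>
      (hasFDerivAt_lineMoment g k hq).fderiv
    rw [← norm_iteratedFDeriv_fderiv, iteratedFDeriv_congr_slit heq]
    have hadd := iteratedFDeriv_add_apply ((preFst n F).contDiff.contDiffAt.comp _ (hcd k))
      ((preSnd n F).contDiff.contDiffAt.comp _ (hcd (k + 1)))
    have h1 := (preFst n F).norm_iteratedFDeriv_comp_left (hcd k) le_rfl
    have h2 := (preSnd n F).norm_iteratedFDeriv_comp_left (hcd (k + 1)) le_rfl
    calc _ ≤ (1 + ‖p.1.1‖) ^ m * (‖preFst n F‖ * ‖iteratedFDeriv ℝ l (lineMoment k D) p.1‖ +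
          ‖preSnd n F‖ * ‖iteratedFDeriv ℝ l (lineMoment (k + 1) D) p.1‖) := by
          gcongr
          refine (congrArg norm hadd).trans_le ((norm_add_le _ _).trans (add_le_add h1 h2))
      _ = ‖preFst n F‖ * ((1 + ‖p.1.1‖) ^ m * ‖iteratedFDeriv ℝ l (lineMoment k D) p.1‖) +
          ‖preSnd n F‖ * ((1 + ‖p.1.1‖) ^ m * ‖iteratedFDeriv ℝ l (lineMoment (k + 1) D) p.1‖) := by
          ring
      _ ≤ _ := by gcongr <;> first | exact hA p | exact hB p

theorem rapidTS_lineMoment [CompleteSpace F] (g : 𝓢(E n, F)) (k : ℕ) :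
    RapidTS (lineMoment k g) :=
  ⟨contDiffOn_infty.mpr fun l => contDiffOn_lineMoment l F g k,
    fun m l => RapidTS.of_lineMoment_bounds l F g k m⟩

/-- The coordinate `f_{ij}` as a Schwartz function. -/
def compS (f : TensorField n) (i j : Fin n) : 𝓢(E n, ℂ) :=
  SchwartzMap.postcompCLM (𝕜 := ℂ)
    ((EuclideanSpace.proj (i, j) : EuclideanSpace ℂ (Fin n × Fin n) →L[ℂ] ℂ).comp
      (SymTensor n).subtypeL) f

theorem compS_apply (f : TensorField n) (i j : Fin n) (x : E n) :
    compS f i j x = comp f i j x := rfl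

theorem comp_symm (f : TensorField n) (i j : Fin n) : comp f i j = comp f j i :=
  funext fun x => (f x).2 i j

theorem rayTransform_eq (k : ℕ) (f : TensorField n) (p : TSphere n) :
    rayTransform k f p = ∑ i, ∑ j, (p.1.2 i * p.1.2 j) • lineMoment k (compS f i j) p.1 := by
  have hint (i j : Fin n) : Integrable fun τ : ℝ =>
      (p.1.2 i * p.1.2 j) • τ ^ k • compS f i j (p.1.1 + τ • p.1.2) :=
    (integrable_line (compS f i j) k (mem_slit p)).smul (p.1.2 i * p.1.2 j)
  simp only [rayTransform, lineMoment, ← integral_smul]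
  rw [Finset.sum_congr rfl fun i _ => (integral_finsetSum _ fun j _ => hint i j).symm,
    ← integral_finsetSum _ fun i _ => integrable_finsetSum _ fun j _ => hint i j]
  congr 1
  funext τ
  rw [Finset.mul_sum]
  refine Finset.sum_congr rfl fun i _ => ?_
  rw [Finset.mul_sum]
  refine Finset.sum_congr rfl fun j _ => ?_
  simp only [compS_apply, Complex.real_smul]
  push_cast
  ring

theorem rayTransform_mem (k : ℕ) (f : TensorField n) : rayTransform k f ∈ SchwartzTS n := by
  refine RapidTS.mem_SchwartzTS (Φ := fun p => ∑ i, ∑ j,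
    (p.2 i * p.2 j) • lineMoment k (compS f i j) p) ?_ (rayTransform_eq k f)
  refine RapidTS.sum _ fun i _ => RapidTS.sum _ fun j _ => ?_
  exact (rapidTS_lineMoment (compS f i j) k).bilinear
    ((growTS_xi_coord i).bilinear (growTS_xi_coord j) (ContinuousLinearMap.lsmul ℝ ℝ))
    (ContinuousLinearMap.lsmul ℝ ℝ).flip

end RayTransform

/-! ### Gaussian damping in the normal direction, and decay of the resulting functions on `ℝⁿ`. -/

section Lift

open MeasureTheory

variable {n : ℕ}

/-- The linear map `(x, ξ) ↦ (x - aξ, cξ)`. -/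
def shear (n : ℕ) (a c : ℝ) : E n × E n →L[ℝ] E n × E n :=
  (ContinuousLinearMap.fst ℝ (E n) (E n) - a • ContinuousLinearMap.snd ℝ (E n) (E n)).prod
    (c • ContinuousLinearMap.snd ℝ (E n) (E n))

theorem shear_apply (a c : ℝ) (p : E n × E n) : shear n a c p = (p.1 - a • p.2, c • p.2) := rfl

theorem norm_shear_le (a c : ℝ) : ‖shear n a c‖ ≤ 1 + |a| + |c| := by
  refine ContinuousLinearMap.opNorm_le_bound _ (by positivity) fun p => ?_
  rw [shear_apply]
  have h1 := norm_fst_le p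
  have h2 := norm_snd_le p
  refine max_le ?_ ?_
  · calc ‖p.1 - a • p.2‖ ≤ ‖p.1‖ + |a| * ‖p.2‖ := by
          rw [← Real.norm_eq_abs, ← norm_smul]; exact norm_sub_le _ _
      _ ≤ ‖p‖ + |a| * ‖p‖ := by gcongr
      _ ≤ _ := by nlinarith [mul_nonneg (abs_nonneg c) (norm_nonneg p)]
  · calc ‖c • p.2‖ = |c| * ‖p.2‖ := by rw [norm_smul, Real.norm_eq_abs]
      _ ≤ |c| * ‖p‖ := by gcongr
      _ ≤ _ := by nlinarith [mul_nonneg (abs_nonneg a) (norm_nonneg p), norm_nonneg p]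

/-- Sliding `x` along `ξ` and rescaling `ξ` positively stay within a fibre of the retraction.
Extensions are therefore invariant under such shears, and their derivative at any point is the one
at the retracted point composed with a shear (`fderiv_extend_ret`). -/
theorem ret_shear (a : ℝ) {c : ℝ} (hc : 0 < c) {p : E n × E n} (hp : p ∈ slit n) :
    ret (shear n a c p) = ret p := by
  have h : ‖p.2‖ ≠ 0 := norm_ne_zero_iff.mpr hp
  have hc' : c ≠ 0 := hc.ne'
  simp only [ret, shear_apply, norm_smul, Real.norm_of_nonneg hc.le, inner_smul_left,
    inner_sub_right, inner_smul_right, real_inner_self_eq_norm_sq, conj_trivial, smul_smul]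
  ext k
  · simp only [PiLp.sub_apply, PiLp.smul_apply, smul_eq_mul]
    field_simp
    ring
  · simp only [PiLp.smul_apply, smul_eq_mul]
    field_simp

theorem shear_mem_slit (a : ℝ) {c : ℝ} (hc : 0 < c) {p : E n × E n} (hp : p ∈ slit n) :
    shear n a c p ∈ slit n := smul_ne_zero hc.ne' hp

theorem extend_shear (φ : TSphere n → ℂ) (a : ℝ) {c : ℝ} (hc : 0 < c) {p : E n × E n}
    (hp : p ∈ slit n) : extend φ (shear n a c p) = extend φ p := by
  rw [extend_apply (shear_mem_slit a hc hp), extend_apply hp]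
  congr 1
  exact Subtype.ext (ret_shear a hc hp)

theorem fderiv_extend_shear {φ : TSphere n → ℂ} (hφ : φ ∈ SchwartzTS n) (a : ℝ) {c : ℝ}
    (hc : 0 < c) {p : E n × E n} (hp : p ∈ slit n) :
    fderiv ℝ (extend φ) p = (fderiv ℝ (extend φ) (shear n a c p)).comp (shear n a c) := by
  have hev : extend φ =ᶠ[nhds p] extend φ ∘ shear n a c :=
    Filter.eventually_of_mem ((isOpen_slit n).mem_nhds hp) fun q hq =>
      (extend_shear φ a hc hq).symm
  have hd : DifferentiableAt ℝ (extend φ) (shear n a c p) :=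
    (hφ.1.contDiffAt ((isOpen_slit n).mem_nhds (shear_mem_slit a hc hp))).differentiableAt (by simp)
  rw [hev.fderiv_eq, fderiv_comp _ hd (shear n a c).differentiableAt, ContinuousLinearMap.fderiv]

theorem ret_eq_shear (p : E n × E n) :
    ret p = shear n (inner ℝ p.2 p.1 / ‖p.2‖ ^ 2) (‖p.2‖⁻¹) p := rfl

theorem fderiv_extend_ret {φ : TSphere n → ℂ} (hφ : φ ∈ SchwartzTS n) {p : E n × E n}
    (hp : p ∈ slit n) :
    fderiv ℝ (extend φ) p = (fderiv ℝ (extend φ) (ret p)).comp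
      (shear n (inner ℝ p.2 p.1 / ‖p.2‖ ^ 2) (‖p.2‖⁻¹)) := by
  rw [ret_eq_shear]
  exact fderiv_extend_shear hφ _ (inv_pos.mpr (norm_pos_iff.mpr hp)) hp

/-- The extension of `φ` damped by a Gaussian in the normal direction. -/
def lift (φ : TSphere n → ℂ) (p : E n × E n) : ℂ :=
  extend φ p * ((Real.exp (-(inner ℝ p.2 p.1) ^ 2 / 2) : ℝ) : ℂ)

/-- The inequality `(|s|-1)² ≥ 0` reads `-s²/2 ≤ 3/2 - (1+|s|)`, and the exponential dominates
`(1+|s|)^N / N!`. -/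
theorem exp_neg_sq_le (N : ℕ) (s : ℝ) :
    Real.exp (-s ^ 2 / 2) ≤ Real.exp (3 / 2) * N.factorial * ((1 + |s|) ^ N)⁻¹ := by
  have h1 := Real.pow_div_factorial_le_exp (1 + |s|) (by positivity) N
  have h2 : Real.exp (-s ^ 2 / 2) ≤ Real.exp (3 / 2) * Real.exp (-(1 + |s|)) := by
    rw [← Real.exp_add]
    gcongr
    nlinarith [sq_nonneg (|s| - 1), sq_abs s]
  refine h2.trans ?_
  rw [mul_assoc]
  gcongr
  rw [Real.exp_neg, ← div_eq_mul_inv, inv_le_comm₀ (Real.exp_pos _) (by positivity), inv_div]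
  exact h1

theorem norm_ret_fst_sq (p : E n × E n) (hp : p ∈ slit n) :
    ‖p.1‖ ^ 2 = ‖(ret p).1‖ ^ 2 + (inner ℝ p.2 p.1 / ‖p.2‖) ^ 2 := by
  have h : ‖p.2‖ ≠ 0 := norm_ne_zero_iff.mpr hp
  simp only [ret]
  rw [norm_sub_sq_real, norm_smul, inner_smul_right, real_inner_comm, Real.norm_eq_abs, mul_pow,
    sq_abs]
  field_simp
  ring

/-- The vector `x` is the orthogonal sum of its retraction and its part along `ξ`, of length
`|⟨ξ,x⟩|/|ξ| ≤ 2|⟨ξ,x⟩|`. So decay in the retracted point and Gaussian decay in `⟨ξ,x⟩` combine into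
decay in `x`. -/
theorem one_add_norm_le (p : E n × E n) (hp : 1 / 2 ≤ ‖p.2‖) :
    1 + ‖p.1‖ ≤ 2 * ((1 + ‖(ret p).1‖) * (1 + |inner ℝ p.2 p.1|)) := by
  have hp0 : 0 < ‖p.2‖ := by linarith
  have h := norm_ret_fst_sq p (norm_pos_iff.mp hp0)
  have h1 : |inner ℝ p.2 p.1 / ‖p.2‖| ≤ 2 * |inner ℝ p.2 p.1| := by
    rw [abs_div, abs_of_pos hp0, div_le_iff₀ hp0]
    nlinarith [abs_nonneg (inner ℝ p.2 p.1)]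
  have h2 : ‖p.1‖ ≤ ‖(ret p).1‖ + |inner ℝ p.2 p.1 / ‖p.2‖| := by
    refine abs_le_of_sq_le_sq' ?_ (by positivity) |>.2
    rw [h, ← sq_abs (inner ℝ p.2 p.1 / ‖p.2‖)]
    nlinarith [mul_nonneg (norm_nonneg (ret p).1) (abs_nonneg (inner ℝ p.2 p.1 / ‖p.2‖))]
  nlinarith [norm_nonneg (ret p).1, abs_nonneg (inner ℝ p.2 p.1),
    mul_nonneg (norm_nonneg (ret p).1) (abs_nonneg (inner ℝ p.2 p.1))]

theorem inv_pow_bound (N : ℕ) (p : E n × E n) (hp : 1 / 2 ≤ ‖p.2‖) :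
    ((1 + ‖(ret p).1‖) ^ N)⁻¹ * ((1 + |inner ℝ p.2 p.1|) ^ N)⁻¹ ≤
      2 ^ N * ((1 + ‖p.1‖) ^ N)⁻¹ := by
  rw [← mul_inv, ← mul_pow, ← div_eq_mul_inv, le_div_iff₀ (by positivity),
    inv_mul_le_iff₀ (by positivity), ← mul_pow]
  refine pow_le_pow_left₀ (by positivity) ?_ N
  have := one_add_norm_le p hp
  linarith

theorem retract_mem {p : E n × E n} (hp : p ∈ slit n) :
    ∃ q : TSphere n, q.1 = ret p := ⟨retract p hp, rfl⟩

theorem extend_decay {φ : TSphere n → ℂ} (hφ : φ ∈ SchwartzTS n) (N : ℕ) :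
    ∃ C : ℝ, 0 ≤ C ∧ ∀ p : E n × E n, p ∈ slit n →
      ‖extend φ p‖ ≤ C * ((1 + ‖(ret p).1‖) ^ N)⁻¹ ∧
      ‖fderiv ℝ (extend φ) (ret p)‖ ≤ C * ((1 + ‖(ret p).1‖) ^ N)⁻¹ := by
  obtain ⟨C, hC0, hC⟩ := (mem_SchwartzTS_iff.mp hφ).uniform N 1
  refine ⟨C, hC0, fun p hp => ?_⟩
  obtain ⟨q, hq⟩ := retract_mem hp
  have h0 := hC 0 (by norm_num) q
  have h1 := hC 1 le_rfl q
  rw [norm_iteratedFDeriv_zero, hq] at h0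
  rw [norm_iteratedFDeriv_one, hq] at h1
  have he : extend φ (ret p) = extend φ p := by
    rw [ret_eq_shear]; exact extend_shear φ _ (inv_pos.mpr (norm_pos_iff.mpr hp)) hp
  rw [he] at h0
  rw [← div_eq_mul_inv, le_div_iff₀ (by positivity), le_div_iff₀ (by positivity)]
  constructor <;> linarith

theorem lift_bound {φ : TSphere n → ℂ} (hφ : φ ∈ SchwartzTS n) (N : ℕ) :
    ∃ C : ℝ, 0 ≤ C ∧ ∀ p : E n × E n, 1 / 2 ≤ ‖p.2‖ → ‖lift φ p‖ ≤ C * ((1 + ‖p.1‖) ^ N)⁻¹ := by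
  obtain ⟨C, hC0, hC⟩ := extend_decay hφ N
  refine ⟨C * (Real.exp (3 / 2) * N.factorial) * 2 ^ N, by positivity, fun p hp => ?_⟩
  have hp' : p ∈ slit n := norm_pos_iff.mp (by linarith)
  rw [lift, norm_mul, Complex.norm_real, Real.norm_of_nonneg (Real.exp_pos _).le]
  calc _ ≤ (C * ((1 + ‖(ret p).1‖) ^ N)⁻¹) *
        (Real.exp (3 / 2) * N.factorial * ((1 + |inner ℝ p.2 p.1|) ^ N)⁻¹) := by
        gcongr
        · exact (hC p hp').1
        · exact exp_neg_sq_le N _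
    _ = C * (Real.exp (3 / 2) * N.factorial) *
        (((1 + ‖(ret p).1‖) ^ N)⁻¹ * ((1 + |inner ℝ p.2 p.1|) ^ N)⁻¹) := by ring
    _ ≤ C * (Real.exp (3 / 2) * N.factorial) * (2 ^ N * ((1 + ‖p.1‖) ^ N)⁻¹) :=
        mul_le_mul_of_nonneg_left (inv_pow_bound N p hp) (by positivity)
    _ = _ := by ring

/-- The derivative of `(x, ξ) ↦ ⟨ξ, x⟩`. -/
def dpair (p : E n × E n) : E n × E n →L[ℝ] ℝ :=
  (innerSL ℝ p.2).comp (ContinuousLinearMap.fst ℝ (E n) (E n)) +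
    (innerSL ℝ p.1).comp (ContinuousLinearMap.snd ℝ (E n) (E n))

theorem dpair_apply (p v : E n × E n) : dpair p v = inner ℝ p.2 v.1 + inner ℝ p.1 v.2 := rfl

theorem norm_dpair_le (p : E n × E n) : ‖dpair p‖ ≤ ‖p.2‖ + ‖p.1‖ := by
  refine ContinuousLinearMap.opNorm_le_bound _ (by positivity) fun v => ?_
  rw [dpair_apply, add_mul]
  have h1 := norm_fst_le v
  have h2 := norm_snd_le v
  calc _ ≤ ‖p.2‖ * ‖v.1‖ + ‖p.1‖ * ‖v.2‖ :=
        (norm_add_le _ _).trans (add_le_add (norm_inner_le_norm _ _) (norm_inner_le_norm _ _))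
    _ ≤ _ := by gcongr

theorem hasFDerivAt_lift {φ : TSphere n → ℂ} (hφ : φ ∈ SchwartzTS n) {p : E n × E n}
    (hp : p ∈ slit n) : ∃ L : E n × E n →L[ℝ] ℂ, HasFDerivAt (lift φ) L p ∧ ∀ v, L v =
      (fderiv ℝ (extend φ) p v - (inner ℝ p.2 p.1 * dpair p v : ℝ) * extend φ p) *
        ((Real.exp (-(inner ℝ p.2 p.1) ^ 2 / 2) : ℝ) : ℂ) := by
  have hd : DifferentiableAt ℝ (extend φ) p :=
    (hφ.1.contDiffAt ((isOpen_slit n).mem_nhds hp)).differentiableAt (by simp)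
  have hi : HasFDerivAt (fun p : E n × E n => inner ℝ p.2 p.1) (dpair p) p := by
    refine (HasFDerivAt.inner ℝ (ContinuousLinearMap.snd ℝ (E n) (E n)).hasFDerivAt
      (ContinuousLinearMap.fst ℝ (E n) (E n)).hasFDerivAt).congr_fderiv ?_
    ext v <;> simp [dpair, real_inner_comm]
  have he : HasFDerivAt (fun p : E n × E n => Real.exp (-(inner ℝ p.2 p.1) ^ 2 / 2)) _ p :=
    ((hi.pow 2).neg.mul_const ((2 : ℝ)⁻¹)).exp
  have hc := (Complex.ofRealCLM.hasFDerivAt (x := Real.exp (-(inner ℝ p.2 p.1) ^ 2 / 2))).comp p he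
  refine ⟨_, hd.hasFDerivAt.mul hc, fun v => ?_⟩
  simp [div_eq_mul_inv]
  ring

theorem lift_fderiv_bound {φ : TSphere n → ℂ} (hφ : φ ∈ SchwartzTS n) (N : ℕ) :
    ∃ C : ℝ, 0 ≤ C ∧ ∀ p : E n × E n, 1 / 2 ≤ ‖p.2‖ → ‖p.2‖ ≤ 2 →
      ‖fderiv ℝ (lift φ) p‖ ≤ C * ((1 + ‖p.1‖) ^ N)⁻¹ := by
  -- The two extra powers pay for the norm of the shear, linear in `|x|`, and for the derivative of
  -- the Gaussian, quadratic in `|x|`. Together these losses are `3 + 6r + 2r² ≤ 11 (1+r)²` with `r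
  -- = |x|`.
  obtain ⟨C, hC0, hC⟩ := extend_decay hφ (N + 2)
  refine ⟨11 * C * (Real.exp (3 / 2) * (N + 2).factorial) * 2 ^ (N + 2), by positivity,
    fun p hp hp2 => ?_⟩
  have hp0 : 0 < ‖p.2‖ := by linarith
  have hp' : p ∈ slit n := norm_pos_iff.mp hp0
  obtain ⟨L, hL, hLv⟩ := hasFDerivAt_lift hφ hp'
  set g := Real.exp (-(inner ℝ p.2 p.1) ^ 2 / 2) with hg
  set w := ((1 + ‖(ret p).1‖) ^ (N + 2))⁻¹ with hw
  have hw0 : 0 ≤ w := by positivity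
  have hg0 : 0 ≤ g := (Real.exp_pos _).le
  have hip : |inner ℝ p.2 p.1| ≤ 2 * ‖p.1‖ := (abs_real_inner_le_norm _ _).trans (by gcongr)
  have hsh : ‖shear n (inner ℝ p.2 p.1 / ‖p.2‖ ^ 2) (‖p.2‖⁻¹)‖ ≤ 3 + 2 * ‖p.1‖ := by
    refine (norm_shear_le _ _).trans ?_
    have h1 : |‖p.2‖⁻¹| ≤ 2 := by
      rw [abs_of_pos (inv_pos.mpr hp0), inv_le_comm₀ hp0 two_pos]
      linarith
    have h2 : |inner ℝ p.2 p.1 / ‖p.2‖ ^ 2| ≤ 2 * ‖p.1‖ := by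
      rw [abs_div, abs_of_pos (by positivity : 0 < ‖p.2‖ ^ 2), div_le_iff₀ (by positivity)]
      calc _ ≤ ‖p.2‖ * ‖p.1‖ := abs_real_inner_le_norm _ _
        _ ≤ _ := by nlinarith [norm_nonneg p.1, mul_nonneg hp0.le (norm_nonneg p.1)]
    linarith
  have hop : ‖fderiv ℝ (extend φ) p‖ ≤ C * w * (3 + 2 * ‖p.1‖) := by
    rw [fderiv_extend_ret hφ hp']
    refine (ContinuousLinearMap.opNorm_comp_le _ _).trans ?_
    gcongr
    exact (hC p hp').2
  have hLn : ‖L‖ ≤ 11 * C * w * g * (1 + ‖p.1‖) ^ 2 := by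
    refine ContinuousLinearMap.opNorm_le_bound _ (by positivity) fun v => ?_
    rw [hLv, norm_mul, Complex.norm_real, Real.norm_of_nonneg hg0]
    have h1 : ‖fderiv ℝ (extend φ) p v‖ ≤ C * w * (3 + 2 * ‖p.1‖) * ‖v‖ :=
      (ContinuousLinearMap.le_opNorm _ _).trans (by gcongr)
    have h2 : ‖((inner ℝ p.2 p.1 * dpair p v : ℝ) : ℂ) * extend φ p‖ ≤
        (2 * ‖p.1‖ * ((2 + ‖p.1‖) * ‖v‖)) * (C * w) := by
      rw [norm_mul, Complex.norm_real, norm_mul, Real.norm_eq_abs]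
      gcongr
      · exact ((dpair p).le_opNorm v).trans (by
          gcongr
          exact (norm_dpair_le p).trans (by gcongr))
      · exact (hC p hp').1
    calc _ ≤ (C * w * (3 + 2 * ‖p.1‖) * ‖v‖ + (2 * ‖p.1‖ * ((2 + ‖p.1‖) * ‖v‖)) * (C * w)) * g := by
          gcongr
          exact (norm_sub_le _ _).trans (add_le_add h1 h2)
      _ = (C * w * g * ‖v‖) * (3 + 6 * ‖p.1‖ + 2 * ‖p.1‖ ^ 2) := by ring
      _ ≤ (C * w * g * ‖v‖) * (11 * (1 + ‖p.1‖) ^ 2) := by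
          gcongr
          nlinarith [norm_nonneg p.1]
      _ = _ := by ring
  rw [hL.fderiv]
  calc ‖L‖ ≤ 11 * C * w * g * (1 + ‖p.1‖) ^ 2 := hLn
    _ ≤ 11 * C * w * (Real.exp (3 / 2) * (N + 2).factorial *
        ((1 + |inner ℝ p.2 p.1|) ^ (N + 2))⁻¹) * (1 + ‖p.1‖) ^ 2 := by
        gcongr
        exact exp_neg_sq_le (N + 2) _
    _ = 11 * C * (Real.exp (3 / 2) * (N + 2).factorial) *
        (w * ((1 + |inner ℝ p.2 p.1|) ^ (N + 2))⁻¹) * (1 + ‖p.1‖) ^ 2 := by ring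
    _ ≤ 11 * C * (Real.exp (3 / 2) * (N + 2).factorial) *
        (2 ^ (N + 2) * ((1 + ‖p.1‖) ^ (N + 2))⁻¹) * (1 + ‖p.1‖) ^ 2 :=
        mul_le_mul_of_nonneg_right
          (mul_le_mul_of_nonneg_left (inv_pow_bound (N + 2) p hp) (by positivity)) (by positivity)
    _ = _ := by
        rw [pow_add (1 + ‖p.1‖)]
        field_simp

theorem contDiffOn_lift {φ : TSphere n → ℂ} (hφ : φ ∈ SchwartzTS n) :
    ContDiffOn ℝ ∞ (lift φ) (slit n) := by
  refine hφ.1.mul (Complex.ofRealCLM.contDiff.comp_contDiffOn ?_)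
  have : ContDiff ℝ ∞ fun p : E n × E n => Real.exp (-(inner ℝ p.2 p.1) ^ 2 / 2) :=
    ((((contDiff_snd.inner ℝ contDiff_fst).pow 2).neg).div_const 2).exp
  exact this.contDiffOn

end Lift

/-! ### Fourier integrals over `ℝⁿ` depending on the parameter `ξ`. -/

section ParametricFourier

open MeasureTheory

variable {n : ℕ}

/-- The kernel `e^{-i⟨y, x⟩}`. -/
def kernelExp (y x : E n) : ℂ := Complex.exp (-Complex.I * ((inner ℝ y x : ℝ) : ℂ))

theorem norm_kernelExp (y x : E n) : ‖kernelExp y x‖ = 1 := by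
  rw [kernelExp, Complex.norm_exp]
  simp

theorem continuous_kernelExp (y : E n) : Continuous (kernelExp y) := by
  unfold kernelExp
  fun_prop

/-- Smooth symbols `Λ(x, ξ)` with decay in `x` locally uniform near the unit sphere. -/
structure DecaySymbol (Λ : E n × E n → ℂ) : Prop where
  contDiffOn : ContDiffOn ℝ ∞ Λ (slit n)
  bound : ∀ N : ℕ, ∃ C : ℝ, 0 ≤ C ∧ ∀ p : E n × E n, 1 / 2 ≤ ‖p.2‖ → ‖p.2‖ ≤ 2 →
    ‖Λ p‖ ≤ C * ((1 + ‖p.1‖) ^ N)⁻¹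
  fderiv_bound : ∀ N : ℕ, ∃ C : ℝ, 0 ≤ C ∧ ∀ p : E n × E n, 1 / 2 ≤ ‖p.2‖ → ‖p.2‖ ≤ 2 →
    ‖fderiv ℝ Λ p‖ ≤ C * ((1 + ‖p.1‖) ^ N)⁻¹

theorem decaySymbol_lift {φ : TSphere n → ℂ} (hφ : φ ∈ SchwartzTS n) : DecaySymbol (lift φ) where
  contDiffOn := contDiffOn_lift hφ
  bound N := by
    obtain ⟨C, h0, h⟩ := lift_bound hφ N
    exact ⟨C, h0, fun p hp _ => h p hp⟩
  fderiv_bound N := lift_fderiv_bound hφ N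

/-- The partial Fourier integral `∫ e^{-i⟨y, x⟩} Λ(x, ξ) dx`. -/
def partialFourier (Λ : E n × E n → ℂ) (p : E n × E n) : ℂ :=
  ∫ x : E n, kernelExp p.1 x * Λ (x, p.2)

variable {Λ : E n × E n → ℂ}

theorem DecaySymbol.differentiableAt (h : DecaySymbol Λ) {p : E n × E n} (hp : p ∈ slit n) :
    DifferentiableAt ℝ Λ p :=
  (h.contDiffOn.contDiffAt ((isOpen_slit n).mem_nhds hp)).differentiableAt (by simp)

theorem continuous_slice {F : Type*} [TopologicalSpace F] {Φ : E n × E n → F}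
    (h : ContinuousOn Φ (slit n)) {ξ : E n} (hξ : ξ ≠ 0) : Continuous fun x : E n => Φ (x, ξ) :=
  h.comp_continuous (by fun_prop) fun _ => hξ

theorem DecaySymbol.continuous (h : DecaySymbol Λ) {ξ : E n} (hξ : ξ ≠ 0) :
    Continuous fun x : E n => Λ (x, ξ) := continuous_slice h.contDiffOn.continuousOn hξ

theorem DecaySymbol.continuous_fderiv (h : DecaySymbol Λ) {ξ : E n} (hξ : ξ ≠ 0) :
    Continuous fun x : E n => fderiv ℝ Λ (x, ξ) :=
  continuous_slice (h.contDiffOn.continuousOn_fderiv_of_isOpen (isOpen_slit n) (by simp)) hξ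

theorem integrable_of_decay {G : E n → ℂ} (hG : Continuous G) {C : ℝ}
    (h : ∀ x, ‖G x‖ ≤ C * ((1 + ‖x‖) ^ (n + 1))⁻¹) : Integrable G :=
  ((integrable_inv_one_add_pow (V := E n) volume (N := n + 1) (by simp)).const_mul C).mono'
    hG.aestronglyMeasurable (Filter.Eventually.of_forall h)

/-- Dominated differentiation under the integral sign, jointly in `(y, ξ)`: the kernel depends on
`y` alone and the symbol on `ξ` alone. -/
theorem hasFDerivAt_partialFourier (h : DecaySymbol Λ) {p : E n × E n} (hp : ‖p.2‖ = 1) :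
    DifferentiableAt ℝ (partialFourier Λ) p ∧ ∀ v : E n × E n,
      fderiv ℝ (partialFourier Λ) p v = ∫ x : E n, kernelExp p.1 x *
        (-Complex.I * (inner ℝ v.1 x : ℝ) * Λ (x, p.2) + fderiv ℝ Λ (x, p.2) (0, v.2)) := by
  -- One power more than integrability on `ℝⁿ` requires, since differentiating the kernel in `y`
  -- costs a factor `|x|`.
  obtain ⟨C₁, hC₁0, hC₁⟩ := h.bound (n + 2)
  obtain ⟨C₂, hC₂0, hC₂⟩ := h.fderiv_bound (n + 1)
  have hp0 : p.2 ≠ 0 := by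
    intro h0
    simp [h0] at hp
  have hball : ∀ q ∈ Metric.ball p (1 / 2), 1 / 2 ≤ ‖q.2‖ ∧ ‖q.2‖ ≤ 2 := by
    intro q hq
    have hq' : ‖q - p‖ < 1 / 2 := by simpa [dist_eq_norm] using hq
    have h2 : ‖q.2 - p.2‖ ≤ ‖q - p‖ := norm_snd_le (q - p)
    have h3 := norm_le_norm_add_norm_sub q.2 p.2
    have h4 := norm_le_norm_add_norm_sub p.2 q.2
    rw [norm_sub_rev] at h4
    constructor <;> linarith
  set L : E n → E n × E n →L[ℝ] ℂ := fun x => (-Complex.I) • Complex.ofRealCLM.comp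
    ((innerSL ℝ x).comp (ContinuousLinearMap.fst ℝ (E n) (E n))) with hL
  have hLv : ∀ x v, L x v = -Complex.I * (inner ℝ v.1 x : ℝ) := by
    intro x v
    simp [hL, real_inner_comm]
  have hLn : ∀ x, ‖L x‖ ≤ ‖x‖ := by
    intro x
    refine ContinuousLinearMap.opNorm_le_bound _ (norm_nonneg x) fun v => ?_
    rw [hLv, norm_mul, norm_neg, Complex.norm_I, one_mul, Complex.norm_real, mul_comm]
    exact (norm_inner_le_norm _ _).trans (by gcongr; exact norm_fst_le v)
  set R : (E n × E n →L[ℝ] ℂ) →L[ℝ] (E n × E n →L[ℝ] ℂ) :=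
    (ContinuousLinearMap.compL ℝ (E n × E n) (E n × E n) ℂ).flip
      ((ContinuousLinearMap.inr ℝ (E n) (E n)).comp (ContinuousLinearMap.snd ℝ (E n) (E n))) with hR
  have hRv : ∀ A v, R A v = A (0, v.2) := fun A v => rfl
  have hRn : ∀ A, ‖R A‖ ≤ ‖A‖ := by
    intro A
    refine ContinuousLinearMap.opNorm_le_bound _ (norm_nonneg A) fun v => ?_
    rw [hRv]
    refine (A.le_opNorm _).trans ?_
    gcongr
    simp [Prod.norm_def]
  set F' : E n × E n → E n → E n × E n →L[ℝ] ℂ := fun q x =>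
    kernelExp q.1 x • (Λ (x, q.2) • L x + R (fderiv ℝ Λ (x, q.2))) with hF'
  have hbound : ∀ q ∈ Metric.ball p (1 / 2), ∀ x, ‖F' q x‖ ≤ (C₁ + C₂) * ((1 + ‖x‖) ^ (n + 1))⁻¹ := by
    intro q hq x
    obtain ⟨h1, h2⟩ := hball q hq
    rw [hF']
    simp only
    rw [norm_smul, norm_kernelExp, one_mul]
    calc _ ≤ ‖Λ (x, q.2)‖ * ‖L x‖ + ‖fderiv ℝ Λ (x, q.2)‖ := by
          refine (norm_add_le _ _).trans (add_le_add (norm_smul _ _).le (hRn _))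
      _ ≤ C₁ * ((1 + ‖x‖) ^ (n + 2))⁻¹ * (1 + ‖x‖) + C₂ * ((1 + ‖x‖) ^ (n + 1))⁻¹ := by
          gcongr
          · exact hC₁ (x, q.2) h1 h2
          · exact (hLn x).trans (by linarith)
          · exact hC₂ (x, q.2) h1 h2
      _ = _ := by
          rw [pow_succ (1 + ‖x‖) (n + 1)]
          field_simp
  have hLc : Continuous L := by
    have : L = fun x => ((-Complex.I) • (ContinuousLinearMap.compL ℝ (E n × E n) ℝ ℂ
        Complex.ofRealCLM)) ((ContinuousLinearMap.compL ℝ (E n × E n) (E n) ℝ).flip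
          (ContinuousLinearMap.fst ℝ (E n) (E n)) (innerSL ℝ x)) := by
      funext x
      ext v <;> simp [hL]
    rw [this]
    fun_prop
  have hF'c : Continuous (F' p) := by
    have h1 := h.continuous hp0
    have h2 := h.continuous_fderiv hp0
    have h3 := continuous_kernelExp p.1
    exact h3.smul ((h1.smul hLc).add (R.continuous.comp h2))
  have hmeas : ∀ q ∈ Metric.ball p (1 / 2), Continuous fun x => kernelExp q.1 x * Λ (x, q.2) := by
    intro q hq
    have hq0 : q.2 ≠ 0 := by
      intro h0
      have := (hball q hq).1
      simp [h0] at this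
      linarith
    exact (continuous_kernelExp q.1).mul (h.continuous hq0)
  have hpb : p ∈ Metric.ball p (1 / 2) := Metric.mem_ball_self (by norm_num)
  have hF'i : Integrable (F' p) :=
    ((integrable_inv_one_add_pow (V := E n) volume (N := n + 1) (by simp)).const_mul
      (C₁ + C₂)).mono' hF'c.aestronglyMeasurable (Filter.Eventually.of_forall (hbound p hpb))
  have key : HasFDerivAt (partialFourier Λ) (∫ x, F' p x) p := by
    refine hasFDerivAt_integral_of_dominated_of_fderiv_le (𝕜 := ℝ)
      (F := fun (q : E n × E n) (x : E n) => kernelExp q.1 x * Λ (x, q.2))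
      (s := Metric.ball p (1 / 2))
      (bound := fun x => (C₁ + C₂) * ((1 + ‖x‖) ^ (n + 1))⁻¹)
      (Metric.ball_mem_nhds _ (by norm_num)) ?_ ?_ hF'c.aestronglyMeasurable
      (Filter.Eventually.of_forall fun x q hq => hbound q hq x)
      ((integrable_inv_one_add_pow (V := E n) volume (N := n + 1) (by simp)).const_mul _)
      (Filter.Eventually.of_forall fun x q hq => ?_)
    · exact Filter.eventually_of_mem (Metric.ball_mem_nhds p (by norm_num : (0 : ℝ) < 1 / 2))
        fun q hq => (hmeas q hq).aestronglyMeasurable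
    · refine integrable_of_decay (hmeas p hpb) (C := C₁) fun x => ?_
      obtain ⟨h1, h2⟩ := hball p hpb
      rw [norm_mul, norm_kernelExp, one_mul]
      refine (hC₁ (x, p.2) h1 h2).trans ?_
      gcongr
      · linarith [norm_nonneg x]
      · omega
    · have hq0 : (x, q.2) ∈ slit n := by
        intro h0
        have := (hball q hq).1
        simp only at h0
        simp [h0] at this
        linarith
      have h1 : HasFDerivAt (fun q : E n × E n => Λ (x, q.2))
          (R (fderiv ℝ Λ (x, q.2))) q := by
        have hg : HasFDerivAt (fun q : E n × E n => ((x, q.2) : E n × E n))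
            ((ContinuousLinearMap.inr ℝ (E n) (E n)).comp
              (ContinuousLinearMap.snd ℝ (E n) (E n))) q := by
          refine ((hasFDerivAt_const x q).prodMk
            (ContinuousLinearMap.snd ℝ (E n) (E n)).hasFDerivAt).congr_fderiv ?_
          ext v <;> simp
        exact (h.differentiableAt hq0).hasFDerivAt.comp q hg
      have h2 : HasFDerivAt (fun q : E n × E n => kernelExp q.1 x) (kernelExp q.1 x • L x) q := by
        have : HasFDerivAt (fun q : E n × E n => L x q) (L x) q := (L x).hasFDerivAt
        refine (this.cexp.congr_fderiv ?_).congr_of_eventuallyEq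
          (Filter.Eventually.of_forall fun q => ?_)
        · rw [hLv, kernelExp]
        · simp only [hLv, kernelExp]
      refine (h2.mul h1).congr_fderiv ?_
      ext v <;> simp [hF'] <;> ring
  refine ⟨key.differentiableAt, fun v => ?_⟩
  rw [key.fderiv, ContinuousLinearMap.integral_apply hF'i]
  congr 1
  funext x
  simp only [hF', smul_apply, add_apply, smul_eq_mul, hLv, hRv]
  ring

/-- Integration by parts against the kernel `e^{-i⟨y, x⟩}`. -/
theorem integral_kernelExp_fderiv {G : E n → ℂ} (hG : Differentiable ℝ G) (y v : E n)
    (h1 : Integrable G) (h2 : Integrable fun x => fderiv ℝ G x v) :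
    ∫ x, kernelExp y x * fderiv ℝ G x v =
      Complex.I * (inner ℝ y v : ℝ) * ∫ x, kernelExp y x * G x := by
  have hk : ∀ x, HasFDerivAt (kernelExp y) (kernelExp y x • ((-Complex.I) •
      Complex.ofRealCLM.comp (innerSL ℝ y))) x := by
    intro x
    have : HasFDerivAt (fun x : E n => ((-Complex.I) • Complex.ofRealCLM.comp (innerSL ℝ y)) x)
        ((-Complex.I) • Complex.ofRealCLM.comp (innerSL ℝ y)) x :=
      ((-Complex.I) • Complex.ofRealCLM.comp (innerSL ℝ y)).hasFDerivAt
    refine (this.cexp.congr_fderiv ?_).congr_of_eventuallyEq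
      (Filter.Eventually.of_forall fun q => ?_)
    · simp [kernelExp]
    · simp [kernelExp]
  have hkv : ∀ x, fderiv ℝ (kernelExp y) x v = -Complex.I * (inner ℝ y v : ℝ) * kernelExp y x := by
    intro x
    rw [(hk x).fderiv]
    simp
    ring
  have hbd (G' : E n → ℂ) (hG' : Integrable G') : Integrable fun x => kernelExp y x * G' x :=
    hG'.bdd_mul (continuous_kernelExp y).aestronglyMeasurable
      (Filter.Eventually.of_forall fun x => (norm_kernelExp y x).le)
  have := integral_mul_fderiv_eq_neg_fderiv_mul_of_integrable (𝕜 := ℂ) (f := kernelExp y) (g := G) (v := v)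
    (μ := volume) (by
      simp only [hkv, mul_assoc]
      exact ((hbd G h1).const_mul _).const_mul _) (hbd _ h2) (hbd G h1)
    (fun x _ => (hk x).differentiableAt) (fun x _ => hG x)
  rw [this, ← integral_neg, ← integral_const_mul]
  congr 1
  funext x
  rw [hkv]
  ring

end ParametricFourier

/-! ### Fubini for the orthogonal splitting `ℝⁿ = ξ^⊥ ⊕ ℝξ`. -/

section Hyperplane

open MeasureTheory

variable {n : ℕ} {F : Type*} [NormedAddCommGroup F] [NormedSpace ℝ F]

theorem measurePreserving_hyperplane {ξ : E n} (hξ : ‖ξ‖ = 1) :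
    MeasurePreserving (fun q : ℝ × hyperplane ξ => (q.2 : E n) + q.1 • ξ)
      (volume.prod volume) volume ∧
    MeasurableEmbedding (fun q : ℝ × hyperplane ξ => (q.2 : E n) + q.1 • ξ) := by
  set K : Submodule ℝ (E n) := ℝ ∙ ξ with hK
  let e := LinearIsometryEquiv.toSpanUnitSingleton (𝕜 := ℝ) ξ hξ
  have h1 : MeasurePreserving (Prod.map e (id : Kᗮ → Kᗮ)) (volume.prod volume)
      (volume.prod volume) := e.measurePreserving.prod (.id _)
  have h2 : MeasurePreserving (WithLp.toLp 2 : K × Kᗮ → WithLp 2 (K × Kᗮ)) volume volume :=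
    WithLp.volume_preserving_toLp K Kᗮ
  have h3 := K.orthogonalDecomposition.symm.measurePreserving
  have heq : (fun q : ℝ × hyperplane ξ => (q.2 : E n) + q.1 • ξ) =
      K.orthogonalDecomposition.symm ∘ (WithLp.toLp 2 : K × Kᗮ → WithLp 2 (K × Kᗮ)) ∘
        Prod.map e (id : Kᗮ → Kᗮ) := by
    funext q
    have : K.orthogonalDecomposition.symm (WithLp.toLp 2 (e q.1, q.2)) = (e q.1 : E n) + q.2 := by
      rw [LinearIsometryEquiv.symm_apply_eq]
      have ha : (e q.1 : E n) ∈ K := (e q.1).2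
      have hb : (q.2 : E n) ∈ Kᗮ := q.2.2
      rw [Submodule.orthogonalDecomposition_apply]
      congr 1
      refine Prod.ext ?_ ?_ <;> apply Subtype.ext
      · simpa [map_add] using K.starProjection_apply_eq_zero_iff.mpr hb
      · simp [map_add]
    simp only [Function.comp, Prod.map, id]
    rw [this, add_comm]
    rfl
  rw [heq]
  refine ⟨h3.comp (h2.comp h1), ?_⟩
  refine K.orthogonalDecomposition.symm.toHomeomorph.measurableEmbedding.comp
    ((MeasurableEquiv.toLp 2 (K × Kᗮ)).measurableEmbedding.comp ?_)
  exact (e.toHomeomorph.prodCongr (Homeomorph.refl Kᗮ)).measurableEmbedding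

theorem integral_hyperplane {ξ : E n} (hξ : ‖ξ‖ = 1) {G : E n → F} (hG : Integrable G) :
    ∫ x, G x = ∫ x : hyperplane ξ, ∫ τ : ℝ, G ((x : E n) + τ • ξ) := by
  obtain ⟨h1, h2⟩ := measurePreserving_hyperplane hξ
  rw [← h1.integral_comp h2, integral_prod_symm]
  exact (h1.integrable_comp_emb h2).mpr hG

end Hyperplane

/-! ### The fibrewise Fourier transform and its commutation with `X_i`, `x_i` and `Ξ_i`. -/

section FourierTS

open MeasureTheory

variable {n : ℕ}

/-- The constant `(2π)^{-n/2}`. -/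
def cRn (n : ℕ) : ℂ := (((2 * Real.pi) ^ (-((n : ℝ) / 2)) : ℝ) : ℂ)

theorem cTS_eq (n : ℕ) : (((2 * Real.pi) ^ (-(((n : ℝ) - 1) / 2)) : ℝ) : ℂ) =
    cRn n * ((√(2 * Real.pi) : ℝ) : ℂ) := by
  rw [cRn, ← Complex.ofReal_mul, Real.sqrt_eq_rpow, ← Real.rpow_add (by positivity)]
  congr 2
  ring

/-- As `y` is orthogonal to `ξ`, the kernel is constant along `ξ`; the integral along `ξ` therefore
factors out. -/
theorem integral_hyperplane_gaussian {ξ : E n} (hξ : ‖ξ‖ = 1) {y : E n} (hy : inner ℝ ξ y = 0)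
    {G : E n → ℂ} (hG : Integrable fun x => kernelExp y x * G x) {g : hyperplane ξ → ℂ} {γ : ℝ → ℂ}
    (h : ∀ (x : hyperplane ξ) (τ : ℝ), G ((x : E n) + τ • ξ) = γ τ * g x) :
    ∫ x, kernelExp y x * G x = (∫ τ, γ τ) * ∫ x : hyperplane ξ, kernelExp y x * g x := by
  rw [integral_hyperplane hξ hG, ← integral_const_mul]
  congr 1
  funext x
  rw [← integral_mul_const]
  congr 1
  funext τ
  have : kernelExp y ((x : E n) + τ • ξ) = kernelExp y x := by
    simp [kernelExp, inner_add_right, inner_smul_right, real_inner_comm ξ y, hy]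
  rw [h, this]
  ring

theorem extend_add_smul (φ : TSphere n → ℂ) {ξ : E n} (hξ : ξ ≠ 0) (x : E n) (τ : ℝ) :
    extend φ (x + τ • ξ, ξ) = extend φ (x, ξ) := by
  have := extend_shear φ (-τ) one_pos (p := (x, ξ)) hξ
  simpa [shear_apply] using this

theorem mem_hyperplane {ξ x : E n} : x ∈ hyperplane ξ ↔ inner ℝ ξ x = 0 :=
  Submodule.mem_orthogonal_singleton_iff_inner_right

/-- The Gaussian integral along `ξ` equals `√(2π)`, precisely the ratio of the normalizing constants
in dimensions `n - 1` and `n`. This replaces the `ξ`-dependent domain by `ℝⁿ` and yields a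
differentiable ambient representative of the transform. -/
theorem hatTS_eq {φ : TSphere n → ℂ} (hφ : φ ∈ SchwartzTS n) (p : TSphere n) :
    hatTS φ p = cRn n * partialFourier (lift φ) p.1 := by
  obtain ⟨⟨y, ξ⟩, hξ, hy⟩ := p
  simp only at hξ hy
  have hξ0 : ξ ≠ 0 := mem_slit ⟨(y, ξ), hξ, hy⟩
  obtain ⟨C, hC0, hC⟩ := lift_bound hφ (n + 1)
  have hint : Integrable fun x => kernelExp y x * lift φ (x, ξ) := by
    refine integrable_of_decay (C := C)
      ((continuous_kernelExp y).mul ((decaySymbol_lift hφ).continuous hξ0)) fun x => ?_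
    rw [norm_mul, norm_kernelExp, one_mul]
    exact hC (x, ξ) (by simp only [hξ]; norm_num)
  rw [hatTS, cTS_eq, partialFourier, mul_assoc]
  congr 1
  simp only
  rw [integral_hyperplane_gaussian hξ hy hint (g := fun x => φ (tsPoint ξ hξ x))
    (γ := fun τ => ((Real.exp (-τ ^ 2 / 2) : ℝ) : ℂ))]
  · congr 1
    rw [integral_complex_ofReal]
    congr 1
    have := integral_gaussian (1 / 2)
    rw [show Real.pi / (1 / 2) = 2 * Real.pi by ring] at this
    rw [← this]
    congr 1
    funext τ
    congr 1
    ring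
  · intro x τ
    have hx : inner ℝ ξ (x : E n) = 0 := mem_hyperplane.mp x.2
    have h1 : inner ℝ ξ ((x : E n) + τ • ξ) = τ := by
      rw [inner_add_right, inner_smul_right, hx, real_inner_self_eq_norm_sq, hξ]
      ring
    simp only [lift]
    rw [extend_add_smul φ hξ0, h1, ← extend_coe φ (tsPoint ξ hξ x), mul_comm]
    rfl

theorem differentiableAt_hat {φ : TSphere n → ℂ} (hφ : φ ∈ SchwartzTS n) (p : TSphere n) :
    DifferentiableAt ℝ (fun q => cRn n * partialFourier (lift φ) q) p.1 :=
  (hasFDerivAt_partialFourier (decaySymbol_lift hφ) p.2.1).1.const_mul _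

theorem fderiv_hat {φ : TSphere n → ℂ} (hφ : φ ∈ SchwartzTS n) (p : TSphere n) (v : E n × E n) :
    fderiv ℝ (fun q => cRn n * partialFourier (lift φ) q) p.1 v =
      cRn n * ∫ x : E n, kernelExp p.1.1 x * (-Complex.I * (inner ℝ v.1 x : ℝ) * lift φ (x, p.1.2)
        + fderiv ℝ (lift φ) (x, p.1.2) (0, v.2)) := by
  obtain ⟨h1, h2⟩ := hasFDerivAt_partialFourier (decaySymbol_lift hφ) p.2.1
  rw [fderiv_const_mul h1, smul_apply, h2, smul_eq_mul]

theorem continuous_hatTS {φ : TSphere n → ℂ} (hφ : φ ∈ SchwartzTS n) : Continuous (hatTS φ) := by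
  have h : hatTS φ = fun p : TSphere n => cRn n * partialFourier (lift φ) p.1 :=
    funext (hatTS_eq hφ)
  rw [h]
  exact continuous_iff_continuousAt.mpr fun p =>
    ContinuousAt.comp (f := Subtype.val) (differentiableAt_hat hφ p).continuousAt
      continuous_subtype_val.continuousAt

/-- The direction `e_i - ξ_i ξ`. -/
def dir (i : Fin n) (ξ : E n) : E n := EuclideanSpace.single i 1 - ξ i • ξ

theorem inner_dir_left (i : Fin n) (ξ x : E n) :
    inner ℝ (dir i ξ) x = x i - ξ i * inner ℝ ξ x := by
  rw [dir, inner_sub_left, real_inner_comm, inner_single_coord, inner_smul_left]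
  simp

theorem extend_mulX (φ : TSphere n → ℂ) (i : Fin n) {ξ : E n} (hξ : ‖ξ‖ = 1) (x : E n) :
    extend (mulX i φ) (x, ξ) = ((inner ℝ (dir i ξ) x : ℝ) : ℂ) * extend φ (x, ξ) := by
  have hξ0 : (x, ξ) ∈ slit n := by
    intro h0
    simp only at h0
    simp [h0] at hξ
  rw [extend_apply hξ0, extend_apply hξ0, mulX, retract_coe, inner_dir_left]
  congr 2
  simp [ret, hξ]
  ring

theorem opX_hatTS {φ : TSphere n → ℂ} (hφ : φ ∈ SchwartzTS n) (i : Fin n) (p : TSphere n) :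
    opX i (hatTS φ) p = -Complex.I * hatTS (mulX i φ) p := by
  rw [opX_eq_fderiv (hatTS_eq hφ) p (differentiableAt_hat hφ p), fderiv_hat hφ,
    hatTS_eq (mulX_mem i hφ), partialFourier, mul_left_comm]
  congr 1
  rw [← integral_const_mul]
  congr 1
  funext x
  have : ((0, (fieldX i p.1).2) : E n × E n) = 0 := rfl
  simp only [lift]
  rw [this, map_zero, extend_mulX φ i p.2.1]
  simp only [fieldX, dir]
  ring

theorem fderiv_slice {Λ : E n × E n → ℂ} {x ξ : E n} (h : DifferentiableAt ℝ Λ (x, ξ)) (v : E n) :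
    DifferentiableAt ℝ (fun x => Λ (x, ξ)) x ∧
      fderiv ℝ (fun x => Λ (x, ξ)) x v = fderiv ℝ Λ (x, ξ) (v, 0) := by
  have hg : HasFDerivAt (fun x : E n => ((x, ξ) : E n × E n)) (ContinuousLinearMap.inl ℝ (E n) (E n))
      x := by
    refine ((hasFDerivAt_id x).prodMk (hasFDerivAt_const ξ x)).congr_fderiv ?_
    ext v <;> simp
  have := h.hasFDerivAt.comp x hg
  exact ⟨this.differentiableAt, by rw [HasFDerivAt.fderiv (f := fun x => Λ (x, ξ)) this]; rfl⟩

theorem DecaySymbol.integrable_mul {Λ : E n × E n → ℂ} (h : DecaySymbol Λ) {ξ : E n}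
    (hξ : ‖ξ‖ = 1) (w : E n) (v : E n × E n) :
    (Integrable fun x => Λ (x, ξ)) ∧
    (Integrable fun x => ((inner ℝ w x : ℝ) : ℂ) * Λ (x, ξ)) ∧
    (Integrable fun x => fderiv ℝ Λ (x, ξ) v) ∧
    Integrable fun x => ((inner ℝ w x : ℝ) : ℂ) * fderiv ℝ Λ (x, ξ) v := by
  have hξ0 : ξ ≠ 0 := by
    intro h0
    simp [h0] at hξ
  obtain ⟨A, hA0, hA⟩ := h.bound (n + 2)
  obtain ⟨B, hB0, hB⟩ := h.fderiv_bound (n + 2)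
  have hA' (x : E n) := hA (x, ξ) (by simp only [hξ]; norm_num) (by simp only [hξ]; norm_num)
  have hB' (x : E n) : ‖fderiv ℝ Λ (x, ξ) v‖ ≤ B * ‖v‖ * ((1 + ‖x‖) ^ (n + 2))⁻¹ := by
    refine (ContinuousLinearMap.le_opNorm _ v).trans ?_
    calc _ ≤ B * ((1 + ‖x‖) ^ (n + 2))⁻¹ * ‖v‖ := by
          gcongr
          exact hB (x, ξ) (by simp only [hξ]; norm_num) (by simp only [hξ]; norm_num)
      _ = _ := by ring
  have hc : Continuous fun x : E n => ((inner ℝ w x : ℝ) : ℂ) := by fun_prop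
  have hle (x : E n) : ((1 + ‖x‖) ^ (n + 2))⁻¹ ≤ ((1 + ‖x‖) ^ (n + 1))⁻¹ := by
    gcongr
    · linarith [norm_nonneg x]
    · omega
  have hmul (x : E n) : ‖w‖ * ‖x‖ * ((1 + ‖x‖) ^ (n + 2))⁻¹ ≤ ‖w‖ * ((1 + ‖x‖) ^ (n + 1))⁻¹ := by
    rw [mul_assoc]
    gcongr
    rw [pow_succ (1 + ‖x‖) (n + 1), mul_inv, mul_comm, mul_assoc]
    refine mul_le_of_le_one_right (by positivity) ?_
    rw [inv_mul_le_iff₀ (by positivity)]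
    linarith
  have hin (x : E n) : ‖((inner ℝ w x : ℝ) : ℂ)‖ ≤ ‖w‖ * ‖x‖ := by
    rw [Complex.norm_real]; exact norm_inner_le_norm _ _
  have hcd : Continuous fun x => fderiv ℝ Λ (x, ξ) v :=
    (h.continuous_fderiv hξ0).clm_apply continuous_const
  refine ⟨integrable_of_decay (h.continuous hξ0) (C := A) fun x => (hA' x).trans ?_,
    integrable_of_decay (hc.mul (h.continuous hξ0)) (C := A * ‖w‖) fun x => ?_,
    integrable_of_decay hcd (C := B * ‖v‖) fun x => (hB' x).trans ?_,
    integrable_of_decay (hc.mul hcd) (C := B * ‖v‖ * ‖w‖) fun x => ?_⟩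
  · exact mul_le_mul_of_nonneg_left (hle x) hA0
  · rw [norm_mul]
    calc _ ≤ (‖w‖ * ‖x‖) * (A * ((1 + ‖x‖) ^ (n + 2))⁻¹) := by
          gcongr
          · exact hin x
          · exact hA' x
      _ = A * (‖w‖ * ‖x‖ * ((1 + ‖x‖) ^ (n + 2))⁻¹) := by ring
      _ ≤ A * (‖w‖ * ((1 + ‖x‖) ^ (n + 1))⁻¹) := by exact mul_le_mul_of_nonneg_left (hmul x) hA0
      _ = _ := by ring
  · exact mul_le_mul_of_nonneg_left (hle x) (by positivity)
  · rw [norm_mul]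
    calc _ ≤ (‖w‖ * ‖x‖) * (B * ‖v‖ * ((1 + ‖x‖) ^ (n + 2))⁻¹) := by
          gcongr
          · exact hin x
          · exact hB' x
      _ = B * ‖v‖ * (‖w‖ * ‖x‖ * ((1 + ‖x‖) ^ (n + 2))⁻¹) := by ring
      _ ≤ B * ‖v‖ * (‖w‖ * ((1 + ‖x‖) ^ (n + 1))⁻¹) := by exact mul_le_mul_of_nonneg_left (hmul x) (by positivity)
      _ = _ := by ring

theorem integrable_kernelExp_mul (y : E n) {G : E n → ℂ} (hG : Integrable G) :
    Integrable fun x => kernelExp y x * G x :=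
  hG.bdd_mul (continuous_kernelExp y).aestronglyMeasurable
    (Filter.Eventually.of_forall fun x => (norm_kernelExp y x).le)

/-- Integration by parts in the first variable, with a linear weight constant along the
direction. -/
theorem DecaySymbol.integral_by_parts {Λ : E n × E n → ℂ} (h : DecaySymbol Λ) {ξ : E n}
    (hξ : ‖ξ‖ = 1) (y : E n) {w v : E n} (hwv : inner ℝ w v = 0) :
    ∫ x, kernelExp y x * (((inner ℝ w x : ℝ) : ℂ) * fderiv ℝ Λ (x, ξ) (v, 0)) =
      Complex.I * (inner ℝ y v : ℝ) * ∫ x, kernelExp y x * (((inner ℝ w x : ℝ) : ℂ) * Λ (x, ξ)) := by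
  have hξ0 : ξ ≠ 0 := by
    intro h0
    simp [h0] at hξ
  obtain ⟨-, h1, -, h2⟩ := h.integrable_mul hξ w (v, 0)
  have hd (x : E n) := fderiv_slice (h.differentiableAt (p := (x, ξ)) hξ0) v
  have hw (x : E n) : HasFDerivAt (fun x : E n => ((inner ℝ w x : ℝ) : ℂ))
      (Complex.ofRealCLM.comp (innerSL ℝ w)) x :=
    (Complex.ofRealCLM.comp (innerSL ℝ w)).hasFDerivAt
  have hprod (x : E n) := (hw x).mul (hd x).1.hasFDerivAt
  have hfd (x : E n) : fderiv ℝ (fun x => ((inner ℝ w x : ℝ) : ℂ) * Λ (x, ξ)) x v =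
      ((inner ℝ w x : ℝ) : ℂ) * fderiv ℝ Λ (x, ξ) (v, 0) := by
    rw [HasFDerivAt.fderiv (f := fun x => ((inner ℝ w x : ℝ) : ℂ) * Λ (x, ξ)) (hprod x)]
    simp [hwv, (hd x).2]
  rw [← integral_kernelExp_fderiv (G := fun x => ((inner ℝ w x : ℝ) : ℂ) * Λ (x, ξ))
    (fun x => (hprod x).differentiableAt) y v h1 (by simpa only [hfd] using h2)]
  simp only [hfd]

theorem DecaySymbol.integral_by_parts' {Λ : E n × E n → ℂ} (h : DecaySymbol Λ) {ξ : E n}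
    (hξ : ‖ξ‖ = 1) (y v : E n) :
    ∫ x, kernelExp y x * fderiv ℝ Λ (x, ξ) (v, 0) =
      Complex.I * (inner ℝ y v : ℝ) * ∫ x, kernelExp y x * Λ (x, ξ) := by
  have hξ0 : ξ ≠ 0 := by
    intro h0
    simp [h0] at hξ
  obtain ⟨h1, -, h2, -⟩ := h.integrable_mul hξ 0 (v, 0)
  have hd (x : E n) := fderiv_slice (h.differentiableAt (p := (x, ξ)) hξ0) v
  rw [← integral_kernelExp_fderiv (G := fun x => Λ (x, ξ)) (fun x => (hd x).1) y v h1
    (by simpa only [(hd _).2] using h2)]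
  simp only [(hd _).2]

/-- The direction `w` is the preimage of the field under the shear that retracts `p`, chosen in
addition to be tangent to the level sets of `⟨ξ, x⟩`. The Gaussian factor is then not
differentiated. -/
theorem lift_op {φ : TSphere n → ℂ} (hφ : φ ∈ SchwartzTS n) {ψ : TSphere n → ℂ}
    {V : TSphere n → E n × E n} (hψ : ∀ q, ψ q = fderiv ℝ (extend φ) q.1 (V q)) {p : E n × E n}
    (hp : ‖p.2‖ = 1) (hp' : p ∈ slit n) {w : E n × E n}
    (hw : V (retract p hp') = (w.1 - (inner ℝ p.2 p.1 : ℝ) • w.2, w.2))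
    (h0 : inner ℝ p.2 w.1 + inner ℝ p.1 w.2 = 0) :
    lift ψ p = fderiv ℝ (lift φ) p w := by
  obtain ⟨L, hL, hLv⟩ := hasFDerivAt_lift hφ hp'
  rw [hL.fderiv, hLv, dpair_apply, h0, lift, extend_apply hp', hψ, hw, fderiv_extend_ret hφ hp',
    ContinuousLinearMap.comp_apply, shear_apply, retract_coe, hp]
  simp

theorem inner_dir_self {i : Fin n} {ξ : E n} (hξ : ‖ξ‖ = 1) : inner ℝ ξ (dir i ξ) = 0 := by
  rw [real_inner_comm, inner_dir_left, real_inner_self_eq_norm_sq, hξ]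
  simp

theorem lift_opX {φ : TSphere n → ℂ} (hφ : φ ∈ SchwartzTS n) (i : Fin n) {ξ : E n}
    (hξ : ‖ξ‖ = 1) (x : E n) :
    lift (opX i φ) (x, ξ) = fderiv ℝ (lift φ) (x, ξ) (dir i ξ, 0) := by
  have hξ0 : (x, ξ) ∈ slit n := by
    intro h0
    simp only at h0
    simp [h0] at hξ
  have h1 : fieldX i (retract (x, ξ) hξ0).1 =
      (dir i ξ - (inner ℝ ξ x : ℝ) • (0 : E n), (0 : E n)) := by
    rw [retract_coe]
    simp [dir, ret, hξ, fieldX]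
  have h2 : inner ℝ ξ (dir i ξ) + inner ℝ x (0 : E n) = 0 := by
    rw [inner_zero_right, add_zero, inner_dir_self hξ]
  exact lift_op (p := (x, ξ)) hφ (V := fun q => fieldX i q.1) (opX_apply i φ) hξ hξ0 h1 h2

theorem lift_opXi {φ : TSphere n → ℂ} (hφ : φ ∈ SchwartzTS n) (i : Fin n) {ξ : E n}
    (hξ : ‖ξ‖ = 1) (x : E n) :
    lift (opXi i φ) (x, ξ) = fderiv ℝ (lift φ) (x, ξ)
      ((inner ℝ ξ x : ℝ) • dir i ξ - (inner ℝ (dir i ξ) x : ℝ) • ξ, dir i ξ) := by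
  have hξ0 : (x, ξ) ∈ slit n := by
    intro h0
    simp only at h0
    simp [h0] at hξ
  have h1 : fieldXi i (retract (x, ξ) hξ0).1 =
      ((inner ℝ ξ x : ℝ) • dir i ξ - (inner ℝ (dir i ξ) x : ℝ) • ξ -
        (inner ℝ ξ x : ℝ) • dir i ξ, dir i ξ) := by
    rw [retract_coe, sub_sub_cancel_left, inner_dir_left]
    ext k
    · simp [fieldXi, ret, hξ, mul_comm]
    · simp [fieldXi, ret, hξ, dir]
  have h2 : inner ℝ ξ ((inner ℝ ξ x : ℝ) • dir i ξ - (inner ℝ (dir i ξ) x : ℝ) • ξ) +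
      inner ℝ x (dir i ξ) = 0 := by
    rw [inner_sub_right, inner_smul_right, inner_smul_right, inner_dir_self hξ,
      real_inner_self_eq_norm_sq, hξ, real_inner_comm (dir i ξ) x]
    ring
  exact lift_op (p := (x, ξ)) hφ (V := fun q => fieldXi i q.1) (opXi_apply i φ) hξ hξ0 h1 h2

theorem hatTS_opX {φ : TSphere n → ℂ} (hφ : φ ∈ SchwartzTS n) (i : Fin n) (p : TSphere n) :
    hatTS (opX i φ) p = Complex.I * (p.1.1 i : ℂ) * hatTS φ p := by
  rw [hatTS_eq (opX_mem i hφ), hatTS_eq hφ, partialFourier, partialFourier]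
  simp only [lift_opX hφ i p.2.1]
  rw [(decaySymbol_lift hφ).integral_by_parts' p.2.1, real_inner_comm, inner_dir_left, p.2.2]
  push_cast
  ring

/-- On the lift, `Ξ_i` is the `ξ`-derivative along `e_i - ξ_i ξ` plus two `x`-derivatives with
linear weights. Integrated by parts, the one along `ξ` vanishes since `⟨y, ξ⟩ = 0`, and the other
yields `i y_i ⟨ξ, x⟩`. The latter is what the component `-y_i ξ` of the field at `(y, ξ)` produces
when it differentiates the kernel. -/
theorem hatTS_opXi {φ : TSphere n → ℂ} (hφ : φ ∈ SchwartzTS n) (i : Fin n) (p : TSphere n) :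
    hatTS (opXi i φ) p = opXi i (hatTS φ) p := by
  rw [opXi_eq_fderiv (hatTS_eq hφ) p (differentiableAt_hat hφ p), fderiv_hat hφ,
    hatTS_eq (opXi_mem i hφ), partialFourier]
  congr 1
  simp only [lift_opXi hφ i p.2.1]
  set y := p.1.1 with hy
  set ξ := p.1.2 with hξ
  have hξ1 : ‖ξ‖ = 1 := p.2.1
  have hyξ : inner ℝ ξ y = 0 := p.2.2
  have hd := decaySymbol_lift hφ
  have hb : inner ℝ ξ (dir i ξ) = 0 := inner_dir_self hξ1
  -- Each linear weight is constant in the direction of differentiation, because `dir i ξ` is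
  -- orthogonal to `ξ`; no further terms arise.
  have e1 := hd.integral_by_parts hξ1 y (w := ξ) (v := dir i ξ) hb
  have e2 := hd.integral_by_parts hξ1 y (w := dir i ξ) (v := ξ) (by rw [real_inner_comm, hb])
  have hyb : inner ℝ y (dir i ξ) = y i := by
    rw [real_inner_comm, inner_dir_left, hyξ]
    ring
  rw [hyb] at e1
  rw [real_inner_comm, hyξ] at e2
  have i1 := integrable_kernelExp_mul y (hd.integrable_mul hξ1 ξ (dir i ξ, 0)).2.2.2
  have i2 := integrable_kernelExp_mul y (hd.integrable_mul hξ1 (dir i ξ) (ξ, 0)).2.2.2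
  have i3 := integrable_kernelExp_mul y (hd.integrable_mul hξ1 ξ (0, dir i ξ)).2.2.1
  have i4 := integrable_kernelExp_mul y (hd.integrable_mul hξ1 ξ (0, dir i ξ)).2.1
  have hL (x : E n) : kernelExp y x * fderiv ℝ (lift φ) (x, ξ)
      ((inner ℝ ξ x : ℝ) • dir i ξ - (inner ℝ (dir i ξ) x : ℝ) • ξ, dir i ξ) =
      kernelExp y x * (((inner ℝ ξ x : ℝ) : ℂ) * fderiv ℝ (lift φ) (x, ξ) (dir i ξ, 0)) -
      kernelExp y x * (((inner ℝ (dir i ξ) x : ℝ) : ℂ) * fderiv ℝ (lift φ) (x, ξ) (ξ, 0)) +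
      kernelExp y x * fderiv ℝ (lift φ) (x, ξ) (0, dir i ξ) := by
    have : (((inner ℝ ξ x : ℝ) • dir i ξ - (inner ℝ (dir i ξ) x : ℝ) • ξ, dir i ξ) : E n × E n) =
        (inner ℝ ξ x : ℝ) • (dir i ξ, 0) - (inner ℝ (dir i ξ) x : ℝ) • (ξ, 0) + (0, dir i ξ) := by
      simp
    rw [this, map_add, map_sub, map_smul, map_smul, Complex.real_smul, Complex.real_smul]
    ring
  have hR (x : E n) : kernelExp y x * (-Complex.I * (inner ℝ (fieldXi i p.1).1 x : ℝ) *
      lift φ (x, ξ) + fderiv ℝ (lift φ) (x, ξ) (0, (fieldXi i p.1).2)) =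
      Complex.I * (y i : ℂ) * (kernelExp y x * (((inner ℝ ξ x : ℝ) : ℂ) * lift φ (x, ξ))) +
      kernelExp y x * fderiv ℝ (lift φ) (x, ξ) (0, dir i ξ) := by
    have : (fieldXi i p.1).2 = dir i ξ := rfl
    rw [this]
    simp only [fieldXi, inner_neg_left, inner_smul_left, conj_trivial, ← hy, ← hξ]
    push_cast
    ring
  simp only [hL, hR]
  have i12 : Integrable fun x =>
      kernelExp y x * (((inner ℝ ξ x : ℝ) : ℂ) * fderiv ℝ (lift φ) (x, ξ) (dir i ξ, 0)) -
      kernelExp y x * (((inner ℝ (dir i ξ) x : ℝ) : ℂ) * fderiv ℝ (lift φ) (x, ξ) (ξ, 0)) :=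
    i1.sub i2
  rw [integral_add i12 i3, integral_sub i1 i2, e1, e2,
    integral_add (i4.const_mul _) i3, integral_const_mul]
  push_cast
  ring

/-- Measurable functions on `T𝕊ⁿ⁻¹` decaying faster than any power of the first variable. -/
def DecayTS (u : TSphere n → ℂ) : Prop :=
  Measurable u ∧ ∀ N : ℕ, ∃ C : ℝ, 0 ≤ C ∧ ∀ p, ‖u p‖ ≤ C * ((1 + ‖p.1.1‖) ^ N)⁻¹

theorem norm_le_sum_abs (y : E n) : ‖y‖ ≤ ∑ i, |y i| := by
  conv_lhs => rw [← (EuclideanSpace.basisFun (Fin n) ℝ).sum_repr y]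
  refine (norm_sum_le _ _).trans (Finset.sum_le_sum fun i _ => ?_)
  simp [norm_smul]

/-- Multiplication of the transform by `y_i` is, up to the factor `i`, the transform of `X_i φ`,
again Schwartz. With `|y| ≤ ∑ |y_i|` each step of the induction gains one power. -/
theorem hatTS_bound (N : ℕ) : ∀ {φ : TSphere n → ℂ}, φ ∈ SchwartzTS n →
    ∃ C : ℝ, 0 ≤ C ∧ ∀ p : TSphere n, (1 + ‖p.1.1‖) ^ N * ‖hatTS φ p‖ ≤ C := by
  induction N with
  | zero =>
    intro φ hφ
    obtain ⟨C, hC0, hC⟩ := lift_bound hφ (n + 1)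
    have hi := (integrable_inv_one_add_pow (V := E n) volume (N := n + 1) (by simp)).const_mul C
    refine ⟨‖cRn n‖ * ∫ x : E n, C * ((1 + ‖x‖) ^ (n + 1))⁻¹, by positivity, fun p => ?_⟩
    rw [pow_zero, one_mul, hatTS_eq hφ, norm_mul]
    gcongr
    refine norm_integral_le_of_norm_le hi (Filter.Eventually.of_forall fun x => ?_)
    rw [norm_mul, norm_kernelExp, one_mul]
    exact hC (x, p.1.2) (by simp only [p.2.1]; norm_num)
  | succ N ih =>
    intro φ hφ
    obtain ⟨A, hA0, hA⟩ := ih hφ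
    choose B hB0 hB using fun i : Fin n => ih (opX_mem i hφ)
    refine ⟨A + ∑ i, B i, add_nonneg hA0 (Finset.sum_nonneg fun i _ => hB0 i), fun p => ?_⟩
    have hi (i : Fin n) : |p.1.1 i| * ((1 + ‖p.1.1‖) ^ N * ‖hatTS φ p‖) ≤ B i := by
      have := hB i p
      rw [hatTS_opX hφ, norm_mul, norm_mul, Complex.norm_I, one_mul, Complex.norm_real,
        Real.norm_eq_abs] at this
      linarith
    calc _ = (1 + ‖p.1.1‖) * ((1 + ‖p.1.1‖) ^ N * ‖hatTS φ p‖) := by ring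
      _ ≤ (1 + ∑ i, |p.1.1 i|) * ((1 + ‖p.1.1‖) ^ N * ‖hatTS φ p‖) := by
          gcongr
          exact norm_le_sum_abs _
      _ = (1 + ‖p.1.1‖) ^ N * ‖hatTS φ p‖ +
          ∑ i, |p.1.1 i| * ((1 + ‖p.1.1‖) ^ N * ‖hatTS φ p‖) := by
          rw [add_mul, one_mul, Finset.sum_mul]
      _ ≤ _ := add_le_add (hA p) (Finset.sum_le_sum fun i _ => hi i)

theorem decayTS_hatTS {φ : TSphere n → ℂ} (hφ : φ ∈ SchwartzTS n) : DecayTS (hatTS φ) := by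
  refine ⟨(continuous_hatTS hφ).measurable, fun N => ?_⟩
  obtain ⟨C, hC0, hC⟩ := hatTS_bound N hφ
  refine ⟨C, hC0, fun p => ?_⟩
  rw [← div_eq_mul_inv, le_div_iff₀ (by positivity), mul_comm]
  exact hC p

end FourierTS

/-! ### The measure `dy dξ` on `T𝕊ⁿ⁻¹`, by trivializing the bundle with reflections. -/

section TSMeasure

open MeasureTheory Metric

variable {n : ℕ}

/-- The restriction of an isometry of `ℝⁿ` to a hyperplane. -/
def hyperplaneEquiv (g : E n ≃ₗᵢ[ℝ] E n) {ξ η : E n} (h : g ξ = η) :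
    hyperplane ξ ≃ₗᵢ[ℝ] hyperplane η where
  toFun x := ⟨g x, by rw [mem_hyperplane, ← h, g.inner_map_map]; exact mem_hyperplane.mp x.2⟩
  invFun y := ⟨g.symm y, by
    rw [mem_hyperplane, ← g.symm_apply_apply ξ, h, g.symm.inner_map_map]
    exact mem_hyperplane.mp y.2⟩
  map_add' x y := by ext; simp
  map_smul' c x := by ext; simp
  left_inv x := by ext; simp
  right_inv y := by ext; simp
  norm_map' x := g.norm_map x

@[simp] theorem hyperplaneEquiv_coe (g : E n ≃ₗᵢ[ℝ] E n) {ξ η : E n} (h : g ξ = η)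
    (x : hyperplane ξ) : (hyperplaneEquiv g h x : E n) = g x := rfl

/-- The reflection exchanging two points of the same norm. -/
def refl (ξ η : E n) : E n ≃ₗᵢ[ℝ] E n := (ℝ ∙ (ξ - η))ᗮ.reflection

theorem refl_left {ξ η : E n} (h : ‖ξ‖ = ‖η‖) : refl ξ η ξ = η := Submodule.reflection_sub h

theorem refl_apply (ξ η x : E n) :
    refl ξ η x = x - (2 * (inner ℝ (ξ - η) x / ‖ξ - η‖ ^ 2)) • (ξ - η) := by
  rw [refl, Submodule.reflection_orthogonal_apply, Submodule.reflection_singleton_apply, two_smul,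
    two_mul, add_smul]
  simp

theorem norm_sphere (ξ : sphere (0 : E n) 1) : ‖(ξ : E n)‖ = 1 := mem_sphere_zero_iff_norm.mp ξ.2

theorem refl_sphere (ξ η : sphere (0 : E n) 1) : refl (ξ : E n) η ξ = η :=
  refl_left (by rw [norm_sphere, norm_sphere])

/-- The parametrization of `T𝕊ⁿ⁻¹` by the product of the sphere and a fixed hyperplane. -/
def chart (ξ₀ : sphere (0 : E n) 1) (q : sphere (0 : E n) 1 × hyperplane (ξ₀ : E n)) : TSphere n :=
  tsPoint q.1 (norm_sphere q.1) (hyperplaneEquiv (refl (ξ₀ : E n) q.1) (refl_sphere ξ₀ q.1) q.2)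

theorem chart_fst (ξ₀ : sphere (0 : E n) 1) (q : sphere (0 : E n) 1 × hyperplane (ξ₀ : E n)) :
    (chart ξ₀ q).1.1 = refl (ξ₀ : E n) q.1 q.2 := rfl

theorem norm_chart_fst (ξ₀ : sphere (0 : E n) 1)
    (q : sphere (0 : E n) 1 × hyperplane (ξ₀ : E n)) : ‖(chart ξ₀ q).1.1‖ = ‖q.2‖ := by
  rw [chart_fst, LinearIsometryEquiv.norm_map]
  rfl

theorem measurable_chart (ξ₀ : sphere (0 : E n) 1) : Measurable (chart ξ₀) := by
  refine Measurable.subtype_mk (Measurable.prodMk ?_ (measurable_subtype_coe.comp measurable_fst))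
  -- The explicit reflection formula holds also at `q.1 = ξ₀`: there the quotient by zero multiplies
  -- the zero vector.
  have : (fun q : sphere (0 : E n) 1 × hyperplane (ξ₀ : E n) =>
      (hyperplaneEquiv (refl (ξ₀ : E n) q.1) (refl_sphere ξ₀ q.1) q.2 : E n)) = fun q =>
      (q.2 : E n) - (2 * (inner ℝ ((ξ₀ : E n) - q.1) (q.2 : E n) / ‖(ξ₀ : E n) - q.1‖ ^ 2)) •
        ((ξ₀ : E n) - q.1) := by
    funext q
    exact refl_apply _ _ _
  rw [this]
  have h1 : Measurable fun q : sphere (0 : E n) 1 × hyperplane (ξ₀ : E n) => (q.1 : E n) := by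
    fun_prop
  have h2 : Measurable fun q : sphere (0 : E n) 1 × hyperplane (ξ₀ : E n) => (q.2 : E n) := by
    fun_prop
  have h3 := (measurable_const (a := (ξ₀ : E n))).sub h1
  exact h2.sub (((((Measurable.inner h3 h2)).div (h3.norm.pow_const 2)).const_mul 2).smul h3)

/-- The product measure on the parameter space of `T𝕊ⁿ⁻¹`. -/
def chartMeasure (ξ₀ : sphere (0 : E n) 1) :
    Measure (sphere (0 : E n) 1 × hyperplane (ξ₀ : E n)) :=
  (volume : Measure (E n)).toSphere.prod volume

/-- The measure `dy dξ` on `T𝕊ⁿ⁻¹`. -/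
def tsMeasure (ξ₀ : sphere (0 : E n) 1) : Measure (TSphere n) :=
  (chartMeasure ξ₀).map (chart ξ₀)

/-- The reflection exchanging `ξ₀` and `ξ` is an isometry of one hyperplane onto the other, so all
fibre integrals can be taken over one hyperplane and Fubini for a product applies. -/
theorem integral_fibre {F : Type*} [NormedAddCommGroup F] [NormedSpace ℝ F]
    (ξ₀ ξ : sphere (0 : E n) 1) (u : TSphere n → F) :
    ∫ y : hyperplane (ξ : E n), u (tsPoint ξ (norm_sphere ξ) y) =
      ∫ z : hyperplane (ξ₀ : E n), u (chart ξ₀ (ξ, z)) := by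
  let e := hyperplaneEquiv (refl (ξ₀ : E n) ξ) (refl_sphere ξ₀ ξ)
  exact (e.measurePreserving.integral_comp e.toHomeomorph.measurableEmbedding
    (fun y => u (tsPoint ξ (norm_sphere ξ) y))).symm

theorem integral_tsMeasure {F : Type*} [NormedAddCommGroup F] [NormedSpace ℝ F]
    (ξ₀ : sphere (0 : E n) 1) {u : TSphere n → F} (hu : Integrable u (tsMeasure ξ₀)) :
    ∫ p, u p ∂(tsMeasure ξ₀) = ∫ ξ : sphere (0 : E n) 1,
      (∫ y : hyperplane (ξ : E n), u (tsPoint ξ (norm_sphere ξ) y))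
        ∂(volume : Measure (E n)).toSphere := by
  rw [tsMeasure, integral_map (measurable_chart ξ₀).aemeasurable hu.aestronglyMeasurable,
    chartMeasure, integral_prod]
  · exact integral_congr_ae (Filter.Eventually.of_forall fun ξ => (integral_fibre ξ₀ ξ u).symm)
  · exact (integrable_map_measure hu.aestronglyMeasurable (measurable_chart ξ₀).aemeasurable).mp hu

theorem finrank_hyperplane (ξ : sphere (0 : E n) 1) :
    Module.finrank ℝ (hyperplane (ξ : E n)) + 1 = n := by
  have h := Submodule.finrank_add_finrank_orthogonal (ℝ ∙ (ξ : E n))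
  rw [finrank_span_singleton (by
    intro h0
    have := norm_sphere ξ
    rw [h0, norm_zero] at this
    exact zero_ne_one this), finrank_euclideanSpace_fin] at h
  change 1 + Module.finrank ℝ (hyperplane (ξ : E n)) = n at h
  omega

theorem nontrivial_hyperplane (hn : 2 ≤ n) (ξ : sphere (0 : E n) 1) :
    Nontrivial (hyperplane (ξ : E n)) := by
  have := finrank_hyperplane ξ
  exact Module.nontrivial_of_finrank_pos (R := ℝ) (by omega)

theorem integrable_comp_norm_tsMeasure (ξ₀ : sphere (0 : E n) 1) {h : ℝ → ℝ} (hm : Measurable h)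
    (hi : Integrable fun z : hyperplane (ξ₀ : E n) => h ‖z‖) :
    Integrable (fun p : TSphere n => h ‖p.1.1‖) (tsMeasure ξ₀) := by
  have hm' : Measurable fun p : TSphere n => h ‖p.1.1‖ := by fun_prop
  rw [tsMeasure, integrable_map_measure hm'.aestronglyMeasurable (measurable_chart ξ₀).aemeasurable]
  simp only [Function.comp_def, norm_chart_fst]
  exact hi.comp_snd _

/-- For `n ≥ 2` hyperplanes have positive dimension and the origin is a null set. Pointwise
identities that divide by `|y|` thus suffice under the integral. -/
theorem ae_tsMeasure_ne_zero (hn : 2 ≤ n) (ξ₀ : sphere (0 : E n) 1) :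
    ∀ᵐ p ∂(tsMeasure ξ₀), p.1.1 ≠ 0 := by
  have := nontrivial_hyperplane hn ξ₀
  rw [tsMeasure, ae_map_iff (measurable_chart ξ₀).aemeasurable]
  · have h : ∀ᵐ z : hyperplane (ξ₀ : E n), z ≠ 0 := by simp [ae_iff]
    have h2 : ∀ᵐ q ∂(chartMeasure ξ₀), q.2 ≠ 0 :=
      Measure.quasiMeasurePreserving_snd.ae h
    filter_upwards [h2] with q hq
    rw [← norm_ne_zero_iff, norm_chart_fst]
    exact norm_ne_zero_iff.mpr hq
  · exact (measurableSet_singleton (0 : E n)).compl.preimage (by fun_prop)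

end TSMeasure

/-! ### Integrability against the weights `|y|^{2τ}(1+|y|²)^{σ-τ}`. -/

section Weights

open MeasureTheory Metric

variable {n : ℕ}

theorem measurable_weight (σ τ : ℝ) : Measurable (weight σ τ) := by
  unfold weight
  fun_prop

theorem weight_nonneg (σ τ : ℝ) {r : ℝ} (hr : 0 ≤ r) : 0 ≤ weight σ τ r := by
  unfold weight
  positivity

theorem weight_pos (σ τ : ℝ) {r : ℝ} (hr : 0 < r) : 0 < weight σ τ r := by
  unfold weight
  positivity

/-- A common shift of the two indices is a power of `|y|`; this brings all terms of the norm to a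
single weight. -/
theorem weight_add (σ τ κ : ℝ) {r : ℝ} (hr : 0 < r) :
    weight (σ + κ) (τ + κ) r = r ^ (2 * κ) * weight σ τ r := by
  rw [weight, weight, mul_add, Real.rpow_add hr, add_sub_add_right_eq_sub]
  ring

theorem integrableOn_rpow_mul_inv_one_add_pow {a : ℝ} (ha : -1 < a) {N : ℕ} (hN : a + 1 < N) :
    IntegrableOn (fun r : ℝ => r ^ a * ((1 + r) ^ N)⁻¹) (Set.Ioi 0) := by
  have hm : Measurable fun r : ℝ => r ^ a * ((1 + r) ^ N)⁻¹ := by fun_prop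
  rw [← Set.Ioc_union_Ioi_eq_Ioi zero_le_one, integrableOn_union]
  constructor
  · have h1 : IntegrableOn (fun r : ℝ => r ^ a) (Set.Ioc 0 1) :=
      (intervalIntegral.intervalIntegrable_rpow' ha (a := 0) (b := 1)).1
    refine h1.mono' hm.aestronglyMeasurable ?_
    refine (ae_restrict_iff' measurableSet_Ioc).mpr (Filter.Eventually.of_forall fun r hr => ?_)
    have hr0 : 0 < r := hr.1
    rw [Real.norm_of_nonneg (by positivity)]
    refine mul_le_of_le_one_right (by positivity) (inv_le_one_of_one_le₀ (one_le_pow₀ (by linarith)))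
  · have h1 : IntegrableOn (fun r : ℝ => r ^ (a - N)) (Set.Ioi 1) :=
      integrableOn_Ioi_rpow_of_lt (by linarith) one_pos
    refine h1.mono' hm.aestronglyMeasurable ?_
    refine (ae_restrict_iff' measurableSet_Ioi).mpr (Filter.Eventually.of_forall fun r hr => ?_)
    have hr0 : 0 < r := zero_lt_one.trans hr
    rw [Real.norm_of_nonneg (by positivity), Real.rpow_sub hr0, Real.rpow_natCast, div_eq_mul_inv]
    gcongr
    linarith

theorem weight_le (σ τ : ℝ) : ∃ M : ℕ, ∀ r : ℝ, 0 ≤ r →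
    weight σ τ r ≤ r ^ (2 * τ) * (1 + r) ^ M := by
  refine ⟨⌈2 * |σ - τ|⌉₊, fun r hr => ?_⟩
  rw [weight]
  gcongr
  have h1 : (1 : ℝ) ≤ 1 + r ^ 2 := by nlinarith
  calc (1 + r ^ 2) ^ (σ - τ) ≤ (1 + r ^ 2) ^ |σ - τ| :=
        Real.rpow_le_rpow_of_exponent_le h1 (le_abs_self _)
    _ ≤ ((1 + r) ^ 2) ^ |σ - τ| := by
        gcongr
        nlinarith
    _ = (1 + r) ^ (2 * |σ - τ|) := by
        rw [← Real.rpow_natCast (1 + r) 2, ← Real.rpow_mul (by positivity)]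
        norm_num
    _ ≤ (1 + r) ^ ((⌈2 * |σ - τ|⌉₊ : ℕ) : ℝ) :=
        Real.rpow_le_rpow_of_exponent_le (by linarith) (Nat.le_ceil _)
    _ = _ := Real.rpow_natCast _ _

/-- In polar coordinates on a space of dimension `n - 1` the exponent at the origin is `n - 2 + 2τ`,
which must exceed `-1`. At `τ = t + 1/2` this is the condition `t > -n/2`. -/
theorem integrable_rpow_norm_hyperplane (hn : 2 ≤ n) (ξ : sphere (0 : E n) 1) {τ : ℝ}
    (hτ : -((n : ℝ) - 1) < 2 * τ) {N : ℕ} (hN : 2 * τ + n < N) :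
    Integrable fun z : hyperplane (ξ : E n) => ‖z‖ ^ (2 * τ) * ((1 + ‖z‖) ^ N)⁻¹ := by
  have := nontrivial_hyperplane hn ξ
  have hd := finrank_hyperplane ξ
  rw [integrable_fun_norm_addHaar volume (f := fun r => r ^ (2 * τ) * ((1 + r) ^ N)⁻¹)]
  have h1 : ((Module.finrank ℝ (hyperplane (ξ : E n)) - 1 : ℕ) : ℝ) = n - 2 := by
    have : Module.finrank ℝ (hyperplane (ξ : E n)) - 1 = n - 2 := by omega
    rw [this, Nat.cast_sub hn]
    norm_num
  have := integrableOn_rpow_mul_inv_one_add_pow (a := (n - 2) + 2 * τ) (by linarith) (N := N)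
    (by linarith)
  refine this.congr_fun (fun r hr => ?_) measurableSet_Ioi
  have hr : 0 < r := hr
  simp only [smul_eq_mul]
  rw [Real.rpow_add hr, ← h1, Real.rpow_natCast]
  ring

theorem DecayTS.integrable (hn : 2 ≤ n) (ξ₀ : sphere (0 : E n) 1) {σ τ : ℝ}
    (hτ : -((n : ℝ) - 1) < 2 * τ) {u : TSphere n → ℂ} (hu : DecayTS u) :
    Integrable (fun p => (weight σ τ ‖p.1.1‖ : ℂ) * u p) (tsMeasure ξ₀) := by
  obtain ⟨M, hM⟩ := weight_le σ τ
  obtain ⟨N, hN⟩ := exists_nat_gt (2 * τ + n)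
  obtain ⟨C, hC0, hC⟩ := hu.2 (N + M)
  have h1 := (integrable_comp_norm_tsMeasure ξ₀
    (h := fun r => r ^ (2 * τ) * ((1 + r) ^ N)⁻¹) (by fun_prop)
    (integrable_rpow_norm_hyperplane hn ξ₀ hτ hN)).const_mul C
  refine h1.mono' ?_ (Filter.Eventually.of_forall fun p => ?_)
  · have := measurable_weight σ τ
    have hu' := hu.1
    exact Measurable.aestronglyMeasurable (by fun_prop)
  · rw [norm_mul, Complex.norm_real, Real.norm_of_nonneg (weight_nonneg _ _ (norm_nonneg _))]
    calc _ ≤ (‖p.1.1‖ ^ (2 * τ) * (1 + ‖p.1.1‖) ^ M) * (C * ((1 + ‖p.1.1‖) ^ (N + M))⁻¹) := by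
          gcongr
          · exact hM _ (norm_nonneg _)
          · exact hC p
      _ = _ := by
          have : (0 : ℝ) < 1 + ‖p.1.1‖ := by positivity
          rw [pow_add]
          field_simp

theorem DecayTS.of_le {u v : TSphere n → ℂ} (hv : Measurable v) (hu : DecayTS u) {M : ℕ}
    {A : ℝ} (hA : 0 ≤ A) (h : ∀ p, ‖v p‖ ≤ A * (1 + ‖p.1.1‖) ^ M * ‖u p‖) : DecayTS v := by
  refine ⟨hv, fun N => ?_⟩
  obtain ⟨C, hC0, hC⟩ := hu.2 (N + M)
  refine ⟨A * C, by positivity, fun p => (h p).trans ?_⟩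
  calc _ ≤ A * (1 + ‖p.1.1‖) ^ M * (C * ((1 + ‖p.1.1‖) ^ (N + M))⁻¹) := by
        gcongr
        exact hC p
    _ = _ := by
        have : (0 : ℝ) < 1 + ‖p.1.1‖ := by positivity
        rw [pow_add]
        field_simp

theorem DecayTS.add {u v : TSphere n → ℂ} (hu : DecayTS u) (hv : DecayTS v) :
    DecayTS fun p => u p + v p := by
  refine ⟨hu.1.add hv.1, fun N => ?_⟩
  obtain ⟨A, hA0, hA⟩ := hu.2 N
  obtain ⟨B, hB0, hB⟩ := hv.2 N
  refine ⟨A + B, by positivity, fun p => (norm_add_le _ _).trans ?_⟩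
  rw [add_mul]
  exact add_le_add (hA p) (hB p)

theorem DecayTS.zero : DecayTS fun _ : TSphere n => 0 :=
  ⟨measurable_const, fun _ => ⟨0, le_rfl, fun p => by simp⟩⟩

theorem DecayTS.sum {ι : Type*} {s : Finset ι} {u : ι → TSphere n → ℂ}
    (hu : ∀ i ∈ s, DecayTS (u i)) : DecayTS fun p => ∑ i ∈ s, u i p := by
  classical
  induction s using Finset.induction_on with
  | empty => simpa using DecayTS.zero
  | insert a s ha ih =>
    simp only [Finset.sum_insert ha]
    exact (hu a (Finset.mem_insert_self a s)).add
      (ih fun i hi => hu i (Finset.mem_insert_of_mem hi))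

/-- Measurable functions on `T𝕊ⁿ⁻¹` of polynomial growth in the first variable. -/
def PolyTS (a : TSphere n → ℂ) : Prop :=
  Measurable a ∧ ∃ (M : ℕ) (A : ℝ), 0 ≤ A ∧ ∀ p, ‖a p‖ ≤ A * (1 + ‖p.1.1‖) ^ M

theorem PolyTS.mul {a u : TSphere n → ℂ} (ha : PolyTS a) (hu : DecayTS u) :
    DecayTS fun p => a p * u p := by
  obtain ⟨h, M, A, hA, hb⟩ := ha
  refine hu.of_le (h.mul hu.1) hA (M := M) fun p => ?_
  rw [norm_mul]
  gcongr
  exact hb p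

theorem PolyTS.mul_poly {a b : TSphere n → ℂ} (ha : PolyTS a) (hb : PolyTS b) :
    PolyTS fun p => a p * b p := by
  obtain ⟨h, M, A, hA, ha⟩ := ha
  obtain ⟨h', M', B, hB, hb⟩ := hb
  refine ⟨h.mul h', M + M', A * B, by positivity, fun p => ?_⟩
  rw [norm_mul, pow_add]
  calc _ ≤ (A * (1 + ‖p.1.1‖) ^ M) * (B * (1 + ‖p.1.1‖) ^ M') := by
        gcongr
        · exact ha p
        · exact hb p
    _ = _ := by ring

theorem PolyTS.const (c : ℂ) : PolyTS fun _ : TSphere n => c :=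
  ⟨measurable_const, 0, ‖c‖, norm_nonneg _, fun p => by simp⟩

theorem abs_coord_le (x : E n) (i : Fin n) : |x i| ≤ ‖x‖ := by
  simpa using PiLp.norm_apply_le x i

theorem PolyTS.fst (i : Fin n) : PolyTS fun p : TSphere n => (p.1.1 i : ℂ) := by
  refine ⟨by fun_prop, 1, 1, zero_le_one, fun p => ?_⟩
  rw [Complex.norm_real, Real.norm_eq_abs]
  have := abs_coord_le p.1.1 i
  linarith

theorem PolyTS.snd (i : Fin n) : PolyTS fun p : TSphere n => (p.1.2 i : ℂ) := by
  refine ⟨by fun_prop, 0, 1, zero_le_one, fun p => ?_⟩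
  rw [Complex.norm_real, Real.norm_eq_abs]
  have := abs_coord_le p.1.2 i
  rw [p.2.1] at this
  linarith

theorem DecayTS.conj {u : TSphere n → ℂ} (hu : DecayTS u) : DecayTS fun p => conj (u p) :=
  hu.of_le (M := 0) (A := 1) (Complex.continuous_conj.measurable.comp hu.1) zero_le_one
    fun p => by simp

theorem DecayTS.poly {u : TSphere n → ℂ} (hu : DecayTS u) : PolyTS u := by
  obtain ⟨C, hC0, hC⟩ := hu.2 0
  exact ⟨hu.1, 0, C, hC0, fun p => by simpa using hC p⟩

end Weights

/-! ### Matrix algebra: the square of `G` and the recovery of its scalar entries. -/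

section TensorAlgebra

open Matrix

variable {n : ℕ}

/-- The bilinear pairing of two matrices. -/
def pairing (M N : Matrix (Fin n) (Fin n) ℂ) : ℂ := ∑ i, ∑ j, M i j * N i j

theorem pairing_add_left (M M' N : Matrix (Fin n) (Fin n) ℂ) :
    pairing (M + M') N = pairing M N + pairing M' N := by
  simp [pairing, add_mul, Finset.sum_add_distrib]

theorem pairing_smul_left (c : ℂ) (M N : Matrix (Fin n) (Fin n) ℂ) :
    pairing (c • M) N = c * pairing M N := by
  simp [pairing, mul_assoc, Finset.mul_sum]

theorem pairing_comm (M N : Matrix (Fin n) (Fin n) ℂ) : pairing M N = pairing N M := by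
  simp only [pairing, mul_comm]

theorem pairing_add_right (M N N' : Matrix (Fin n) (Fin n) ℂ) :
    pairing M (N + N') = pairing M N + pairing M N' := by
  rw [pairing_comm, pairing_add_left, pairing_comm N, pairing_comm N']

theorem pairing_smul_right (c : ℂ) (M N : Matrix (Fin n) (Fin n) ℂ) :
    pairing M (c • N) = c * pairing M N := by
  rw [pairing_comm, pairing_smul_left, pairing_comm]

theorem pairing_vecMulVec_right (M : Matrix (Fin n) (Fin n) ℂ) (a b : Fin n → ℂ) :
    pairing M (vecMulVec a b) = a ⬝ᵥ (M *ᵥ b) := by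
  simp only [pairing, vecMulVec_apply, dotProduct, mulVec, Finset.mul_sum]
  exact Finset.sum_congr rfl fun i _ => Finset.sum_congr rfl fun j _ => by ring

theorem pairing_vecMulVec_left (M : Matrix (Fin n) (Fin n) ℂ) (a b : Fin n → ℂ) :
    pairing (vecMulVec a b) M = a ⬝ᵥ (M *ᵥ b) := by
  rw [pairing_comm, pairing_vecMulVec_right]

theorem pairing_one_right (M : Matrix (Fin n) (Fin n) ℂ) : pairing M 1 = trace M := by
  simp [pairing, one_apply, trace]

theorem pairing_one_left (M : Matrix (Fin n) (Fin n) ℂ) : pairing 1 M = trace M := by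
  rw [pairing_comm, pairing_one_right]

theorem dot_vecMulVec_mulVec (a b c d : Fin n → ℂ) :
    a ⬝ᵥ (vecMulVec b c *ᵥ d) = (a ⬝ᵥ b) * (c ⬝ᵥ d) := by
  rw [vecMulVec_mulVec, dotProduct_smul]
  simp

/-- The tensor `G` built from the jets of the three Fourier transforms. -/
def symbolG (J : ℂ) (y ξ : Fin n → ℂ) (u v w : ℂ) (U V P : Fin n → ℂ)
    (H : Matrix (Fin n) (Fin n) ℂ) : Matrix (Fin n) (Fin n) ℂ :=
  H + (2 : ℂ) • vecMulVec U ξ + vecMulVec ξ U + (2 * u) • (1 : Matrix (Fin n) (Fin n) ℂ) +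
    (-J * v) • vecMulVec y ξ + (-J * v) • vecMulVec ξ y + (-J) • vecMulVec y V +
    (-J) • vecMulVec V y + (-w) • vecMulVec y y + (-1 : ℂ) • vecMulVec y P

/-- The relations between the jets. -/
structure JetRelations (y ξ U V P : Fin n → ℂ) (H : Matrix (Fin n) (Fin n) ℂ) : Prop where
  unit : ξ ⬝ᵥ ξ = 1
  orth : ξ ⬝ᵥ y = 0
  orthU : ξ ⬝ᵥ U = 0
  orthV : ξ ⬝ᵥ V = 0
  orthP : ξ ⬝ᵥ P = 0
  left : ∀ a, ξ ⬝ᵥ (H *ᵥ a) = 0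
  right : H *ᵥ ξ = -U
  comm : H = Hᵀ + vecMulVec ξ U + (-1 : ℂ) • vecMulVec U ξ + vecMulVec y P +
    (-1 : ℂ) • vecMulVec P y

theorem dot_transpose_mulVec (H : Matrix (Fin n) (Fin n) ℂ) (a b : Fin n → ℂ) :
    a ⬝ᵥ (Hᵀ *ᵥ b) = b ⬝ᵥ (H *ᵥ a) := by
  rw [mulVec_transpose, dotProduct_comm, ← dotProduct_mulVec]

/-- The commutator of `Ξ_i` and `Ξ_j` measures the failure of `H` to be symmetric; contracted with
`y` and a vector orthogonal to `ξ`, only the `P` terms survive. -/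
theorem JetRelations.swap {y ξ U V P : Fin n → ℂ} {H : Matrix (Fin n) (Fin n) ℂ}
    (h : JetRelations y ξ U V P H) {a : Fin n → ℂ} (ha : ξ ⬝ᵥ a = 0) :
    a ⬝ᵥ (H *ᵥ y) = y ⬝ᵥ (H *ᵥ a) - (y ⬝ᵥ y) * (P ⬝ᵥ a) + (y ⬝ᵥ P) * (y ⬝ᵥ a) := by
  conv_rhs => rw [h.comm]
  simp only [add_mulVec, dotProduct_add, smul_mulVec, dotProduct_smul, dot_vecMulVec_mulVec,
    dot_transpose_mulVec, ha, dotProduct_comm y ξ, h.orth, smul_eq_mul]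
  ring

/-- All ten-by-ten products are expanded; orthogonality to `ξ` removes most of them, and `swap`
moves `y` to the left of `H` in the rest. The form is bilinear with `-J` in the second factor, so
that setting `J = i` and conjugating the second jets gives `|G|²`. -/
theorem pairing_symbolG {J : ℂ} (hJ : J * J = -1) {y ξ : Fin n → ℂ} {u v w : ℂ} {U V P : Fin n → ℂ}
    {H : Matrix (Fin n) (Fin n) ℂ} {u' v' w' : ℂ} {U' V' P' : Fin n → ℂ}
    {H' : Matrix (Fin n) (Fin n) ℂ} (h : JetRelations y ξ U V P H)
    (h' : JetRelations y ξ U' V' P' H') :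
    pairing (symbolG J y ξ u v w U V P H) (symbolG (-J) y ξ u' v' w' U' V' P' H') =
      (y ⬝ᵥ y) ^ 2 * (w * w') - 2 * J * (y ⬝ᵥ y) * (w * (y ⬝ᵥ V') - w' * (y ⬝ᵥ V)) +
      2 * (y ⬝ᵥ y) * (V ⬝ᵥ V') + 2 * (y ⬝ᵥ y) * (v * v') + 2 * ((y ⬝ᵥ V) * (y ⬝ᵥ V')) +
      (y ⬝ᵥ y) * (w * (y ⬝ᵥ P') + w' * (y ⬝ᵥ P)) - 2 * (y ⬝ᵥ y) * (w * u' + w' * u) -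
      (w * (y ⬝ᵥ (H' *ᵥ y)) + w' * (y ⬝ᵥ (H *ᵥ y))) +
      2 * J * (y ⬝ᵥ y) * (V ⬝ᵥ P' - P ⬝ᵥ V') -
      4 * J * ((y ⬝ᵥ V) * u' - (y ⬝ᵥ V') * u) - 2 * J * (v * (y ⬝ᵥ U') - v' * (y ⬝ᵥ U)) -
      2 * J * (y ⬝ᵥ (H' *ᵥ V) - y ⬝ᵥ (H *ᵥ V')) + (y ⬝ᵥ y) * (P ⬝ᵥ P') -
      (y ⬝ᵥ (H' *ᵥ P) + y ⬝ᵥ (H *ᵥ P')) - 2 * ((y ⬝ᵥ P) * u' + (y ⬝ᵥ P') * u) +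
      pairing H H' + 2 * (trace H * u' + trace H' * u) + U ⬝ᵥ U' + 4 * n * (u * u') := by
  have e1 := h.swap h'.orthV
  have e2 := h'.swap h.orthV
  simp only [symbolG, pairing_add_left, pairing_add_right, pairing_smul_left, pairing_smul_right,
    pairing_vecMulVec_right, pairing_vecMulVec_left, pairing_one_right, pairing_one_left,
    add_mulVec, dotProduct_add, smul_mulVec, dotProduct_smul, trace_add, trace_smul, smul_eq_mul,
    dot_vecMulVec_mulVec, e1, e2, h.left, h'.left, h.right, h'.right, h.unit, h.orth, h.orthU,
    h.orthV, h.orthP, h'.orthU, h'.orthV, h'.orthP, dotProduct_comm y ξ, dotProduct_comm U ξ,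
    dotProduct_comm V ξ, dotProduct_comm P ξ, dotProduct_comm U' ξ, dotProduct_comm V' ξ,
    dotProduct_neg, trace_one, trace_vecMulVec, one_mulVec, Fintype.card_fin,
    dotProduct_comm V' y, dotProduct_comm V y, dotProduct_comm U y, dotProduct_comm U' y,
    dotProduct_comm P y, dotProduct_comm V' V, dotProduct_comm U' U,
    dotProduct_comm P' V]
  linear_combination (-2 * (v * (y ⬝ᵥ y) * v') - 2 * ((y ⬝ᵥ y) * (V ⬝ᵥ V')) -
    2 * ((y ⬝ᵥ V) * (y ⬝ᵥ V'))) * hJ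

/-- Start of the triangular recovery of `u`, `v`, `w` from `G`: the contraction with `ξ`, `ξ` sees
only `u`. When `u` and its jets vanish, the contraction with `y`, `ξ` sees only `v`, and when `v`
and its jets vanish too, the one with `y`, `y` sees only `w`. -/
theorem trace_pairing_symbolG {J : ℂ} {y ξ : Fin n → ℂ} {u v w : ℂ} {U V P : Fin n → ℂ}
    {H : Matrix (Fin n) (Fin n) ℂ} (h : JetRelations y ξ U V P H) :
    ξ ⬝ᵥ (symbolG J y ξ u v w U V P H *ᵥ ξ) = 2 * u := by
  simp only [symbolG, add_mulVec, dotProduct_add, smul_mulVec, dotProduct_smul, smul_eq_mul,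
    dot_vecMulVec_mulVec, h.left, h.unit, h.orth, h.orthU, h.orthV, one_mulVec,
    dotProduct_comm y ξ, dotProduct_comm U ξ]
  ring

theorem symbolG_mulVec_of_eq_zero {J : ℂ} {y ξ : Fin n → ℂ} {v w : ℂ} {V : Fin n → ℂ}
    (h1 : ξ ⬝ᵥ ξ = 1) (h2 : ξ ⬝ᵥ y = 0) (h3 : ξ ⬝ᵥ V = 0) :
    y ⬝ᵥ (symbolG J y ξ 0 v w 0 V 0 0 *ᵥ ξ) = -J * v * (y ⬝ᵥ y) := by
  have h2' : y ⬝ᵥ ξ = 0 := by rw [dotProduct_comm, h2]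
  have h3' : V ⬝ᵥ ξ = 0 := by rw [dotProduct_comm, h3]
  simp only [symbolG, add_mulVec, dotProduct_add, smul_mulVec, dotProduct_smul, smul_eq_mul,
    dot_vecMulVec_mulVec, h1, h2', h3', one_mulVec, zero_mulVec, dotProduct_zero,
    zero_dotProduct]
  ring

theorem symbolG_quadratic_of_eq_zero {J : ℂ} {y ξ : Fin n → ℂ} {w : ℂ} :
    y ⬝ᵥ (symbolG J y ξ 0 0 w 0 0 0 0 *ᵥ y) = -w * (y ⬝ᵥ y) ^ 2 := by
  simp only [symbolG, add_mulVec, dotProduct_add, smul_mulVec, dotProduct_smul, smul_eq_mul,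
    dot_vecMulVec_mulVec, one_mulVec, zero_mulVec, dotProduct_zero, zero_dotProduct]
  ring

end TensorAlgebra

/-! ### Linearity of the Fourier transform and the relations between the jets. -/

section JetMaps

open MeasureTheory

variable {n : ℕ}

/-- The Fourier transform on `𝓢(T𝕊ⁿ⁻¹)` as a linear map. -/
def hatL : SchwartzTS n →ₗ[ℂ] (TSphere n → ℂ) where
  toFun φ := hatTS φ.1
  map_add' φ ψ := by
    funext p
    have h (χ : SchwartzTS n) := integrable_kernelExp_mul p.1.1
      ((decaySymbol_lift χ.2).integrable_mul p.2.1 0 0).1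
    rw [Pi.add_apply, hatTS_eq φ.2, hatTS_eq ψ.2, hatTS_eq (φ + ψ).2, ← mul_add, partialFourier,
      partialFourier, partialFourier, ← integral_add (h φ) (h ψ)]
    congr 2
    funext x
    simp only [lift, Submodule.coe_add, extend_add, Pi.add_apply]
    ring
  map_smul' c φ := by
    funext p
    rw [Pi.smul_apply, hatTS_eq φ.2, hatTS_eq (c • φ).2, partialFourier, partialFourier,
      RingHom.id_apply, smul_eq_mul, mul_left_comm, ← integral_const_mul c]
    congr 2
    funext x
    simp only [lift, Submodule.coe_smul, extend_smul, Pi.smul_apply, smul_eq_mul]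
    ring

/-- The operator `Ξ_i` on `𝓢(T𝕊ⁿ⁻¹)`. -/
def opXiL (i : Fin n) : SchwartzTS n →ₗ[ℂ] SchwartzTS n where
  toFun φ := ⟨opXi i φ.1, opXi_mem i φ.2⟩
  map_add' φ ψ := by
    apply Subtype.ext
    funext p
    simp only [Submodule.coe_add, opXi, extend_add, Pi.add_apply]
    rw [fderiv_add (differentiableAt_extend φ.2 p) (differentiableAt_extend ψ.2 p)]
    rfl
  map_smul' c φ := by
    apply Subtype.ext
    funext p
    simp only [Submodule.coe_smul, opXi, extend_smul, Pi.smul_apply, RingHom.id_apply]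
    rw [fderiv_const_smul (differentiableAt_extend φ.2 p)]
    rfl

/-- Multiplication by `x_i` on `𝓢(T𝕊ⁿ⁻¹)`. -/
def mulXL (i : Fin n) : SchwartzTS n →ₗ[ℂ] SchwartzTS n where
  toFun φ := ⟨mulX i φ.1, mulX_mem i φ.2⟩
  map_add' φ ψ := by
    apply Subtype.ext
    funext p
    simp [mulX, mul_add]
  map_smul' c φ := by
    apply Subtype.ext
    funext p
    simp [mulX, mul_left_comm]

theorem hatTS_add {φ ψ : TSphere n → ℂ} (hφ : φ ∈ SchwartzTS n) (hψ : ψ ∈ SchwartzTS n)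
    (p : TSphere n) : hatTS (φ + ψ) p = hatTS φ p + hatTS ψ p :=
  congrFun (map_add hatL ⟨φ, hφ⟩ ⟨ψ, hψ⟩) p

theorem hatTS_sub {φ ψ : TSphere n → ℂ} (hφ : φ ∈ SchwartzTS n) (hψ : ψ ∈ SchwartzTS n)
    (p : TSphere n) : hatTS (φ - ψ) p = hatTS φ p - hatTS ψ p :=
  congrFun (map_sub hatL ⟨φ, hφ⟩ ⟨ψ, hψ⟩) p

theorem hatTS_sum {φ : Fin n → TSphere n → ℂ} (hφ : ∀ i, φ i ∈ SchwartzTS n) (p : TSphere n) :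
    hatTS (∑ i, φ i) p = ∑ i, hatTS (φ i) p := by
  have := congrFun (map_sum hatL (fun i => (⟨φ i, hφ i⟩ : SchwartzTS n)) Finset.univ) p
  rw [Finset.sum_apply] at this
  have h : ((∑ i, (⟨φ i, hφ i⟩ : SchwartzTS n) : SchwartzTS n) : TSphere n → ℂ) = ∑ i, φ i := by
    rw [Submodule.coe_sum]
  rw [← h]
  exact this

theorem hatTS_mulXi (φ : TSphere n → ℂ) (i : Fin n) (p : TSphere n) :
    hatTS (mulXi i φ) p = (p.1.2 i : ℂ) * hatTS φ p := by
  rw [hatTS, hatTS, mul_left_comm, ← integral_const_mul (p.1.2 i : ℂ)]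
  congr 2
  funext x
  simp only [mulXi, tsPoint]
  ring

open Matrix

/-- The jets of the Fourier transforms of functions in `𝓢(T𝕊ⁿ⁻¹)` satisfy `JetRelations`. -/
theorem jetRelations {φ ψ : TSphere n → ℂ} (hφ : φ ∈ SchwartzTS n) (hψ : ψ ∈ SchwartzTS n)
    (p : TSphere n) :
    JetRelations (fun i => (p.1.1 i : ℂ)) (fun i => (p.1.2 i : ℂ)) (fun i => hatTS (opXi i φ) p)
      (fun i => hatTS (opXi i ψ) p) (fun i => -Complex.I * hatTS (mulX i φ) p)
      (Matrix.of fun i j => hatTS (opXi i (opXi j φ)) p) where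
  unit := by
    have h : ∑ i, p.1.2 i * p.1.2 i = 1 := by
      have := EuclideanSpace.real_norm_sq_eq p.1.2
      rw [p.2.1] at this
      simp only [pow_two] at this
      linarith
    simp only [dotProduct]
    exact_mod_cast h
  orth := by
    have h := p.2.2
    simp only [PiLp.inner_apply, RCLike.inner_apply, conj_trivial] at h
    simp only [dotProduct]
    simp only [mul_comm (p.1.2 _ : ℂ)]
    exact_mod_cast h
  orthU := by
    simp only [dotProduct, hatTS_opXi hφ]
    exact sum_xi_opXi _ p
  orthV := by
    simp only [dotProduct, hatTS_opXi hψ]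
    exact sum_xi_opXi _ p
  orthP := by
    simp only [dotProduct, ← opX_hatTS hφ]
    exact sum_xi_opX _ p
  left a := by
    simp only [dotProduct, mulVec, Matrix.of_apply, Finset.mul_sum]
    rw [Finset.sum_comm]
    refine Finset.sum_eq_zero fun j _ => ?_
    simp only [hatTS_opXi (opXi_mem j hφ), ← mul_assoc]
    rw [← Finset.sum_mul, sum_xi_opXi, zero_mul]
  right := by
    funext i
    have hm (j : Fin n) : mulXi j (opXi i (opXi j φ)) ∈ SchwartzTS n :=
      mulXi_mem j (opXi_mem i (opXi_mem j hφ))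
    -- The relation is proved for `φ` itself and then transformed: multiplication by `ξ_j` commutes
    -- with the fibrewise Fourier transform, and `Ξ_i` passes through it.
    have h0 : ∑ j, mulXi j (opXi i (opXi j φ)) + opXi i φ = 0 := by
      funext q
      rw [Pi.add_apply, Finset.sum_apply]
      simp only [mulXi]
      rw [sum_xi_opXi_opXi hφ]
      simp
    have h1 := hatTS_add ((SchwartzTS n).sum_mem (t := Finset.univ) fun j _ => hm j) (opXi_mem i hφ) p
    rw [h0, hatTS_sum hm] at h1
    have h2 : hatTS (0 : TSphere n → ℂ) p = 0 := congrFun (map_zero hatL) p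
    rw [h2] at h1
    simp only [hatTS_mulXi] at h1
    simp only [mulVec, dotProduct, Matrix.of_apply, Pi.neg_apply]
    rw [eq_neg_iff_add_eq_zero, h1]
    simp only [mul_comm]
  comm := by
    ext i j
    have hO (i j : Fin n) := opXi_mem i (opXi_mem j hφ)
    -- Transforming the commutator of `φ` turns the outer `X_j` into `i y_j`, which yields the terms
    -- in `y` and `P`.
    have h0 : opXi i (opXi j φ) - opXi j (opXi i φ) = mulXi i (opXi j φ) - mulXi j (opXi i φ) +
        opX j (mulX i φ) - opX i (mulX j φ) := by
      funext q
      exact opXi_commutator hφ i j q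
    have h1 := hatTS_sub (hO i j) (hO j i) p
    have hA (i j : Fin n) := mulXi_mem i (opXi_mem j hφ)
    have hB (i j : Fin n) := opX_mem j (mulX_mem i hφ)
    rw [h0, hatTS_sub ((SchwartzTS n).add_mem ((SchwartzTS n).sub_mem (hA i j) (hA j i)) (hB i j))
      (hB j i), hatTS_add ((SchwartzTS n).sub_mem (hA i j) (hA j i)) (hB i j),
      hatTS_sub (hA i j) (hA j i), hatTS_mulXi, hatTS_mulXi, hatTS_opX (mulX_mem i hφ),
      hatTS_opX (mulX_mem j hφ)] at h1
    simp only [Matrix.add_apply, Matrix.smul_apply, Matrix.transpose_apply, Matrix.of_apply,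
      vecMulVec_apply, smul_eq_mul]
    linear_combination -h1

end JetMaps

/-! ### The tensor field `G` of a triple; conjugation and decay of its ingredients. -/

section Jets

open Matrix

variable {n : ℕ}

/-- The first component of a point of `T𝕊ⁿ⁻¹` as a complex vector. -/
def yC (p : TSphere n) : Fin n → ℂ := fun i => (p.1.1 i : ℂ)

/-- The second component of a point of `T𝕊ⁿ⁻¹` as a complex vector. -/
def xiC (p : TSphere n) : Fin n → ℂ := fun i => (p.1.2 i : ℂ)

/-- The vector `Ξ_i φ̂`. -/
def jetXi (φ : TSphere n → ℂ) (p : TSphere n) : Fin n → ℂ := fun i => hatTS (opXi i φ) p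

/-- The vector `X_i φ̂`. -/
def jetX (φ : TSphere n → ℂ) (p : TSphere n) : Fin n → ℂ :=
  fun i => -Complex.I * hatTS (mulX i φ) p

/-- The matrix `Ξ_i Ξ_j φ̂`. -/
def jetXi2 (φ : TSphere n → ℂ) (p : TSphere n) : Matrix (Fin n) (Fin n) ℂ :=
  Matrix.of fun i j => hatTS (opXi i (opXi j φ)) p

/-- The tensor field whose weighted square norm is `tripleNormSq`. -/
def hatG (φ ψ χ : TSphere n → ℂ) (p : TSphere n) : Matrix (Fin n) (Fin n) ℂ :=
  symbolG Complex.I (yC p) (xiC p) (hatTS φ p) (hatTS ψ p) (hatTS χ p) (jetXi φ p) (jetXi ψ p)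
    (jetX φ p) (jetXi2 φ p)

theorem symbolG_map_star (J : ℂ) {y ξ : Fin n → ℂ} (hy : star y = y) (hξ : star ξ = ξ)
    (u v w : ℂ) (U V P : Fin n → ℂ) (H : Matrix (Fin n) (Fin n) ℂ) :
    (symbolG J y ξ u v w U V P H).map star =
      symbolG (star J) y ξ (star u) (star v) (star w) (star U) (star V) (star P) (H.map star) := by
  have hy' (i : Fin n) : conj (y i) = y i := congrFun hy i
  have hξ' (i : Fin n) : conj (ξ i) = ξ i := congrFun hξ i
  ext i j
  by_cases hij : i = j <;>
  simp [symbolG, vecMulVec_apply, hy', hξ', hij, map_ofNat (starRingEnd ℂ) 2]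

theorem JetRelations.star {y ξ U V P : Fin n → ℂ} {H : Matrix (Fin n) (Fin n) ℂ}
    (h : JetRelations y ξ U V P H) (hy : star y = y) (hξ : star ξ = ξ) :
    JetRelations y ξ (star U) (star V) (star P) (H.map star) where
  unit := h.unit
  orth := h.orth
  orthU := by rw [← hξ, star_dotProduct_star, dotProduct_comm, h.orthU, star_zero]
  orthV := by rw [← hξ, star_dotProduct_star, dotProduct_comm, h.orthV, star_zero]
  orthP := by rw [← hξ, star_dotProduct_star, dotProduct_comm, h.orthP, star_zero]
  left a := by
    have h1 := congrArg (Star.star) (h.left (Star.star a))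
    simp only [dotProduct, mulVec, star_sum, star_mul', Pi.star_apply, star_star, star_zero] at h1
    simp only [dotProduct, mulVec, Matrix.map_apply]
    rw [← h1]
    exact Finset.sum_congr rfl fun i _ => congrArg (· * _) (congrFun hξ i).symm
  right := by
    funext i
    have h1 := congrArg (Star.star) (congrFun h.right i)
    simp only [dotProduct, mulVec, star_sum, star_mul', Pi.neg_apply, star_neg] at h1
    simp only [dotProduct, mulVec, Matrix.map_apply, Pi.neg_apply, Pi.star_apply]
    rw [← h1]
    refine Finset.sum_congr rfl fun j _ => ?_
    rw [← Pi.star_apply ξ, hξ]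
  comm := by
    ext i j
    have h1 := congrArg (Star.star) (congrFun (congrFun h.comm i) j)
    simp only [Matrix.add_apply, Matrix.smul_apply, Matrix.transpose_apply, vecMulVec_apply,
      smul_eq_mul, star_add, star_mul', star_neg, star_one, ← Pi.star_apply y, hy,
      ← Pi.star_apply ξ, hξ] at h1
    simp only [Matrix.add_apply, Matrix.smul_apply, Matrix.transpose_apply, vecMulVec_apply,
      smul_eq_mul, Matrix.map_apply, Pi.star_apply]
    exact h1

theorem star_yC (p : TSphere n) : star (yC p) = yC p := by
  funext i
  simp [yC]

theorem star_xiC (p : TSphere n) : star (xiC p) = xiC p := by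
  funext i
  simp [xiC]

theorem yC_dot_yC (p : TSphere n) : yC p ⬝ᵥ yC p = (‖p.1.1‖ : ℂ) ^ 2 := by
  have h := EuclideanSpace.real_norm_sq_eq p.1.1
  simp only [yC, dotProduct]
  rw [← Complex.ofReal_pow, h]
  push_cast
  exact Finset.sum_congr rfl fun i _ => (pow_two _).symm

theorem conj_yC (p : TSphere n) (i : Fin n) : conj (yC p i) = yC p i := Complex.conj_ofReal _

theorem conj_yC_dot (p : TSphere n) (a : Fin n → ℂ) : conj (yC p ⬝ᵥ a) = yC p ⬝ᵥ star a := by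
  simp [dotProduct, conj_yC]

theorem conj_yC_vecMul (p : TSphere n) (H : Matrix (Fin n) (Fin n) ℂ) (i : Fin n) :
    conj ((yC p ᵥ* H) i) = (yC p ᵥ* H.map star) i := by
  simp [vecMul, dotProduct, conj_yC]

theorem conj_yC_quadratic (p : TSphere n) (H : Matrix (Fin n) (Fin n) ℂ) :
    conj (yC p ⬝ᵥ (H *ᵥ yC p)) = yC p ⬝ᵥ (H.map star *ᵥ yC p) := by
  simp [mulVec, dotProduct, conj_yC]

theorem hatZ_eq {φ : TSphere n → ℂ} (hφ : φ ∈ SchwartzTS n) (p : TSphere n) :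
    hatZ φ p = (yC p ⬝ᵥ jetXi φ p) / (‖p.1.1‖ : ℂ) := by
  simp only [hatZ, yC, jetXi, dotProduct, hatTS_opXi hφ]

theorem hatW_eq {φ : TSphere n → ℂ} (hφ : φ ∈ SchwartzTS n) (p : TSphere n) :
    hatW φ p = (yC p ⬝ᵥ jetX φ p) / (‖p.1.1‖ : ℂ) := by
  simp only [hatW, yC, jetX, dotProduct, opX_hatTS hφ]

theorem hatQ_eq {φ : TSphere n → ℂ} (hφ : φ ∈ SchwartzTS n) (p : TSphere n) :
    hatQ φ p = (yC p ⬝ᵥ (jetXi2 φ p *ᵥ yC p)) / (‖p.1.1‖ : ℂ) ^ 2 := by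
  have h (j : Fin n) : opXi j (hatTS φ) = hatTS (opXi j φ) :=
    funext fun p => (hatTS_opXi hφ j p).symm
  simp only [hatQ, yC, jetXi2, dotProduct, mulVec, h, ← hatTS_opXi (opXi_mem _ hφ), Finset.mul_sum,
    Matrix.of_apply]
  congr 1
  exact Finset.sum_congr rfl fun i _ => Finset.sum_congr rfl fun j _ => by ring

theorem hatZ_opXi_eq {φ : TSphere n → ℂ} (hφ : φ ∈ SchwartzTS n) (i : Fin n) (p : TSphere n) :
    hatZ (opXi i φ) p = (yC p ᵥ* jetXi2 φ p) i / (‖p.1.1‖ : ℂ) := by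
  rw [hatZ_eq (opXi_mem i hφ)]
  rfl

theorem hatTS_mulX_eq (φ : TSphere n → ℂ) (i : Fin n) (p : TSphere n) :
    hatTS (mulX i φ) p = Complex.I * jetX φ p i := by
  rw [jetX, ← mul_assoc, mul_neg, Complex.I_mul_I, neg_neg, one_mul]

/-- The quotient `y_i / |y|` is at most `1` in modulus and takes the value `0` at `y = 0`, so the
operators `Z`, `Q`, `W` lose no decay. Continuity at `y = 0` may be lost, and measurability is all
that `DecayTS` asks. -/
theorem DecayTS.div_norm {u : TSphere n → ℂ} (hu : DecayTS u) (i : Fin n) :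
    DecayTS fun p => yC p i * u p / (‖p.1.1‖ : ℂ) := by
  have hu' := hu.1
  refine hu.of_le (M := 0) (A := 1) (by unfold yC; fun_prop) zero_le_one fun p => ?_
  rw [mul_div_right_comm, norm_mul, pow_zero, mul_one, norm_div, yC, Complex.norm_real,
    Complex.norm_real, norm_norm]
  gcongr
  exact div_le_one_of_le₀ (abs_coord_le p.1.1 i) (norm_nonneg _)

theorem decayTS_hatZ {φ : TSphere n → ℂ} (hφ : φ ∈ SchwartzTS n) : DecayTS (hatZ φ) := by
  have h : hatZ φ = fun p => ∑ i, yC p i * hatTS (opXi i φ) p / (‖p.1.1‖ : ℂ) := by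
    funext p
    rw [hatZ_eq hφ, dotProduct, Finset.sum_div]
    rfl
  rw [h]
  exact DecayTS.sum fun i _ => (decayTS_hatTS (opXi_mem i hφ)).div_norm i

theorem decayTS_hatW {φ : TSphere n → ℂ} (hφ : φ ∈ SchwartzTS n) : DecayTS (hatW φ) := by
  have h : hatW φ = fun p => ∑ i, yC p i * (-Complex.I * hatTS (mulX i φ) p) / (‖p.1.1‖ : ℂ) := by
    funext p
    rw [hatW_eq hφ, dotProduct, Finset.sum_div]
    rfl
  rw [h]
  exact DecayTS.sum fun i _ =>
    ((PolyTS.const (-Complex.I)).mul (decayTS_hatTS (mulX_mem i hφ))).div_norm i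

theorem decayTS_hatQ {φ : TSphere n → ℂ} (hφ : φ ∈ SchwartzTS n) : DecayTS (hatQ φ) := by
  have h : hatQ φ = fun p => ∑ i, ∑ j, yC p i * (yC p j * hatTS (opXi i (opXi j φ)) p /
      (‖p.1.1‖ : ℂ)) / (‖p.1.1‖ : ℂ) := by
    funext p
    rw [hatQ_eq hφ, dotProduct, Finset.sum_div]
    refine Finset.sum_congr rfl fun i _ => ?_
    simp only [mulVec, dotProduct, jetXi2, Matrix.of_apply, Finset.mul_sum, Finset.sum_div]
    refine Finset.sum_congr rfl fun j _ => ?_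
    rw [mul_div_assoc', div_div, pow_two]
    ring
  rw [h]
  exact DecayTS.sum fun i _ => DecayTS.sum fun j _ =>
    ((decayTS_hatTS (opXi_mem i (opXi_mem j hφ))).div_norm j).div_norm i

theorem decayTS_hatG {φ ψ χ : TSphere n → ℂ} (hφ : φ ∈ SchwartzTS n) (hψ : ψ ∈ SchwartzTS n)
    (hχ : χ ∈ SchwartzTS n) (i j : Fin n) : DecayTS fun p => hatG φ ψ χ p i j := by
  have hU (i : Fin n) := decayTS_hatTS (opXi_mem i hφ)
  have hV (i : Fin n) := decayTS_hatTS (opXi_mem i hψ)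
  have hP (i : Fin n) := (PolyTS.const (-Complex.I)).mul (decayTS_hatTS (mulX_mem i hφ))
  have hI := PolyTS.const (n := n) (-Complex.I)
  have hv := hI.mul (decayTS_hatTS hψ)
  simp only [hatG, symbolG, Matrix.add_apply, Matrix.smul_apply, vecMulVec_apply, smul_eq_mul,
    jetXi, jetX, jetXi2, Matrix.of_apply, mul_comm (hatTS (opXi _ φ) _) (xiC _ _),
    mul_comm (hatTS (opXi _ ψ) _) (yC _ _)]
  refine DecayTS.add (DecayTS.add (DecayTS.add (DecayTS.add (DecayTS.add (DecayTS.add (DecayTS.add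
    (DecayTS.add (DecayTS.add ?_ ?_) ?_) ?_) ?_) ?_) ?_) ?_) ?_) ?_
  · exact decayTS_hatTS (opXi_mem i (opXi_mem j hφ))
  · exact (PolyTS.const 2).mul ((PolyTS.snd j).mul (hU i))
  · exact (PolyTS.snd i).mul (hU j)
  · simp only [mul_assoc, mul_comm (hatTS φ _)]
    exact (PolyTS.const 2).mul ((PolyTS.const _).mul (decayTS_hatTS hφ))
  · simp only [mul_comm (-Complex.I * hatTS ψ _)]
    exact ((PolyTS.fst i).mul_poly (PolyTS.snd j)).mul hv
  · simp only [mul_comm (-Complex.I * hatTS ψ _)]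
    exact ((PolyTS.snd i).mul_poly (PolyTS.fst j)).mul hv
  · exact hI.mul ((PolyTS.fst i).mul (hV j))
  · exact hI.mul ((PolyTS.fst j).mul (hV i))
  · have h := ((PolyTS.fst i).mul_poly (PolyTS.fst j)).mul
      ((PolyTS.const (-1)).mul (decayTS_hatTS hχ))
    refine (congrArg DecayTS (funext fun p => ?_)).mp h
    simp only [yC]
    ring
  · exact (PolyTS.const (-1)).mul ((PolyTS.fst i).mul (hP j))

end Jets

/-! ### Linear calculus of integrals against the single weight with indices `s + 1/2`, `t + 1/2`. -/

section WeightedIntegral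

open MeasureTheory Metric

variable {n : ℕ} {ξ₀ : sphere (0 : E n) 1} {s t : ℝ}

/-- The function `f` on `T𝕊ⁿ⁻¹` has the weighted integral `c`. -/
def HasWInt (ξ₀ : sphere (0 : E n) 1) (s t : ℝ) (f : TSphere n → ℂ) (c : ℂ) : Prop :=
  Integrable (fun p => (weight (s + 1 / 2) (t + 1 / 2) ‖p.1.1‖ : ℂ) * f p) (tsMeasure ξ₀) ∧
    ((1 / (2 * Real.pi) : ℝ) : ℂ) *
      ∫ p, (weight (s + 1 / 2) (t + 1 / 2) ‖p.1.1‖ : ℂ) * f p ∂(tsMeasure ξ₀) = c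

theorem HasWInt.add {f g : TSphere n → ℂ} {c d : ℂ} (hf : HasWInt ξ₀ s t f c)
    (hg : HasWInt ξ₀ s t g d) : HasWInt ξ₀ s t (fun p => f p + g p) (c + d) := by
  unfold HasWInt
  simp only [mul_add]
  refine ⟨hf.1.add hg.1, ?_⟩
  rw [integral_add hf.1 hg.1, mul_add, hf.2, hg.2]

theorem HasWInt.const_mul {f : TSphere n → ℂ} {c : ℂ} (a : ℂ) (hf : HasWInt ξ₀ s t f c) :
    HasWInt ξ₀ s t (fun p => a * f p) (a * c) := by
  unfold HasWInt
  simp only [mul_left_comm _ a]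
  refine ⟨hf.1.const_mul a, ?_⟩
  rw [integral_const_mul, mul_left_comm, hf.2]

theorem HasWInt.sub {f g : TSphere n → ℂ} {c d : ℂ} (hf : HasWInt ξ₀ s t f c)
    (hg : HasWInt ξ₀ s t g d) : HasWInt ξ₀ s t (fun p => f p - g p) (c - d) := by
  have := hf.add (hg.const_mul (-1))
  simpa only [neg_one_mul, ← sub_eq_add_neg] using this

theorem HasWInt.conj {f : TSphere n → ℂ} {c : ℂ} (hf : HasWInt ξ₀ s t f c) :
    HasWInt ξ₀ s t (fun p => conj (f p)) (conj c) := by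
  have h (p : TSphere n) : (weight (s + 1 / 2) (t + 1 / 2) ‖p.1.1‖ : ℂ) * conj (f p) =
      conj ((weight (s + 1 / 2) (t + 1 / 2) ‖p.1.1‖ : ℂ) * f p) := by
    rw [map_mul, Complex.conj_ofReal]
  unfold HasWInt
  simp only [h]
  refine ⟨(Complex.conjCLE.toContinuousLinearMap).integrable_comp hf.1, ?_⟩
  rw [integral_conj, ← hf.2, map_mul, Complex.conj_ofReal]

theorem HasWInt.re {f : TSphere n → ℂ} {c : ℂ} (hf : HasWInt ξ₀ s t f c) :
    HasWInt ξ₀ s t (fun p => 1 / 2 * (f p + conj (f p))) (c.re : ℂ) := by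
  have := (hf.add hf.conj).const_mul (1 / 2)
  rwa [Complex.add_conj, one_div, Complex.ofReal_mul, Complex.ofReal_ofNat,
    inv_mul_cancel_left₀ two_ne_zero, ← one_div] at this

theorem HasWInt.im {f : TSphere n → ℂ} {c : ℂ} (hf : HasWInt ξ₀ s t f c) :
    HasWInt ξ₀ s t (fun p => -Complex.I / 2 * (f p - conj (f p))) (c.im : ℂ) := by
  have := (hf.sub hf.conj).const_mul (-Complex.I / 2)
  have h : -Complex.I / 2 * (c - conj c) = (c.im : ℂ) := by
    rw [Complex.sub_conj]
    push_cast
    linear_combination -(c.im : ℂ) * Complex.I_mul_I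
  rwa [h] at this

theorem HasWInt.sum {ι : Type*} {S : Finset ι} {f : ι → TSphere n → ℂ} {c : ι → ℂ}
    (hf : ∀ i ∈ S, HasWInt ξ₀ s t (f i) (c i)) :
    HasWInt ξ₀ s t (fun p => ∑ i ∈ S, f i p) (∑ i ∈ S, c i) := by
  unfold HasWInt
  simp only [Finset.mul_sum]
  refine ⟨integrable_finsetSum _ fun i hi => (hf i hi).1, ?_⟩
  rw [integral_finsetSum _ fun i hi => (hf i hi).1, Finset.mul_sum]
  exact Finset.sum_congr rfl fun i hi => (hf i hi).2

theorem HasWInt.congr (hn : 2 ≤ n) {f g : TSphere n → ℂ} {c : ℂ} (hf : HasWInt ξ₀ s t f c)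
    (h : ∀ p : TSphere n, (‖p.1.1‖ : ℂ) ≠ 0 → f p = g p) : HasWInt ξ₀ s t g c := by
  have hae : (fun p => (weight (s + 1 / 2) (t + 1 / 2) ‖p.1.1‖ : ℂ) * f p) =ᵐ[tsMeasure ξ₀]
      fun p => (weight (s + 1 / 2) (t + 1 / 2) ‖p.1.1‖ : ℂ) * g p := by
    filter_upwards [ae_tsMeasure_ne_zero hn ξ₀] with p hp
    rw [h p (by exact_mod_cast norm_ne_zero_iff.mpr hp)]
  exact ⟨hf.1.congr hae, by rw [← integral_congr_ae hae, hf.2]⟩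

theorem DecayTS.hasWInt (hn : 2 ≤ n) (ht : -(n : ℝ) / 2 < t) {f : TSphere n → ℂ}
    (hf : DecayTS f) : ∃ c, HasWInt ξ₀ s t f c :=
  ⟨_, hf.integrable hn ξ₀ (by linarith), rfl⟩

/-- The excess `k / 2` of the indices over `s + 1/2`, `t + 1/2` becomes the factor `|y|^k`, up to
the null set `y = 0`. -/
theorem hasWInt_innerH (hn : 2 ≤ n) (ht : -(n : ℝ) / 2 < t) (k : ℕ) {σ τ : ℝ}
    (hσ : σ = s + 1 / 2 + k / 2) (hτ : τ = t + 1 / 2 + k / 2) {u v : TSphere n → ℂ}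
    (hu : DecayTS u) (hv : DecayTS v) :
    HasWInt ξ₀ s t (fun p => (‖p.1.1‖ : ℂ) ^ k * (u p * conj (v p))) (innerH σ τ u v) := by
  have h0 : (0 : ℝ) ≤ k := Nat.cast_nonneg k
  have h1 := DecayTS.integrable hn ξ₀ (σ := σ) (τ := τ) (by rw [hτ]; linarith)
    (hu.poly.mul hv.conj)
  have hae : (fun p => (weight σ τ ‖p.1.1‖ : ℂ) * (u p * conj (v p))) =ᵐ[tsMeasure ξ₀]
      fun p => (weight (s + 1 / 2) (t + 1 / 2) ‖p.1.1‖ : ℂ) *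
        ((‖p.1.1‖ : ℂ) ^ k * (u p * conj (v p))) := by
    filter_upwards [ae_tsMeasure_ne_zero hn ξ₀] with p hp
    rw [hσ, hτ, weight_add _ _ _ (norm_pos_iff.mpr hp), mul_div_cancel₀ _ two_ne_zero,
      Real.rpow_natCast]
    push_cast
    ring
  refine ⟨h1.congr hae, ?_⟩
  rw [← integral_congr_ae hae, integral_tsMeasure ξ₀ h1]
  rfl

theorem normSqH_eq (σ τ : ℝ) (u : TSphere n → ℂ) : (normSqH σ τ u : ℂ) = innerH σ τ u u := by
  rw [normSqH, innerH, Complex.ofReal_mul, ← integral_complex_ofReal]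
  congr 2
  funext ξ
  rw [← integral_complex_ofReal]
  congr 1
  funext y
  rw [Complex.mul_conj']
  push_cast
  rfl

end WeightedIntegral

/-! ### The norm of a triple as the integral of `|G|²`. -/

section TripleNorm

open MeasureTheory Metric Matrix

variable {n : ℕ} {ξ₀ : sphere (0 : E n) 1} {s t : ℝ}

/-- The pairing of a tensor field on `T𝕊ⁿ⁻¹` with the conjugate of another. -/
def hermG (φ ψ χ φ' ψ' χ' : TSphere n → ℂ) (p : TSphere n) : ℂ :=
  pairing (hatG φ ψ χ p) ((hatG φ' ψ' χ' p).map star)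

theorem decayTS_hermG {φ ψ χ φ' ψ' χ' : TSphere n → ℂ} (hφ : φ ∈ SchwartzTS n)
    (hψ : ψ ∈ SchwartzTS n) (hχ : χ ∈ SchwartzTS n) (hφ' : φ' ∈ SchwartzTS n)
    (hψ' : ψ' ∈ SchwartzTS n) (hχ' : χ' ∈ SchwartzTS n) : DecayTS (hermG φ ψ χ φ' ψ' χ') := by
  unfold hermG pairing
  exact DecayTS.sum fun i _ => DecayTS.sum fun j _ =>
    (decayTS_hatG hφ hψ hχ i j).poly.mul (decayTS_hatG hφ' hψ' hχ' i j).conj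

/-- The nineteen terms become integrals against one weight, so that only a pointwise identity
between integrands remains; away from `y = 0` it is `pairing_symbolG` applied to `G` and its
conjugate. -/
theorem hasWInt_tripleNormSq (hn : 2 ≤ n) (ht : -(n : ℝ) / 2 < t) {φ ψ χ : TSphere n → ℂ}
    (hφ : φ ∈ SchwartzTS n) (hψ : ψ ∈ SchwartzTS n) (hχ : χ ∈ SchwartzTS n) :
    ∃ c : ℂ, HasWInt ξ₀ s t (hermG φ ψ χ φ ψ χ) c ∧
      (tripleNormSq s t φ ψ χ : ℂ) = aConst n / 4 * c := by
  have du := decayTS_hatTS hφ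
  have dv := decayTS_hatTS hψ
  have dw := decayTS_hatTS hχ
  have dU (i : Fin n) := decayTS_hatTS (opXi_mem i hφ)
  have dV (i : Fin n) := decayTS_hatTS (opXi_mem i hψ)
  have dP (i : Fin n) := decayTS_hatTS (mulX_mem i hφ)
  have dH (i j : Fin n) := decayTS_hatTS (opXi_mem i (opXi_mem j hφ))
  have dZU (i : Fin n) := decayTS_hatZ (opXi_mem i hφ)
  -- Here and below the natural number is twice the excess of the index over `s + 1/2`: `4, 3, 2, 1,
  -- 0` for `s + 5/2, s + 2, s + 3/2, s + 1, s + 1/2`.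
  have h1 := hasWInt_innerH (ξ₀ := ξ₀) (s := s) hn ht 4 (σ := s + 5 / 2) (τ := t + 5 / 2)
    (by push_cast; ring) (by push_cast; ring) dw dw
  have h2 := ((hasWInt_innerH (ξ₀ := ξ₀) (s := s) hn ht 3 (σ := s + 2) (τ := t + 2)
    (by push_cast; ring) (by push_cast; ring) dw (decayTS_hatZ hψ)).im).const_mul 4
  have h3 := (HasWInt.sum (S := Finset.univ) fun i _ => hasWInt_innerH (ξ₀ := ξ₀) (s := s) hn ht 2
    (σ := s + 3 / 2) (τ := t + 3 / 2)
    (by push_cast; ring) (by push_cast; ring) (dV i) (dV i)).const_mul 2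
  have h4 := (hasWInt_innerH (ξ₀ := ξ₀) (s := s) hn ht 2 (σ := s + 3 / 2) (τ := t + 3 / 2)
    (by push_cast; ring) (by push_cast; ring) dv dv).const_mul 2
  have h5 := (hasWInt_innerH (ξ₀ := ξ₀) (s := s) hn ht 2 (σ := s + 3 / 2) (τ := t + 3 / 2)
    (by push_cast; ring) (by push_cast; ring) (decayTS_hatZ hψ) (decayTS_hatZ hψ)).const_mul 2
  have h6 := ((hasWInt_innerH (ξ₀ := ξ₀) (s := s) hn ht 3 (σ := s + 2) (τ := t + 2)
    (by push_cast; ring) (by push_cast; ring) dw (decayTS_hatW hφ)).re).const_mul 2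
  have h7 := ((hasWInt_innerH (ξ₀ := ξ₀) (s := s) hn ht 2 (σ := s + 3 / 2) (τ := t + 3 / 2)
    (by push_cast; ring) (by push_cast; ring) dw du).re).const_mul 4
  have h8 := ((hasWInt_innerH (ξ₀ := ξ₀) (s := s) hn ht 2 (σ := s + 3 / 2) (τ := t + 3 / 2)
    (by push_cast; ring) (by push_cast; ring) dw (decayTS_hatQ hφ)).re).const_mul 2
  have h9 := (HasWInt.sum (S := Finset.univ) fun i _ => (hasWInt_innerH (ξ₀ := ξ₀) (s := s) hn ht 2
    (σ := s + 3 / 2) (τ := t + 3 / 2)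
    (by push_cast; ring) (by push_cast; ring) (dV i) (dP i)).re).const_mul 4
  have h10 := ((hasWInt_innerH (ξ₀ := ξ₀) (s := s) hn ht 1 (σ := s + 1) (τ := t + 1)
    (by push_cast; ring) (by push_cast; ring) (decayTS_hatZ hψ) du).im).const_mul 8
  have h11 := ((hasWInt_innerH (ξ₀ := ξ₀) (s := s) hn ht 1 (σ := s + 1) (τ := t + 1)
    (by push_cast; ring) (by push_cast; ring) dv (decayTS_hatZ hφ)).im).const_mul 4
  have h12 := (HasWInt.sum (S := Finset.univ) fun i _ => (hasWInt_innerH (ξ₀ := ξ₀) (s := s) hn ht 1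
    (σ := s + 1) (τ := t + 1)
    (by push_cast; ring) (by push_cast; ring) (dV i) (dZU i)).im).const_mul 4
  have h13 := HasWInt.sum (S := Finset.univ) fun i _ => hasWInt_innerH (ξ₀ := ξ₀) (s := s) hn ht 2
    (σ := s + 3 / 2) (τ := t + 3 / 2)
    (by push_cast; ring) (by push_cast; ring) (dP i) (dP i)
  have h14 := (HasWInt.sum (S := Finset.univ) fun i _ => (hasWInt_innerH (ξ₀ := ξ₀) (s := s) hn ht 1
    (σ := s + 1) (τ := t + 1)
    (by push_cast; ring) (by push_cast; ring) (dP i) (dZU i)).im).const_mul 2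
  have h15 := ((hasWInt_innerH (ξ₀ := ξ₀) (s := s) hn ht 1 (σ := s + 1) (τ := t + 1)
    (by push_cast; ring) (by push_cast; ring) (decayTS_hatW hφ) du).re).const_mul 4
  have h16 := HasWInt.sum (S := Finset.univ) fun i _ => HasWInt.sum (S := Finset.univ) fun j _ =>
    hasWInt_innerH (ξ₀ := ξ₀) (s := s) hn ht 0 (σ := s + 1 / 2) (τ := t + 1 / 2)
    (by push_cast; ring) (by push_cast; ring) (dH i j) (dH i j)
  have h17 := (HasWInt.sum (S := Finset.univ) fun i _ => (hasWInt_innerH (ξ₀ := ξ₀) (s := s) hn ht 0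
    (σ := s + 1 / 2) (τ := t + 1 / 2)
    (by push_cast; ring) (by push_cast; ring) (dH i i) du).re).const_mul 4
  have h18 := HasWInt.sum (S := Finset.univ) fun i _ => hasWInt_innerH (ξ₀ := ξ₀) (s := s) hn ht 0
    (σ := s + 1 / 2) (τ := t + 1 / 2)
    (by push_cast; ring) (by push_cast; ring) (dU i) (dU i)
  have h19 := (hasWInt_innerH (ξ₀ := ξ₀) (s := s) hn ht 0 (σ := s + 1 / 2) (τ := t + 1 / 2)
    (by push_cast; ring) (by push_cast; ring) du du).const_mul (4 * n)
  have key := (((((((((((((((((h1.add h2).add h3).add h4).add h5).add h6).sub h7).sub h8).sub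
    h9).add h10).add h11).add h12).add h13).sub h14).sub h15).add h16).add h17).add h18).add h19
  refine ⟨_, key.congr hn fun p hp => ?_, ?_⟩
  · clear key h1 h2 h3 h4 h5 h6 h7 h8 h9 h10 h11 h12 h13 h14 h15 h16 h17 h18 h19
    have hr := jetRelations hφ hψ p
    change JetRelations (yC p) (xiC p) (jetXi φ p) (jetXi ψ p) (jetX φ p) (jetXi2 φ p) at hr
    rw [hermG, hatG, symbolG_map_star _ (star_yC p) (star_xiC p),
      show star Complex.I = -Complex.I from Complex.conj_I,
      pairing_symbolG Complex.I_mul_I hr (hr.star (star_yC p) (star_xiC p)), yC_dot_yC]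
    simp only [hatZ_eq hφ, hatZ_eq hψ, hatW_eq hφ, hatQ_eq hφ, hatZ_opXi_eq hφ, hatTS_mulX_eq]
    set V := jetXi ψ p
    set U := jetXi φ p
    set P := jetX φ p
    set H := jetXi2 φ p
    set r : ℂ := (‖p.1.1‖ : ℂ) with hrdef
    have hr' : conj r = r := Complex.conj_ofReal _
    have s3 : ∑ i, r ^ 2 * (hatTS (opXi i ψ) p * conj (hatTS (opXi i ψ) p)) =
        r ^ 2 * (V ⬝ᵥ star V) := by
      rw [dotProduct, Finset.mul_sum]
      rfl
    -- The transform of `x_i φ` is `i X_i u`; the factor `i` makes this real part an antisymmetric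
    -- expression in `V` and `P`.
    have s9 : ∑ i, 1 / 2 * (r ^ 2 * (hatTS (opXi i ψ) p * conj (Complex.I * P i)) +
        conj (r ^ 2 * (hatTS (opXi i ψ) p * conj (Complex.I * P i)))) =
        -Complex.I / 2 * r ^ 2 * (V ⬝ᵥ star P - P ⬝ᵥ star V) := by
      rw [dotProduct, dotProduct, ← Finset.sum_sub_distrib, Finset.mul_sum]
      refine Finset.sum_congr rfl fun i _ => ?_
      change 1 / 2 * (r ^ 2 * (V i * conj (Complex.I * P i)) +
        conj (r ^ 2 * (V i * conj (Complex.I * P i)))) = _ * (V i * conj (P i) - P i * conj (V i))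
      simp only [map_mul, map_pow, hr', Complex.conj_I, Complex.conj_conj, map_neg, neg_neg]
      ring
    have s12 : ∑ i, -Complex.I / 2 * (r ^ 1 * (hatTS (opXi i ψ) p * conj ((yC p ᵥ* H) i / r)) -
        conj (r ^ 1 * (hatTS (opXi i ψ) p * conj ((yC p ᵥ* H) i / r)))) =
        -Complex.I / 2 * (yC p ⬝ᵥ (H.map star *ᵥ V) - yC p ⬝ᵥ (H *ᵥ star V)) := by
      rw [dotProduct_mulVec, dotProduct_mulVec, dotProduct, dotProduct, ← Finset.sum_sub_distrib,
        Finset.mul_sum]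
      refine Finset.sum_congr rfl fun i _ => ?_
      change -Complex.I / 2 * (r ^ 1 * (V i * conj ((yC p ᵥ* H) i / r)) -
        conj (r ^ 1 * (V i * conj ((yC p ᵥ* H) i / r)))) = _ * (_ * V i - _ * conj (V i))
      simp only [map_mul, map_pow, map_div₀, hr', Complex.conj_conj, ← conj_yC_vecMul]
      field_simp
    have s13 : ∑ i, r ^ 2 * (Complex.I * P i * conj (Complex.I * P i)) =
        r ^ 2 * (P ⬝ᵥ star P) := by
      rw [dotProduct, Finset.mul_sum]
      refine Finset.sum_congr rfl fun i _ => ?_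
      rw [map_mul, Complex.conj_I, Pi.star_apply, RCLike.star_def]
      linear_combination -r ^ 2 * P i * conj (P i) * Complex.I_mul_I
    have s14 : ∑ i, -Complex.I / 2 * (r ^ 1 * (Complex.I * P i * conj ((yC p ᵥ* H) i / r)) -
        conj (r ^ 1 * (Complex.I * P i * conj ((yC p ᵥ* H) i / r)))) =
        1 / 2 * (yC p ⬝ᵥ (H.map star *ᵥ P) + yC p ⬝ᵥ (H *ᵥ star P)) := by
      rw [dotProduct_mulVec, dotProduct_mulVec, dotProduct, dotProduct, ← Finset.sum_add_distrib,
        Finset.mul_sum]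
      refine Finset.sum_congr rfl fun i _ => ?_
      change _ = _ * (_ * P i + _ * conj (P i))
      simp only [map_mul, map_pow, map_div₀, hr', Complex.conj_conj, ← conj_yC_vecMul,
        Complex.conj_I]
      field_simp
      ring_nf
      simp only [Complex.I_sq]
      ring
    have s16 : ∑ i, ∑ j, r ^ 0 * (hatTS (opXi i (opXi j φ)) p *
        conj (hatTS (opXi i (opXi j φ)) p)) = pairing H (H.map star) := by
      simp only [pow_zero, one_mul]
      rfl
    have s17 : ∑ i, 1 / 2 * (r ^ 0 * (hatTS (opXi i (opXi i φ)) p * conj (hatTS φ p)) +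
        conj (r ^ 0 * (hatTS (opXi i (opXi i φ)) p * conj (hatTS φ p)))) =
        1 / 2 * (trace H * conj (hatTS φ p) + trace (H.map star) * hatTS φ p) := by
      rw [trace, trace, Finset.sum_mul, Finset.sum_mul, ← Finset.sum_add_distrib, Finset.mul_sum]
      refine Finset.sum_congr rfl fun i _ => ?_
      simp only [pow_zero, one_mul, map_mul, Complex.conj_conj]
      rfl
    have s18 : ∑ i, r ^ 0 * (hatTS (opXi i φ) p * conj (hatTS (opXi i φ) p)) = U ⬝ᵥ star U := by
      simp only [pow_zero, one_mul]
      rfl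
    simp only [s3, s9, s12, s13, s14, s16, s17, s18]
    have hH : (H.map star).map star = H := by
      ext
      simp
    simp only [map_mul, map_pow, map_div₀, hr', conj_yC_quadratic, hH]
    simp only [Complex.conj_conj, conj_yC_dot, star_star, RCLike.star_def]
    field_simp
    ring
  · rw [tripleNormSq]
    push_cast
    simp only [normSqH_eq]

end TripleNorm

/-! ### A triple with `G = 0` almost everywhere vanishes. -/

section Injectivity

open MeasureTheory Metric Matrix
open scoped FourierTransform

variable {n : ℕ}

theorem continuous_coe {φ : TSphere n → ℂ} (hφ : φ ∈ SchwartzTS n) : Continuous φ := by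
  have h : Continuous fun p : TSphere n => extend φ p.1 :=
    hφ.1.continuousOn.comp_continuous continuous_subtype_val mem_slit
  simpa only [extend_coe] using h

theorem continuous_tsPoint {ξ : E n} (hξ : ‖ξ‖ = 1) : Continuous (tsPoint ξ hξ) :=
  Continuous.subtype_mk (by fun_prop) _

/-- Fourier inversion on the Euclidean space `ξ^⊥`, where the restriction of `φ` is continuous and
integrable. -/
theorem eq_zero_of_hatTS_fibre {φ : TSphere n → ℂ} (hφ : φ ∈ SchwartzTS n) {ξ : E n}
    (hξ : ‖ξ‖ = 1) (h : ∀ y : hyperplane ξ, hatTS φ (tsPoint ξ hξ y) = 0) (x : hyperplane ξ) :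
    φ (tsPoint ξ hξ x) = 0 := by
  set g : hyperplane ξ → ℂ := fun x => φ (tsPoint ξ hξ x) with hg
  have hc : Continuous g := (continuous_coe hφ).comp (continuous_tsPoint hξ)
  obtain ⟨C, -, hC⟩ := extend_decay hφ (Module.finrank ℝ (hyperplane ξ) + 1)
  have hi : Integrable g := by
    refine ((integrable_inv_one_add_pow (V := hyperplane ξ) volume (Nat.lt_succ_self _)).const_mul
      C).mono' hc.aestronglyMeasurable (Filter.Eventually.of_forall fun x => ?_)
    have := (hC _ (mem_slit (tsPoint ξ hξ x))).1
    rw [extend_coe, ret_eq] at this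
    exact this
  have hF : 𝓕 g = 0 := by
    funext w
    -- The factor `2π` passes from the kernel `e^{-i⟨y,x⟩}` to `e^{-2πi⟨w,x⟩}`.
    have h1 := h ((2 * Real.pi) • w)
    rw [hatTS, mul_eq_zero] at h1
    have h2 := h1.resolve_left (by
      have : (0 : ℝ) < (2 * Real.pi) ^ (-(((n : ℝ) - 1) / 2)) := by positivity
      exact_mod_cast this.ne')
    rw [Real.fourier_eq', Pi.zero_apply, ← h2]
    refine integral_congr_ae (Filter.Eventually.of_forall fun v => ?_)
    simp only [hg, smul_eq_mul]
    congr 2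
    simp only [tsPoint, Submodule.coe_smul, inner_smul_left, Submodule.coe_inner, conj_trivial]
    rw [real_inner_comm]
    push_cast
    ring
  have h3 := hc.fourierInv_fourier_eq hi (by rw [hF]; exact integrable_zero _ _ _)
  have h4 : 𝓕⁻ (𝓕 g) x = 0 := by
    rw [hF, Real.fourierInv_eq']
    simp
  rw [h3] at h4
  exact h4

theorem exists_eq_tsPoint {ξ : E n} (hξ : ‖ξ‖ = 1) {p : TSphere n} (hp : p.1.2 = ξ) :
    ∃ z : hyperplane ξ, p = tsPoint ξ hξ z := by
  subst hp
  exact ⟨⟨p.1.1, mem_hyperplane.mpr p.2.2⟩, rfl⟩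

/-- Fubini and continuity along the fibre give vanishing on the whole fibre over almost every `ξ`,
hence over a dense set of `ξ`; continuity in `ξ` does the rest. -/
theorem eq_zero_of_hatTS_ae {φ : TSphere n → ℂ} (hφ : φ ∈ SchwartzTS n) (ξ₀ : sphere (0 : E n) 1)
    (h : ∀ᵐ p ∂(tsMeasure ξ₀), hatTS φ p = 0) : φ = 0 := by
  have h1 := ae_of_ae_map (measurable_chart ξ₀).aemeasurable h
  have h2 := Measure.ae_ae_of_ae_prod h1
  have h3 : ∀ᵐ ξ : sphere (0 : E n) 1 ∂(volume : Measure (E n)).toSphere,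
      ∀ x, φ (tsPoint ξ (norm_sphere ξ) x) = 0 := by
    filter_upwards [h2] with ξ hξ
    refine eq_zero_of_hatTS_fibre hφ (norm_sphere ξ) fun y => ?_
    set e := hyperplaneEquiv (refl (ξ₀ : E n) ξ) (refl_sphere ξ₀ ξ)
    have hc : Continuous fun z : hyperplane (ξ₀ : E n) => hatTS φ (tsPoint ξ (norm_sphere ξ) (e z)) :=
      (continuous_hatTS hφ).comp ((continuous_tsPoint _).comp e.continuous)
    have h4 : (fun z : hyperplane (ξ₀ : E n) => hatTS φ (tsPoint ξ (norm_sphere ξ) (e z))) =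
        fun _ => 0 :=
      Continuous.ae_eq_iff_eq (μ := volume) hc continuous_const |>.mp hξ
    have := congrFun h4 (e.symm y)
    simpa using this
  have hd := Measure.dense_of_ae h3
  funext p
  -- With `x` held fixed, `(x, η)` leaves `T𝕊ⁿ⁻¹` as `η` varies; the extension is still defined
  -- there and takes the value of `φ` at a point of the fibre over `η`.
  have hc : Continuous fun η : sphere (0 : E n) 1 => extend φ (p.1.1, η) := by
    refine hφ.1.continuousOn.comp_continuous (by fun_prop) fun η h0 => ?_
    have := norm_sphere η
    simp only at h0
    rw [h0, norm_zero] at this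
    exact zero_ne_one this
  have h5 : (fun η : sphere (0 : E n) 1 => extend φ (p.1.1, η)) = fun _ => 0 := by
    refine Continuous.ext_on hd hc continuous_const fun η hη => ?_
    have h6 : ((p.1.1, (η : E n)) : E n × E n) ∈ slit n := by
      intro h0
      have := norm_sphere η
      simp only at h0
      rw [h0, norm_zero] at this
      exact zero_ne_one this
    change extend φ (p.1.1, η) = 0
    rw [extend_apply h6]
    have hr : (retract (p.1.1, (η : E n)) h6).1.2 = η := by
      rw [retract_coe]
      simp [ret]
    obtain ⟨z, hz⟩ := exists_eq_tsPoint (norm_sphere η) hr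
    rw [hz]
    exact hη _
  have := congrFun h5 ⟨p.1.2, mem_sphere_zero_iff_norm.mpr p.2.1⟩
  rw [Pi.zero_apply, ← extend_coe φ p]
  exact this

theorem hatTS_zero (p : TSphere n) : hatTS (0 : TSphere n → ℂ) p = 0 := congrFun (map_zero hatL) p

theorem opXi_zero (i : Fin n) : opXi i (0 : TSphere n → ℂ) = 0 :=
  congrArg Subtype.val (map_zero (opXiL i))

theorem mulX_zero (i : Fin n) : mulX i (0 : TSphere n → ℂ) = 0 :=
  congrArg Subtype.val (map_zero (mulXL i))

theorem jetXi_zero (p : TSphere n) : jetXi 0 p = 0 := by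
  funext i
  rw [jetXi, opXi_zero, hatTS_zero]
  rfl

theorem jetX_zero (p : TSphere n) : jetX 0 p = 0 := by
  funext i
  rw [jetX, mulX_zero, hatTS_zero, mul_zero]
  rfl

theorem jetXi2_zero (p : TSphere n) : jetXi2 0 p = 0 := by
  ext i j
  rw [jetXi2, Matrix.of_apply, opXi_zero, opXi_zero, hatTS_zero]
  rfl

theorem eq_zero_of_hatG_ae (hn : 2 ≤ n) (ξ₀ : sphere (0 : E n) 1) {φ ψ χ : TSphere n → ℂ}
    (hφ : φ ∈ SchwartzTS n) (hψ : ψ ∈ SchwartzTS n) (hχ : χ ∈ SchwartzTS n)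
    (h : ∀ᵐ p ∂(tsMeasure ξ₀), hatG φ ψ χ p = 0) : φ = 0 ∧ ψ = 0 ∧ χ = 0 := by
  have hr (p : TSphere n) : JetRelations (yC p) (xiC p) (jetXi φ p) (jetXi ψ p) (jetX φ p)
    (jetXi2 φ p) := jetRelations hφ hψ p
  have h1 : φ = 0 := by
    refine eq_zero_of_hatTS_ae hφ ξ₀ ?_
    filter_upwards [h] with p hp
    have := trace_pairing_symbolG (J := Complex.I) (u := hatTS φ p) (v := hatTS ψ p)
      (w := hatTS χ p) (hr p)
    rw [hatG] at hp
    rw [hp, zero_mulVec, dotProduct_zero] at this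
    simpa using this.symm
  subst h1
  have h0 (p : TSphere n) (hp : p.1.1 ≠ 0) : yC p ⬝ᵥ yC p ≠ 0 := by
    rw [yC_dot_yC]
    exact pow_ne_zero 2 (by exact_mod_cast norm_ne_zero_iff.mpr hp)
  simp only [hatG, jetXi_zero, jetX_zero, jetXi2_zero, hatTS_zero] at h
  have h2 : ψ = 0 := by
    refine eq_zero_of_hatTS_ae hψ ξ₀ ?_
    filter_upwards [h, ae_tsMeasure_ne_zero hn ξ₀] with p hp hp0
    have := symbolG_mulVec_of_eq_zero (J := Complex.I) (v := hatTS ψ p) (w := hatTS χ p)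
      (hr p).unit (hr p).orth (hr p).orthV
    rw [hp, zero_mulVec, dotProduct_zero] at this
    simpa [h0 p hp0] using this.symm
  subst h2
  refine ⟨rfl, rfl, ?_⟩
  refine eq_zero_of_hatTS_ae hχ ξ₀ ?_
  filter_upwards [h, ae_tsMeasure_ne_zero hn ξ₀] with p hp hp0
  have := symbolG_quadratic_of_eq_zero (J := Complex.I) (y := yC p) (ξ := xiC p) (w := hatTS χ p)
  rw [jetXi_zero, hatTS_zero] at hp
  rw [hp, zero_mulVec, dotProduct_zero] at this
  simpa [h0 p hp0] using this.symm

end Injectivity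

/-! ### Positivity and definiteness of the norm. -/

section Positivity

open MeasureTheory Metric Matrix

variable {n : ℕ}

theorem aConst_pos (hn : 2 ≤ n) : 0 < aConst n := by
  have h : (2 : ℝ) ≤ n := by exact_mod_cast hn
  have := Real.Gamma_pos_of_pos (show 0 < ((n : ℝ) - 1) / 2 by linarith)
  unfold aConst
  positivity

/-- The square norm of a matrix. -/
def frobSq (M : Matrix (Fin n) (Fin n) ℂ) : ℝ := ∑ i, ∑ j, ‖M i j‖ ^ 2

theorem pairing_map_star (M : Matrix (Fin n) (Fin n) ℂ) : pairing M (M.map star) = frobSq M := by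
  simp only [pairing, frobSq, Matrix.map_apply, RCLike.star_def, Complex.mul_conj']
  push_cast
  rfl

theorem frobSq_nonneg (M : Matrix (Fin n) (Fin n) ℂ) : 0 ≤ frobSq M := by
  unfold frobSq
  positivity

theorem eq_zero_of_frobSq {M : Matrix (Fin n) (Fin n) ℂ} (h : frobSq M = 0) : M = 0 := by
  ext i j
  rw [frobSq, Finset.sum_eq_zero_iff_of_nonneg fun i _ => by positivity] at h
  have h1 := h i (Finset.mem_univ i)
  rw [Finset.sum_eq_zero_iff_of_nonneg fun j _ => by positivity] at h1
  simpa using h1 j (Finset.mem_univ j)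

/-- The norm is a weighted `L²` norm of `G`. Positivity, definiteness and the isometry property are
all read off from this form. -/
theorem tripleNormSq_eq (hn : 2 ≤ n) (ξ₀ : sphere (0 : E n) 1) {s t : ℝ}
    (ht : -(n : ℝ) / 2 < t) {φ ψ χ : TSphere n → ℂ}
    (hφ : φ ∈ SchwartzTS n) (hψ : ψ ∈ SchwartzTS n) (hχ : χ ∈ SchwartzTS n) :
    Integrable (fun p => weight (s + 1 / 2) (t + 1 / 2) ‖p.1.1‖ * frobSq (hatG φ ψ χ p))
      (tsMeasure ξ₀) ∧
    tripleNormSq s t φ ψ χ = aConst n / 4 * (1 / (2 * Real.pi) *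
      ∫ p, weight (s + 1 / 2) (t + 1 / 2) ‖p.1.1‖ * frobSq (hatG φ ψ χ p) ∂(tsMeasure ξ₀)) := by
  obtain ⟨c, ⟨h1, h2⟩, h3⟩ := hasWInt_tripleNormSq (ξ₀ := ξ₀) (s := s) hn ht hφ hψ hχ
  have h4 (p : TSphere n) : (weight (s + 1 / 2) (t + 1 / 2) ‖p.1.1‖ : ℂ) * hermG φ ψ χ φ ψ χ p =
      ((weight (s + 1 / 2) (t + 1 / 2) ‖p.1.1‖ * frobSq (hatG φ ψ χ p) : ℝ) : ℂ) := by
    rw [hermG, pairing_map_star]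
    push_cast
    rfl
  simp only [h4] at h1 h2
  refine ⟨?_, ?_⟩
  · have := h1.re
    simpa using this
  · rw [integral_complex_ofReal] at h2
    rw [← h2] at h3
    exact_mod_cast h3

theorem tripleNormSq_nonneg (hn : 2 ≤ n) {s t : ℝ}
    (ht : -(n : ℝ) / 2 < t) {φ ψ χ : TSphere n → ℂ}
    (hφ : φ ∈ SchwartzTS n) (hψ : ψ ∈ SchwartzTS n) (hχ : χ ∈ SchwartzTS n)
    (ξ₀ : sphere (0 : E n) 1) : 0 ≤ tripleNormSq s t φ ψ χ := by
  rw [(tripleNormSq_eq hn ξ₀ ht hφ hψ hχ).2]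
  have h1 := aConst_pos hn
  have h2 : 0 ≤ ∫ p, weight (s + 1 / 2) (t + 1 / 2) ‖p.1.1‖ * frobSq (hatG φ ψ χ p)
      ∂(tsMeasure ξ₀) :=
    integral_nonneg fun p => mul_nonneg (weight_nonneg _ _ (norm_nonneg _)) (frobSq_nonneg _)
  positivity

theorem eq_zero_of_tripleNormSq (hn : 2 ≤ n) {s t : ℝ}
    (ht : -(n : ℝ) / 2 < t) {φ ψ χ : TSphere n → ℂ}
    (hφ : φ ∈ SchwartzTS n) (hψ : ψ ∈ SchwartzTS n) (hχ : χ ∈ SchwartzTS n)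
    (ξ₀ : sphere (0 : E n) 1) (h : tripleNormSq s t φ ψ χ = 0) : φ = 0 ∧ ψ = 0 ∧ χ = 0 := by
  obtain ⟨h1, h2⟩ := tripleNormSq_eq (s := s) hn ξ₀ ht hφ hψ hχ
  rw [h] at h2
  have h3 : aConst n / 4 * (1 / (2 * Real.pi)) ≠ 0 := by
    have := aConst_pos hn
    positivity
  have h4 := (mul_eq_zero.mp ((mul_assoc _ _ _).trans h2.symm)).resolve_left h3
  rw [integral_eq_zero_iff_of_nonneg
    (fun p => mul_nonneg (weight_nonneg _ _ (norm_nonneg _)) (frobSq_nonneg _)) h1] at h4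
  refine eq_zero_of_hatG_ae hn ξ₀ hφ hψ hχ ?_
  filter_upwards [h4, ae_tsMeasure_ne_zero hn ξ₀] with p hp hp0
  exact eq_zero_of_frobSq
    ((mul_eq_zero.mp hp).resolve_left (weight_pos _ _ (norm_pos_iff.mpr hp0)).ne')

end Positivity

/-! ### The inner product on triples. -/

section TripleInner

open MeasureTheory Metric Matrix

variable {n : ℕ}

theorem symbolG_add (J : ℂ) (y ξ : Fin n → ℂ) (u v w : ℂ) (U V P : Fin n → ℂ)
    (H : Matrix (Fin n) (Fin n) ℂ) (u' v' w' : ℂ) (U' V' P' : Fin n → ℂ)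
    (H' : Matrix (Fin n) (Fin n) ℂ) :
    symbolG J y ξ (u + u') (v + v') (w + w') (U + U') (V + V') (P + P') (H + H') =
      symbolG J y ξ u v w U V P H + symbolG J y ξ u' v' w' U' V' P' H' := by
  ext i j
  simp only [symbolG, Matrix.add_apply, Matrix.smul_apply, vecMulVec_apply, smul_eq_mul,
    Pi.add_apply]
  ring

theorem symbolG_smul (c J : ℂ) (y ξ : Fin n → ℂ) (u v w : ℂ) (U V P : Fin n → ℂ)
    (H : Matrix (Fin n) (Fin n) ℂ) :
    symbolG J y ξ (c * u) (c * v) (c * w) (c • U) (c • V) (c • P) (c • H) =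
      c • symbolG J y ξ u v w U V P H := by
  ext i j
  simp only [symbolG, Matrix.add_apply, Matrix.smul_apply, vecMulVec_apply, smul_eq_mul,
    Pi.smul_apply]
  ring

theorem hatG_add (a b : Triple n) (p : TSphere n) :
    hatG (a + b).1.1 (a + b).2.1.1 (a + b).2.2.1 p =
      hatG a.1.1 a.2.1.1 a.2.2.1 p + hatG b.1.1 b.2.1.1 b.2.2.1 p := by
  have h1 (φ ψ : SchwartzTS n) : hatTS (φ + ψ).1 p = hatTS φ.1 p + hatTS ψ.1 p :=
    congrFun (map_add hatL φ ψ) p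
  have h2 (φ ψ : SchwartzTS n) : jetXi (φ + ψ).1 p = jetXi φ.1 p + jetXi ψ.1 p := by
    funext i
    exact congrFun (map_add (hatL ∘ₗ opXiL i) φ ψ) p
  have h3 (φ ψ : SchwartzTS n) : jetX (φ + ψ).1 p = jetX φ.1 p + jetX ψ.1 p := by
    funext i
    refine (congrArg (-Complex.I * ·) (congrFun (map_add (hatL ∘ₗ mulXL i) φ ψ) p)).trans ?_
    exact mul_add _ _ _
  have h4 (φ ψ : SchwartzTS n) : jetXi2 (φ + ψ).1 p = jetXi2 φ.1 p + jetXi2 ψ.1 p := by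
    ext i j
    exact congrFun (map_add (hatL ∘ₗ opXiL i ∘ₗ opXiL j) φ ψ) p
  rw [hatG, hatG, hatG, ← symbolG_add]
  simp only [Prod.fst_add, Prod.snd_add, h1, h2, h3, h4]

theorem hatG_smul (c : ℂ) (a : Triple n) (p : TSphere n) :
    hatG (c • a).1.1 (c • a).2.1.1 (c • a).2.2.1 p = c • hatG a.1.1 a.2.1.1 a.2.2.1 p := by
  have h1 (φ : SchwartzTS n) : hatTS (c • φ).1 p = c * hatTS φ.1 p :=
    congrFun (map_smul hatL c φ) p
  have h2 (φ : SchwartzTS n) : jetXi (c • φ).1 p = c • jetXi φ.1 p := by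
    funext i
    exact congrFun (map_smul (hatL ∘ₗ opXiL i) c φ) p
  have h3 (φ : SchwartzTS n) : jetX (c • φ).1 p = c • jetX φ.1 p := by
    funext i
    refine (congrArg (-Complex.I * ·) (congrFun (map_smul (hatL ∘ₗ mulXL i) c φ) p)).trans ?_
    exact mul_left_comm _ _ _
  have h4 (φ : SchwartzTS n) : jetXi2 (c • φ).1 p = c • jetXi2 φ.1 p := by
    ext i j
    exact congrFun (map_smul (hatL ∘ₗ opXiL i ∘ₗ opXiL j) c φ) p
  rw [hatG, hatG, ← symbolG_smul]
  simp only [Prod.smul_fst, Prod.smul_snd, h1, h2, h3, h4]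

/-- The integrand of the inner product of two triples. -/
def tripleHerm (a b : Triple n) (p : TSphere n) : ℂ :=
  hermG b.1.1 b.2.1.1 b.2.2.1 a.1.1 a.2.1.1 a.2.2.1 p

/-- The inner product of two triples. -/
def tripleInner (ξ₀ : sphere (0 : E n) 1) (s t : ℝ) (a b : Triple n) : ℂ :=
  (aConst n / 4 : ℝ) * (((1 / (2 * Real.pi) : ℝ) : ℂ) *
    ∫ p, (weight (s + 1 / 2) (t + 1 / 2) ‖p.1.1‖ : ℂ) * tripleHerm a b p ∂(tsMeasure ξ₀))

theorem hasWInt_tripleHerm (hn : 2 ≤ n) (ξ₀ : sphere (0 : E n) 1) (s : ℝ) {t : ℝ}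
    (ht : -(n : ℝ) / 2 < t) (a b : Triple n) :
    HasWInt ξ₀ s t (tripleHerm a b) (((1 / (2 * Real.pi) : ℝ) : ℂ) *
      ∫ p, (weight (s + 1 / 2) (t + 1 / 2) ‖p.1.1‖ : ℂ) * tripleHerm a b p ∂(tsMeasure ξ₀)) := by
  obtain ⟨c, hc⟩ := (decayTS_hermG b.1.2 b.2.1.2 b.2.2.2 a.1.2 a.2.1.2 a.2.2.2).hasWInt
    (ξ₀ := ξ₀) (s := s) hn ht
  exact ⟨hc.1, rfl⟩

theorem tripleInner_eq {ξ₀ : sphere (0 : E n) 1} {s t : ℝ} {a b : Triple n} {c : ℂ}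
    (h : HasWInt ξ₀ s t (tripleHerm a b) c) :
    tripleInner ξ₀ s t a b = (aConst n / 4 : ℝ) * c := by
  rw [tripleInner, h.2]

theorem tripleInner_self (hn : 2 ≤ n) (ξ₀ : sphere (0 : E n) 1) (s : ℝ) {t : ℝ}
    (ht : -(n : ℝ) / 2 < t) (a : Triple n) :
    tripleInner ξ₀ s t a a = (tripleNormSq s t a.1.1 a.2.1.1 a.2.2.1 : ℂ) := by
  obtain ⟨c, h1, h2⟩ := hasWInt_tripleNormSq (ξ₀ := ξ₀) (s := s) hn ht a.1.2 a.2.1.2 a.2.2.2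
  rw [tripleInner_eq (a := a) (b := a) h1, h2]
  push_cast
  rfl

/-- The inner product of `ℋ^{2,s}_t(T𝕊ⁿ⁻¹)` on triples of functions in `𝓢(T𝕊ⁿ⁻¹)`. -/
@[reducible] def tripleCore (hn : 2 ≤ n) (ξ₀ : sphere (0 : E n) 1) (s : ℝ) {t : ℝ}
    (ht : -(n : ℝ) / 2 < t) : InnerProductSpace.Core ℂ (Triple n) where
  inner := tripleInner ξ₀ s t
  conj_inner_symm a b := by
    have h := (hasWInt_tripleHerm hn ξ₀ s ht b a).conj
    have h1 : (fun p => conj (tripleHerm b a p)) = tripleHerm a b := by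
      funext p
      simp only [tripleHerm, hermG, pairing, map_sum, map_mul, Matrix.map_apply, RCLike.star_def,
        Complex.conj_conj, mul_comm]
    rw [h1] at h
    rw [tripleInner_eq h, tripleInner, map_mul, Complex.conj_ofReal]
  re_inner_nonneg a := by
    rw [tripleInner_self hn ξ₀ s ht]
    exact tripleNormSq_nonneg hn ht a.1.2 a.2.1.2 a.2.2.2 ξ₀
  add_left a b c := by
    have h := (hasWInt_tripleHerm hn ξ₀ s ht a c).add (hasWInt_tripleHerm hn ξ₀ s ht b c)
    have h1 : (fun p => tripleHerm a c p + tripleHerm b c p) = tripleHerm (a + b) c := by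
      funext p
      rw [tripleHerm, tripleHerm, tripleHerm, hermG, hermG, hermG, hatG_add,
        Matrix.map_add _ (fun x y => star_add x y), pairing_add_right]
    rw [h1] at h
    rw [tripleInner_eq h, mul_add]
    rfl
  smul_left a b r := by
    have h := (hasWInt_tripleHerm hn ξ₀ s ht a b).const_mul (conj r)
    have h1 : (fun p => conj r * tripleHerm a b p) = tripleHerm (r • a) b := by
      funext p
      rw [tripleHerm, tripleHerm, hermG, hermG, hatG_smul, ← pairing_smul_right]
      congr 1
      ext i j
      simp
    rw [h1] at h
    rw [tripleInner_eq h, mul_left_comm]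
    rfl
  definite a h := by
    rw [tripleInner_self hn ξ₀ s ht] at h
    obtain ⟨h1, h2, h3⟩ := eq_zero_of_tripleNormSq hn ht a.1.2 a.2.1.2 a.2.2.2 ξ₀
      (Complex.ofReal_eq_zero.mp h)
    exact Prod.ext (Subtype.ext h1) (Prod.ext (Subtype.ext h2) (Subtype.ext h3))

end TripleInner

/-! ### Rotation-invariant measures on `ℝⁿ` are determined by their radial integrals. -/

section SphereRotation

open MeasureTheory Metric

variable {n : ℕ}

theorem map_mem_sphere (g : E n ≃ₗᵢ[ℝ] E n) (θ : sphere (0 : E n) 1) :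
    g (θ : E n) ∈ sphere (0 : E n) 1 := by
  rw [mem_sphere_zero_iff_norm, g.norm_map, norm_sphere]

theorem continuous_map_sphere (g : E n ≃ₗᵢ[ℝ] E n) :
    Continuous fun θ : sphere (0 : E n) 1 => (⟨g θ, map_mem_sphere g θ⟩ : sphere (0 : E n) 1) :=
  (g.continuous.comp continuous_subtype_val).subtype_mk _

/-- The action of an isometry of `ℝⁿ` on the unit sphere. -/
def sphereIso (g : E n ≃ₗᵢ[ℝ] E n) : sphere (0 : E n) 1 ≃ₜ sphere (0 : E n) 1 where
  toFun θ := ⟨g θ, map_mem_sphere g θ⟩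
  invFun θ := ⟨g.symm θ, map_mem_sphere g.symm θ⟩
  left_inv _ := Subtype.ext (g.symm_apply_apply _)
  right_inv _ := Subtype.ext (g.apply_symm_apply _)
  continuous_toFun := continuous_map_sphere g
  continuous_invFun := continuous_map_sphere g.symm

@[simp] theorem sphereIso_coe (g : E n ≃ₗᵢ[ℝ] E n) (θ : sphere (0 : E n) 1) :
    (sphereIso g θ : E n) = g θ := rfl

-- The surface measure of a set is `n` times the volume of the cone over it, and linear isometries
-- map cones to cones of equal volume.
open scoped Pointwise in
theorem measurePreserving_sphereIso (g : E n ≃ₗᵢ[ℝ] E n) :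
    MeasurePreserving (sphereIso g) (volume : Measure (E n)).toSphere
      (volume : Measure (E n)).toSphere := by
  refine ⟨(sphereIso g).continuous.measurable, Measure.ext fun s hs => ?_⟩
  rw [Measure.map_apply (sphereIso g).continuous.measurable hs, Measure.toSphere_apply' _ hs,
    Measure.toSphere_apply' _ ((sphereIso g).continuous.measurable hs)]
  congr 1
  rw [← g.measurePreserving.measure_preimage_emb g.toHomeomorph.measurableEmbedding
    (Set.Ioo (0 : ℝ) 1 • ((↑) '' s : Set (E n)))]
  congr 1
  ext x
  simp only [Set.mem_smul, Set.mem_image, Set.mem_preimage]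
  constructor
  · rintro ⟨r, hr, _, ⟨θ, hθ, rfl⟩, rfl⟩
    exact ⟨r, hr, _, ⟨sphereIso g θ, hθ, rfl⟩, by simp⟩
  · rintro ⟨r, hr, _, ⟨θ, hθ, rfl⟩, h⟩
    refine ⟨r, hr, _, ⟨(sphereIso g).symm θ, by simpa using hθ, rfl⟩, ?_⟩
    apply g.injective
    rw [← h, map_smul]
    congr 1
    exact g.apply_symm_apply _

theorem integral_sphereIso {F : Type*} [NormedAddCommGroup F] [NormedSpace ℝ F]
    (g : E n ≃ₗᵢ[ℝ] E n) (f : sphere (0 : E n) 1 → F) :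
    ∫ θ, f (sphereIso g θ) ∂(volume : Measure (E n)).toSphere =
      ∫ θ, f θ ∂(volume : Measure (E n)).toSphere :=
  (measurePreserving_sphereIso g).integral_comp (sphereIso g).measurableEmbedding f

/-- The Fourier transform of the surface measure of the sphere, as a function of the radius. -/
def sphereJ (ξ₀ : sphere (0 : E n) 1) (r : ℝ) : ℂ :=
  ∫ θ, Complex.exp ((inner ℝ (r • (ξ₀ : E n)) (θ : E n) : ℝ) * Complex.I)
    ∂(volume : Measure (E n)).toSphere

theorem continuous_sphereJ (ξ₀ : sphere (0 : E n) 1) : Continuous (sphereJ ξ₀) := by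
  refine continuous_of_dominated (bound := fun _ => 1) (fun r => ?_) (fun r => ?_)
    (integrable_const 1) ?_
  · exact Continuous.aestronglyMeasurable (by fun_prop)
  · exact Filter.Eventually.of_forall fun θ => (Complex.norm_exp_ofReal_mul_I _).le
  · exact Filter.Eventually.of_forall fun θ => by fun_prop

theorem integral_sphere_exp (ξ₀ : sphere (0 : E n) 1) (y : E n) :
    ∫ θ, Complex.exp ((inner ℝ y (θ : E n) : ℝ) * Complex.I)
      ∂(volume : Measure (E n)).toSphere = sphereJ ξ₀ ‖y‖ := by
  have hg : refl y (‖y‖ • (ξ₀ : E n)) y = ‖y‖ • (ξ₀ : E n) :=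
    refl_left (by rw [norm_smul, norm_sphere, norm_norm, mul_one])
  rw [sphereJ, ← hg, ← integral_sphereIso (refl y (‖y‖ • (ξ₀ : E n))).symm]
  simp only [sphereIso_coe, LinearIsometryEquiv.inner_map_eq_flip]

/-- By invariance `t` may be replaced by `‖t‖ θ` for every unit vector `θ`. Averaging over `θ` and
exchanging the integrals turns the integrand into a function of `‖y‖`. -/
theorem charFun_average (ξ₀ : sphere (0 : E n) 1) {ν : Measure (E n)} [IsFiniteMeasure ν]
    (hν : ∀ (g : E n ≃ₗᵢ[ℝ] E n) (t : E n), charFun ν (g t) = charFun ν t) (t : E n) :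
    (volume : Measure (E n)).toSphere.real Set.univ • charFun ν t =
      ∫ y, sphereJ ξ₀ (‖t‖ * ‖y‖) ∂ν := by
  have h1 (θ : sphere (0 : E n) 1) : charFun ν t =
      ∫ y, Complex.exp ((inner ℝ y (‖t‖ • (θ : E n)) : ℝ) * Complex.I) ∂ν := by
    rw [← charFun_apply, ← hν (refl t (‖t‖ • (θ : E n))) t,
      refl_left (by rw [norm_smul, norm_sphere, norm_norm, mul_one])]
  rw [← integral_const, integral_congr_ae (Filter.Eventually.of_forall h1),
    integral_integral_swap]
  · refine integral_congr_ae (Filter.Eventually.of_forall fun y => ?_)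
    have h2 := integral_sphere_exp ξ₀ (‖t‖ • y)
    rw [norm_smul, norm_norm] at h2
    simp only
    rw [← h2]
    simp only [inner_smul_left, inner_smul_right, conj_trivial]
  · refine Integrable.mono' (g := fun _ => 1) (integrable_const 1) ?_
      (Filter.Eventually.of_forall fun q => (Complex.norm_exp_ofReal_mul_I _).le)
    exact Continuous.aestronglyMeasurable (by fun_prop)

/-- Characteristic functions of invariant measures are radial integrals, so agreement on radial
functions gives equal characteristic functions. This takes the place of a change of variables on the
set of orthogonal pairs. -/
theorem ext_of_rotation_invariant (hn : 0 < n) {μ ν : Measure (E n)} [IsFiniteMeasure μ]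
    [IsFiniteMeasure ν] (hμ : ∀ (g : E n ≃ₗᵢ[ℝ] E n) (t : E n), charFun μ (g t) = charFun μ t)
    (hν : ∀ (g : E n ≃ₗᵢ[ℝ] E n) (t : E n), charFun ν (g t) = charFun ν t)
    (h : ∀ f : ℝ → ℂ, Measurable f → ∫ y, f ‖y‖ ∂μ = ∫ y, f ‖y‖ ∂ν) : μ = ν := by
  have ξ₀ : sphere (0 : E n) 1 :=
    ⟨EuclideanSpace.single ⟨0, hn⟩ 1, by simp⟩
  have : Nontrivial (E n) := ⟨ξ₀, 0, fun h0 => by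
    have := norm_sphere ξ₀
    rw [h0, norm_zero] at this
    exact zero_ne_one this⟩
  refine Measure.ext_of_charFun (funext fun t => ?_)
  have h1 := charFun_average ξ₀ hμ t
  rw [h (fun r => sphereJ ξ₀ (‖t‖ * r))
    ((continuous_sphereJ ξ₀).measurable.comp (measurable_const_mul _)),
    ← charFun_average ξ₀ hν t] at h1
  refine smul_right_injective ℂ ?_ h1
  rw [measureReal_def, ENNReal.toReal_ne_zero]
  exact ⟨by rw [Measure.measure_univ_ne_zero]; exact Measure.toSphere_ne_zero _,
    measure_ne_top _ _⟩

end SphereRotation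

/-! ### Integration of functions of `y` over the pairs `(y, ξ)`, and the constant `a_n`. -/

section HyperplaneAverage

open MeasureTheory Metric

variable {n : ℕ}

/-- A radial weight of finite mass on hyperplanes. -/
def radialW (n : ℕ) (r : ℝ) : ℝ := ((1 + r) ^ (n + 1))⁻¹

theorem measurable_radialW : Measurable (radialW n) := by
  unfold radialW
  fun_prop

theorem radialW_pos {r : ℝ} (hr : 0 ≤ r) : 0 < radialW n r := by
  unfold radialW
  positivity

/-- The area of the unit sphere of a hyperplane. -/
def sphereArea (ξ₀ : sphere (0 : E n) 1) : ℝ :=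
  Module.finrank ℝ (hyperplane (ξ₀ : E n)) *
    (volume : Measure (hyperplane (ξ₀ : E n))).real (ball 0 1)

/-- The image of the weighted measure of `T𝕊ⁿ⁻¹` under `(y, ξ) ↦ y`. -/
def nuTS (ξ₀ : sphere (0 : E n) 1) : Measure (E n) :=
  ((tsMeasure ξ₀).withDensity fun p => ENNReal.ofReal (radialW n ‖p.1.1‖)).map fun p => p.1.1

/-- The weighted measure `|y|⁻¹ dy`. -/
def nuRn (ξ₀ : sphere (0 : E n) 1) : Measure (E n) :=
  (volume : Measure (E n)).withDensity fun y =>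
    ENNReal.ofReal (sphereArea ξ₀ * (‖y‖⁻¹ * radialW n ‖y‖))

theorem sphereArea_nonneg (ξ₀ : sphere (0 : E n) 1) : 0 ≤ sphereArea ξ₀ := by
  unfold sphereArea
  positivity

theorem integral_nuTS {F : Type*} [NormedAddCommGroup F] [NormedSpace ℝ F]
    (ξ₀ : sphere (0 : E n) 1) {f : E n → F} (hf : StronglyMeasurable f) :
    ∫ y, f y ∂(nuTS ξ₀) = ∫ p, radialW n ‖p.1.1‖ • f p.1.1 ∂(tsMeasure ξ₀) := by
  have hm : Measurable fun p : TSphere n => ENNReal.ofReal (radialW n ‖p.1.1‖) := by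
    have := measurable_radialW (n := n)
    fun_prop
  rw [nuTS, integral_map (by fun_prop) hf.aestronglyMeasurable,
    integral_withDensity_eq_integral_toReal_smul hm (by simp)]
  simp only [ENNReal.toReal_ofReal (radialW_pos (norm_nonneg _)).le]

theorem integral_nuRn {F : Type*} [NormedAddCommGroup F] [NormedSpace ℝ F]
    (ξ₀ : sphere (0 : E n) 1) (f : E n → F) :
    ∫ y, f y ∂(nuRn ξ₀) = ∫ y, (sphereArea ξ₀ * (‖y‖⁻¹ * radialW n ‖y‖)) • f y := by
  have hm : Measurable fun y : E n =>
      ENNReal.ofReal (sphereArea ξ₀ * (‖y‖⁻¹ * radialW n ‖y‖)) := by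
    have := measurable_radialW (n := n)
    fun_prop
  rw [nuRn, integral_withDensity_eq_integral_toReal_smul hm (by simp)]
  have h (y : E n) : 0 ≤ sphereArea ξ₀ * (‖y‖⁻¹ * radialW n ‖y‖) :=
    mul_nonneg (sphereArea_nonneg ξ₀)
      (mul_nonneg (inv_nonneg.mpr (norm_nonneg _)) (radialW_pos (norm_nonneg _)).le)
  simp only [ENNReal.toReal_ofReal (h _)]

theorem isFiniteMeasure_nuTS (ξ₀ : sphere (0 : E n) 1) : IsFiniteMeasure (nuTS ξ₀) := by
  have hd := finrank_hyperplane ξ₀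
  have h1 := integrable_comp_norm_tsMeasure ξ₀ (h := radialW n) measurable_radialW
    (integrable_inv_one_add_pow (V := hyperplane (ξ₀ : E n)) volume (N := n + 1) (by omega))
  have := isFiniteMeasure_withDensity_ofReal h1.2
  unfold nuTS
  infer_instance

theorem isFiniteMeasure_nuRn (hn : 2 ≤ n) (ξ₀ : sphere (0 : E n) 1) :
    IsFiniteMeasure (nuRn ξ₀) := by
  have : Nontrivial (E n) := Module.nontrivial_of_finrank_pos (R := ℝ) (by
    rw [finrank_euclideanSpace_fin]; omega)
  refine isFiniteMeasure_withDensity_ofReal (Integrable.const_mul ?_ _).2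
  rw [integrable_fun_norm_addHaar volume (f := fun r => r⁻¹ * radialW n r),
    finrank_euclideanSpace_fin]
  have h2 : (2 : ℝ) ≤ n := by exact_mod_cast hn
  have := integrableOn_rpow_mul_inv_one_add_pow (a := (n - 2 : ℕ)) (N := n + 1)
    (by linarith [Nat.cast_nonneg (α := ℝ) (n - 2)]) (by
      rw [Nat.cast_sub hn]
      push_cast
      linarith)
  refine this.congr_fun (fun r hr => ?_) measurableSet_Ioi
  have hr : r ≠ 0 := (Set.mem_Ioi.mp hr).ne'
  simp only [smul_eq_mul, Real.rpow_natCast, radialW]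
  rw [show n - 1 = n - 2 + 1 by omega, pow_succ]
  field_simp
  ring

theorem charFun_nuTS (ξ₀ : sphere (0 : E n) 1) (g : E n ≃ₗᵢ[ℝ] E n) (t : E n) :
    charFun (nuTS ξ₀) (g t) = charFun (nuTS ξ₀) t := by
  have := isFiniteMeasure_nuTS ξ₀
  have key (t : E n) : charFun (nuTS ξ₀) t = ∫ ξ : sphere (0 : E n) 1,
      (∫ y : hyperplane (ξ : E n), radialW n ‖y‖ •
        Complex.exp ((inner ℝ (y : E n) t : ℝ) * Complex.I))
        ∂(volume : Measure (E n)).toSphere := by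
    have hm : StronglyMeasurable fun y : E n => Complex.exp ((inner ℝ y t : ℝ) * Complex.I) :=
      Continuous.stronglyMeasurable (by fun_prop)
    have hd := finrank_hyperplane ξ₀
    have h1 := integrable_comp_norm_tsMeasure ξ₀ (h := radialW n) measurable_radialW
      (integrable_inv_one_add_pow (V := hyperplane (ξ₀ : E n)) volume (N := n + 1) (by omega))
    rw [charFun_apply, integral_nuTS ξ₀ hm, integral_tsMeasure ξ₀]
    · rfl
    · refine h1.mono' ?_ (Filter.Eventually.of_forall fun p => ?_)
      · have := measurable_radialW (n := n)
        exact Measurable.aestronglyMeasurable (by fun_prop)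
      · rw [norm_smul, Complex.norm_exp_ofReal_mul_I, mul_one,
          Real.norm_of_nonneg (radialW_pos (norm_nonneg _)).le]
  rw [key, key, ← integral_sphereIso g]
  refine integral_congr_ae (Filter.Eventually.of_forall fun ξ => ?_)
  let e := hyperplaneEquiv g (ξ := (ξ : E n)) (η := sphereIso g ξ) rfl
  have h := e.measurePreserving.integral_comp e.toHomeomorph.measurableEmbedding
    (fun y => radialW n ‖y‖ • Complex.exp ((inner ℝ (y : E n) (g t) : ℝ) * Complex.I))
  simp only
  rw [← h]
  refine integral_congr_ae (Filter.Eventually.of_forall fun y => ?_)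
  have hc : (e y : E n) = g y := hyperplaneEquiv_coe g _ y
  simp only [LinearIsometryEquiv.norm_map, hc, LinearIsometryEquiv.inner_map_map]

theorem charFun_nuRn (ξ₀ : sphere (0 : E n) 1) (g : E n ≃ₗᵢ[ℝ] E n) (t : E n) :
    charFun (nuRn ξ₀) (g t) = charFun (nuRn ξ₀) t := by
  rw [charFun_apply, charFun_apply, integral_nuRn, integral_nuRn,
    ← g.measurePreserving.integral_comp g.toHomeomorph.measurableEmbedding]
  simp only [LinearIsometryEquiv.norm_map, LinearIsometryEquiv.inner_map_map]

theorem integral_norm_tsMeasure (ξ₀ : sphere (0 : E n) 1) {h : ℝ → ℂ} (hm : Measurable h) :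
    ∫ p, h ‖p.1.1‖ ∂(tsMeasure ξ₀) = (volume : Measure (E n)).toSphere.real Set.univ •
      ∫ z : hyperplane (ξ₀ : E n), h ‖z‖ := by
  have hm' : Measurable fun p : TSphere n => h ‖p.1.1‖ := by fun_prop
  rw [tsMeasure, integral_map (measurable_chart ξ₀).aemeasurable hm'.aestronglyMeasurable]
  simp only [norm_chart_fst]
  exact integral_fun_snd (fun z : hyperplane (ξ₀ : E n) => h ‖z‖)

/-- Both measures are finite and rotation invariant, so radial functions suffice. There polar
coordinates in dimensions `n - 1` and `n` give `r^{n-2}` and `r^{n-1} · r⁻¹`, and the constants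
match because each side carries the area of both unit spheres. -/
theorem nuTS_eq_nuRn (hn : 2 ≤ n) (ξ₀ : sphere (0 : E n) 1) : nuTS ξ₀ = nuRn ξ₀ := by
  have := isFiniteMeasure_nuTS ξ₀
  have := isFiniteMeasure_nuRn hn ξ₀
  have hE : Nontrivial (E n) := Module.nontrivial_of_finrank_pos (R := ℝ) (by
    rw [finrank_euclideanSpace_fin]; omega)
  have hH := nontrivial_hyperplane hn ξ₀
  have hd := finrank_hyperplane ξ₀
  refine ext_of_rotation_invariant (by omega) (charFun_nuTS ξ₀) (charFun_nuRn ξ₀) fun f hf => ?_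
  have hw := measurable_radialW (n := n)
  rw [integral_nuTS ξ₀ (f := fun y => f ‖y‖) (by fun_prop : Measurable _).stronglyMeasurable,
    integral_norm_tsMeasure ξ₀ (h := fun r => radialW n r • f r) (by fun_prop),
    integral_nuRn,
    integral_fun_norm_addHaar volume (fun r => radialW n r • f r),
    integral_fun_norm_addHaar volume
      (fun r => (sphereArea ξ₀ * (r⁻¹ * radialW n r)) • f r),
    Measure.toSphere_real_apply_univ, finrank_euclideanSpace_fin]
  have h1 : ∫ r in Set.Ioi (0 : ℝ), r ^ (n - 1) • (sphereArea ξ₀ * (r⁻¹ * radialW n r)) • f r =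
      sphereArea ξ₀ • ∫ r in Set.Ioi (0 : ℝ),
        r ^ (Module.finrank ℝ (hyperplane (ξ₀ : E n)) - 1) • radialW n r • f r := by
    rw [← integral_smul]
    refine setIntegral_congr_fun measurableSet_Ioi fun r hr => ?_
    have hr : r ≠ 0 := (Set.mem_Ioi.mp hr).ne'
    simp only [smul_smul]
    congr 1
    rw [show n - 1 = (Module.finrank ℝ (hyperplane (ξ₀ : E n)) - 1) + 1 by omega, pow_succ]
    field_simp
  rw [h1, sphereArea, ← Nat.cast_smul_eq_nsmul ℝ n, ← Nat.cast_smul_eq_nsmul ℝ (Module.finrank ℝ _)]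
  simp only [smul_smul]
  congr 1
  ring

/-- The auxiliary factor `radialW`, present only to make the measures finite, is divided out again.
-/
theorem integral_fst_tsMeasure (hn : 2 ≤ n) (ξ₀ : sphere (0 : E n) 1) {f : E n → ℝ}
    (hf : Measurable f) :
    ∫ p, f p.1.1 ∂(tsMeasure ξ₀) = sphereArea ξ₀ * ∫ y, ‖y‖⁻¹ * f y := by
  have hw := measurable_radialW (n := n)
  have hm : Measurable fun y => (radialW n ‖y‖)⁻¹ * f y := by fun_prop
  have h1 := integral_nuTS ξ₀ hm.stronglyMeasurable
  rw [nuTS_eq_nuRn hn, integral_nuRn] at h1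
  have h2 (y : E n) : radialW n ‖y‖ ≠ 0 := (radialW_pos (norm_nonneg _)).ne'
  simp only [smul_eq_mul, mul_inv_cancel_left₀ (h2 _)] at h1
  rw [← h1, ← integral_const_mul]
  refine integral_congr_ae (Filter.Eventually.of_forall fun y => ?_)
  have := h2 y
  simp only
  field_simp

/-- The unit ball of dimension `m = n - 1` has volume `π^{m/2} / Γ(m/2 + 1)`, so by `Γ(z+1) = zΓ(z)`
its boundary has area `2π^{m/2} / Γ(m/2)`. -/
theorem aConst_mul_sphereArea (hn : 2 ≤ n) (ξ₀ : sphere (0 : E n) 1) :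
    aConst n * sphereArea ξ₀ = 1 := by
  have hH := nontrivial_hyperplane hn ξ₀
  have hd := finrank_hyperplane ξ₀
  have h2 : (2 : ℝ) ≤ n := by exact_mod_cast hn
  have hm : ((Module.finrank ℝ (hyperplane (ξ₀ : E n)) : ℕ) : ℝ) = n - 1 := by
    rw [eq_sub_iff_add_eq]
    exact_mod_cast hd
  have hpos : 0 < ((n : ℝ) - 1) / 2 := by linarith
  have hG := (Real.Gamma_pos_of_pos hpos).ne'
  have hpi : (Real.pi ^ (((n : ℝ) - 1) / 2)) ≠ 0 := by positivity
  rw [sphereArea, measureReal_def, InnerProductSpace.volume_ball, ENNReal.ofReal_one, one_pow,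
    one_mul, ENNReal.toReal_ofReal (by positivity), hm, Real.Gamma_add_one hpos.ne',
    ← Real.rpow_natCast, hm, Real.sqrt_eq_rpow, ← Real.rpow_mul Real.pi_pos.le, aConst,
    show 1 / 2 * ((n : ℝ) - 1) = ((n : ℝ) - 1) / 2 by ring]
  have h3 : (n : ℝ) - 1 ≠ 0 := by linarith
  field_simp

end HyperplaneAverage

/-! ### The Fourier slice theorem for momentum ray transforms. -/

section Slice

open MeasureTheory FourierTransform LineDeriv

variable {n : ℕ}

set_option maxSynthPendingDepth 5

/-- The dilation `y ↦ y / (2π)`. -/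
def dilation (n : ℕ) : E n ≃L[ℝ] E n :=
  ContinuousLinearEquiv.smulLeft (Units.mk0 (2 * Real.pi)⁻¹ (by positivity))

theorem dilation_apply (y : E n) : dilation n y = (2 * Real.pi)⁻¹ • y := rfl

/-- The Fourier transform on the Schwartz space of `ℝⁿ`, in the normalization of `hatRn`. -/
def hatS (n : ℕ) : 𝓢(E n, ℂ) →L[ℂ] 𝓢(E n, ℂ) :=
  cRn n • (SchwartzMap.compCLMOfContinuousLinearEquiv ℂ (dilation n)).comp (fourierCLM ℂ 𝓢(E n, ℂ))

theorem hatS_eq (g : 𝓢(E n, ℂ)) (y : E n) :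
    hatS n g y = cRn n * (𝓕 g) (dilation n y) := rfl

theorem hatS_apply (g : 𝓢(E n, ℂ)) (y : E n) : hatS n g y = hatRn g y := by
  rw [hatS_eq, SchwartzMap.fourier_coe, Real.fourier_eq']
  simp only [hatRn, cRn, smul_eq_mul]
  congr 2
  funext x
  congr 2
  rw [dilation_apply, inner_smul_right, real_inner_comm]
  push_cast
  field_simp

theorem hatS_injective (n : ℕ) : Function.Injective (hatS n) := by
  refine (injective_iff_map_eq_zero _).mpr fun g hg => ?_
  have h : 𝓕 g = 0 := by
    ext y
    have := DFunLike.congr_fun hg ((dilation n).symm y)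
    rw [hatS_eq, (dilation n).apply_symm_apply] at this
    exact (mul_eq_zero.mp this).resolve_left
      (Complex.ofReal_ne_zero.mpr (Real.rpow_pos_of_pos (by positivity) _).ne')
  rw [← fourierInv_fourier_eq (F := 𝓢(E n, ℂ)) g, h]
  exact map_zero (fourierInvCLM ℂ 𝓢(E n, ℂ))

/-- Multiplication by `⟨·, ξ⟩`. -/
def mulInner (ξ : E n) : 𝓢(E n, ℂ) →L[ℝ] 𝓢(E n, ℂ) :=
  SchwartzMap.smulLeftCLM ℂ (fun x => inner ℝ x ξ)

theorem mulInner_apply (ξ : E n) (g : 𝓢(E n, ℂ)) (x : E n) :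
    mulInner ξ g x = (inner ℝ x ξ : ℝ) • g x :=
  SchwartzMap.smulLeftCLM_apply_apply (by fun_prop) _ _

theorem mulInner_iterate_apply (ξ : E n) (k : ℕ) (g : 𝓢(E n, ℂ)) (x : E n) :
    (mulInner ξ)^[k] g x = (inner ℝ x ξ : ℝ) ^ k • g x := by
  induction k with
  | zero => simp
  | succ k ih => rw [Function.iterate_succ_apply', mulInner_apply, ih, smul_smul, pow_succ']

theorem hatS_mulInner (ξ : E n) (g : 𝓢(E n, ℂ)) (y : E n) :
    hatS n (mulInner ξ g) y = Complex.I * fderiv ℝ (hatS n g) y ξ := by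
  have h1 : fderiv ℝ (hatS n g) y ξ = cRn n * fderiv ℝ (𝓕 g : 𝓢(E n, ℂ)) (dilation n y) (dilation n ξ) := by
    have h := ((𝓕 g).differentiableAt (x := dilation n y)).hasFDerivAt.comp y
      (dilation n).hasFDerivAt
    have h2 := (h.const_smul (cRn n)).fderiv
    exact DFunLike.congr_fun h2 ξ
  have h2 : fderiv ℝ (𝓕 g : 𝓢(E n, ℂ)) (dilation n y) ξ =
      (𝓕 (-(2 * Real.pi * Complex.I) • mulInner ξ g)) (dilation n y) :=
    DFunLike.congr_fun (SchwartzMap.lineDerivOp_fourier_eq g ξ) (dilation n y)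
  rw [h1, dilation_apply ξ, map_smul, h2, FourierTransform.fourier_smul, hatS_eq,
    smul_apply, Complex.real_smul, smul_eq_mul]
  have := Real.pi_ne_zero
  push_cast
  field_simp
  rw [Complex.I_sq]
  ring

/-- The function `⟨f(x), ξ ⊗ ξ⟩`. -/
def contract (f : TensorField n) (ξ : E n) : 𝓢(E n, ℂ) :=
  ∑ i, ∑ j, (ξ i * ξ j) • compS f i j

theorem contract_apply (f : TensorField n) (ξ x : E n) :
    contract f ξ x = ∑ i, ∑ j, comp f i j x * (ξ i : ℂ) * (ξ j : ℂ) := by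
  simp only [contract, sum_apply, smul_apply, compS_apply,
    Complex.real_smul, Complex.ofReal_mul]
  exact Finset.sum_congr rfl fun i _ => Finset.sum_congr rfl fun j _ => by ring

/-- The Fourier slice theorem for the momentum ray transforms. -/
theorem hatTS_rayTransform (k : ℕ) (f : TensorField n) (p : TSphere n) :
    hatTS (rayTransform k f) p =
      ((√(2 * Real.pi) : ℝ) : ℂ) * hatS n ((mulInner p.1.2)^[k] (contract f p.1.2)) p.1.1 := by
  have hint := integrable_kernelExp_mul p.1.1
    (SchwartzMap.integrable ((mulInner p.1.2)^[k] (contract f p.1.2)))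
  rw [hatS_apply, hatTS, cTS_eq, hatRn]
  change _ = _ * (cRn n * ∫ x, kernelExp p.1.1 x * _)
  -- Split `ℝⁿ` along `ξ`: at `x + τξ` the kernel does not depend on `τ`, while `⟨·, ξ⟩^k` equals
  -- `τ^k`; the inner integral is the ray transform.
  rw [integral_hyperplane p.2.1 hint, ← mul_assoc, mul_comm (cRn n)]
  congr 2
  funext x
  have hx : inner ℝ p.1.2 (x : E n) = 0 := mem_hyperplane.mp x.2
  have hy := p.2.2
  rw [rayTransform, ← integral_const_mul]
  congr 1
  funext τ
  have h1 : kernelExp p.1.1 ((x : E n) + τ • p.1.2) = kernelExp p.1.1 x := by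
    rw [kernelExp, kernelExp, inner_add_right, inner_smul_right, real_inner_comm p.1.2 p.1.1, hy]
    simp
  have h2 : inner ℝ ((x : E n) + τ • p.1.2) p.1.2 = τ := by
    rw [inner_add_left, inner_smul_left, real_inner_comm, hx, real_inner_self_eq_norm_sq, p.2.1]
    simp
  rw [h1, mulInner_iterate_apply, h2, contract_apply, Complex.real_smul, Complex.ofReal_pow]
  rfl

/-- The bilinear form `(a, b) ↦ a_i b_j`. -/
def coordForm (i j : Fin n) : E n →L[ℝ] E n →L[ℝ] ℂ :=
  ContinuousLinearMap.smulRight (EuclideanSpace.proj i : E n →L[ℝ] ℝ)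
    (Complex.ofRealCLM.comp (EuclideanSpace.proj j : E n →L[ℝ] ℝ))

theorem coordForm_apply (i j : Fin n) (a b : E n) : coordForm i j a b = (a i : ℂ) * (b j : ℂ) := by
  simp [coordForm]

/-- The Fourier transform of a tensor field, as a field of bilinear forms. -/
def tensorHat (f : TensorField n) (y : E n) : E n →L[ℝ] E n →L[ℝ] ℂ :=
  ∑ i, ∑ j, hatS n (compS f i j) y • coordForm i j

theorem tensorHat_apply (f : TensorField n) (y a b : E n) :
    tensorHat f y a b = ∑ i, ∑ j, hatS n (compS f i j) y * ((a i : ℂ) * (b j : ℂ)) := by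
  simp [tensorHat, coordForm_apply]

theorem contDiff_tensorHat (f : TensorField n) : ContDiff ℝ ∞ (tensorHat f) := by
  refine ContDiff.sum fun i _ => ContDiff.sum fun j _ => ?_
  exact ((hatS n (compS f i j)).smooth ⊤).smul contDiff_const

theorem tensorHat_symm (f : TensorField n) (y a b : E n) :
    tensorHat f y a b = tensorHat f y b a := by
  rw [tensorHat_apply, tensorHat_apply, Finset.sum_comm]
  refine Finset.sum_congr rfl fun i _ => Finset.sum_congr rfl fun j _ => ?_
  have : compS f j i = compS f i j := DFunLike.ext' (comp_symm f j i)
  rw [this]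
  ring

theorem tensorHat_single (f : TensorField n) (y : E n) (i j : Fin n) :
    tensorHat f y (EuclideanSpace.single i 1) (EuclideanSpace.single j 1) =
      hatRn (comp f i j) y := by
  rw [tensorHat_apply, ← show hatS n (compS f i j) y = hatRn (comp f i j) y from hatS_apply _ _,
    Finset.sum_eq_single i, Finset.sum_eq_single j]
  · simp
  · intro b _ hb
    simp [hb]
  · simp
  · intro b _ hb
    simp [hb]
  · simp

theorem hatS_contract (f : TensorField n) (ξ y : E n) :
    hatS n (contract f ξ) y = tensorHat f y ξ ξ := by
  rw [contract, tensorHat_apply, map_sum, sum_apply]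
  refine Finset.sum_congr rfl fun i _ => ?_
  rw [map_sum, sum_apply]
  refine Finset.sum_congr rfl fun j _ => ?_
  rw [← Complex.coe_smul, map_smul, smul_apply, smul_eq_mul]
  push_cast
  ring

theorem differentiable_tensorHat (f : TensorField n) : Differentiable ℝ (tensorHat f) :=
  (contDiff_tensorHat f).differentiable (by simp)

theorem differentiable_fderiv_tensorHat (f : TensorField n) :
    Differentiable ℝ (fderiv ℝ (tensorHat f)) :=
  ((contDiff_tensorHat f).fderiv_right (m := 1) (by norm_cast)).differentiable (by simp)

theorem hatS_mulInner_contract (f : TensorField n) (ξ y : E n) :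
    hatS n (mulInner ξ (contract f ξ)) y = Complex.I * fderiv ℝ (tensorHat f) y ξ ξ ξ := by
  have h : HasFDerivAt (fun y => tensorHat f y ξ ξ) _ y :=
    ((differentiable_tensorHat f y).hasFDerivAt.clm_apply (hasFDerivAt_const ξ y)).clm_apply
      (hasFDerivAt_const ξ y)
  rw [hatS_mulInner, show (hatS n (contract f ξ) : E n → ℂ) = fun y => tensorHat f y ξ ξ from
    funext (hatS_contract f ξ), h.fderiv]
  simp

theorem hatS_mulInner_mulInner_contract (f : TensorField n) (ξ y : E n) :
    hatS n (mulInner ξ (mulInner ξ (contract f ξ))) y =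
      -fderiv ℝ (fderiv ℝ (tensorHat f)) y ξ ξ ξ ξ := by
  have h : HasFDerivAt (fun y => Complex.I * fderiv ℝ (tensorHat f) y ξ ξ ξ) _ y :=
    ((((differentiable_fderiv_tensorHat f y).hasFDerivAt.clm_apply
      (hasFDerivAt_const ξ y)).clm_apply (hasFDerivAt_const ξ y)).clm_apply
      (hasFDerivAt_const ξ y)).const_mul Complex.I
  rw [hatS_mulInner, show (hatS n (mulInner ξ (contract f ξ)) : E n → ℂ) =
    fun y => Complex.I * fderiv ℝ (tensorHat f) y ξ ξ ξ from
    funext (hatS_mulInner_contract f ξ), h.fderiv]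
  simp [← mul_assoc]

end Slice

/-! ### Jets of the transforms of `I⁰f`, `I¹f`, `I²f`, and the identification of `G` with the
Fourier transform of `f`. -/

section ImageJets

open Matrix

variable {n : ℕ}

set_option maxSynthPendingDepth 5

/-- The symbol `F(y)(ξ, ξ)` of the transform `I⁰f`. -/
def symbol₀ (f : TensorField n) (q : E n × E n) : ℂ := tensorHat f q.1 q.2 q.2

/-- The symbol `(∂_ξ F)(y)(ξ, ξ)` of the transform `I¹f`. -/
def symbol₁ (f : TensorField n) (q : E n × E n) : ℂ := fderiv ℝ (tensorHat f) q.1 q.2 q.2 q.2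

theorem hatTS_rayTransform_zero (f : TensorField n) (p : TSphere n) :
    hatTS (rayTransform 0 f) p = ((√(2 * Real.pi) : ℝ) : ℂ) * symbol₀ f p.1 := by
  rw [hatTS_rayTransform, Function.iterate_zero_apply, hatS_contract]
  rfl

theorem hatTS_rayTransform_one (f : TensorField n) (p : TSphere n) :
    hatTS (rayTransform 1 f) p = ((√(2 * Real.pi) : ℝ) : ℂ) * Complex.I * symbol₁ f p.1 := by
  rw [hatTS_rayTransform, Function.iterate_one, hatS_mulInner_contract, mul_assoc]
  rfl

theorem hatTS_rayTransform_two (f : TensorField n) (p : TSphere n) :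
    hatTS (rayTransform 2 f) p = -((√(2 * Real.pi) : ℝ) : ℂ) *
      fderiv ℝ (fderiv ℝ (tensorHat f)) p.1.1 p.1.2 p.1.2 p.1.2 p.1.2 := by
  rw [hatTS_rayTransform, Function.iterate_succ_apply, Function.iterate_one,
    hatS_mulInner_mulInner_contract]
  ring

theorem hasFDerivAt_tensorHat_fst (f : TensorField n) (q : E n × E n) :
    HasFDerivAt (fun q : E n × E n => tensorHat f q.1)
      ((fderiv ℝ (tensorHat f) q.1).comp (ContinuousLinearMap.fst ℝ _ _)) q :=
  (differentiable_tensorHat f q.1).hasFDerivAt.comp q hasFDerivAt_fst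

theorem hasFDerivAt_fderiv_tensorHat_fst (f : TensorField n) (q : E n × E n) :
    HasFDerivAt (fun q : E n × E n => fderiv ℝ (tensorHat f) q.1)
      ((fderiv ℝ (fderiv ℝ (tensorHat f)) q.1).comp (ContinuousLinearMap.fst ℝ _ _)) q :=
  (differentiable_fderiv_tensorHat f q.1).hasFDerivAt.comp q hasFDerivAt_fst

theorem fderiv_symbol₀ (f : TensorField n) (q : E n × E n) :
    DifferentiableAt ℝ (symbol₀ f) q ∧ ∀ v : E n × E n, fderiv ℝ (symbol₀ f) q v =
      fderiv ℝ (tensorHat f) q.1 v.1 q.2 q.2 + tensorHat f q.1 v.2 q.2 +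
        tensorHat f q.1 q.2 v.2 := by
  have h : HasFDerivAt (symbol₀ f) _ q :=
    ((hasFDerivAt_tensorHat_fst f q).clm_apply hasFDerivAt_snd).clm_apply hasFDerivAt_snd
  refine ⟨h.differentiableAt, fun v => ?_⟩
  rw [h.fderiv]
  simp
  ring

theorem fderiv_symbol₁ (f : TensorField n) (q : E n × E n) :
    DifferentiableAt ℝ (symbol₁ f) q ∧ ∀ v : E n × E n, fderiv ℝ (symbol₁ f) q v =
      fderiv ℝ (fderiv ℝ (tensorHat f)) q.1 v.1 q.2 q.2 q.2 +
        fderiv ℝ (tensorHat f) q.1 v.2 q.2 q.2 + fderiv ℝ (tensorHat f) q.1 q.2 v.2 q.2 +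
        fderiv ℝ (tensorHat f) q.1 q.2 q.2 v.2 := by
  have h : HasFDerivAt (symbol₁ f) _ q :=
    (((hasFDerivAt_fderiv_tensorHat_fst f q).clm_apply hasFDerivAt_snd).clm_apply
      hasFDerivAt_snd).clm_apply hasFDerivAt_snd
  refine ⟨h.differentiableAt, fun v => ?_⟩
  rw [h.fderiv]
  simp
  ring

/-- The symbol of `I⁰f` with one index free. -/
def symbolVec (f : TensorField n) (a : E n) (q : E n × E n) : ℂ := tensorHat f q.1 a q.2

theorem fderiv_symbolVec (f : TensorField n) (a : E n) (q : E n × E n) :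
    DifferentiableAt ℝ (symbolVec f a) q ∧ ∀ v : E n × E n, fderiv ℝ (symbolVec f a) q v =
      fderiv ℝ (tensorHat f) q.1 v.1 a q.2 + tensorHat f q.1 a v.2 := by
  have h : HasFDerivAt (symbolVec f a) _ q :=
    ((hasFDerivAt_tensorHat_fst f q).clm_apply (hasFDerivAt_const a q)).clm_apply hasFDerivAt_snd
  refine ⟨h.differentiableAt, fun v => ?_⟩
  rw [h.fderiv]
  simp
  ring

theorem fderiv_tensorHat_symm (f : TensorField n) (y h a b : E n) :
    fderiv ℝ (tensorHat f) y h a b = fderiv ℝ (tensorHat f) y h b a := by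
  have key (a b : E n) : HasFDerivAt (fun y => tensorHat f y a b) _ y :=
    ((differentiable_tensorHat f y).hasFDerivAt.clm_apply (hasFDerivAt_const a y)).clm_apply
      (hasFDerivAt_const b y)
  have h1 := (key a b).fderiv
  rw [show (fun y => tensorHat f y a b) = fun y => tensorHat f y b a from
    funext fun y => tensorHat_symm f y a b, (key b a).fderiv] at h1
  have := DFunLike.congr_fun h1 h
  simpa using this.symm

/-- The function `Ξ_i` of the symbol of `I⁰f`, extended to `ℝⁿ × ℝⁿ`. -/
def symbolXi (f : TensorField n) (i : Fin n) (q : E n × E n) : ℂ :=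
  2 * symbolVec f (EuclideanSpace.single i 1) q - (q.1 i : ℂ) * symbol₁ f q -
    2 * ((q.2 i : ℂ) * symbol₀ f q)

theorem fderiv_coord_mul (L : E n × E n →L[ℝ] ℝ) {g : E n × E n → ℂ} {q : E n × E n}
    (hg : DifferentiableAt ℝ g q) :
    DifferentiableAt ℝ (fun q => (L q : ℂ) * g q) q ∧ ∀ v,
      fderiv ℝ (fun q => (L q : ℂ) * g q) q v = (L v : ℂ) * g q + (L q : ℂ) * fderiv ℝ g q v := by
  have h : HasFDerivAt (fun q => (L q : ℂ) * g q) _ q :=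
    ((Complex.ofRealCLM.comp L).hasFDerivAt (x := q)).mul hg.hasFDerivAt
  refine ⟨h.differentiableAt, fun v => ?_⟩
  rw [h.fderiv]
  simp
  ring

theorem fderiv_symbolXi (f : TensorField n) (i : Fin n) (q : E n × E n) :
    DifferentiableAt ℝ (symbolXi f i) q ∧ ∀ v : E n × E n, fderiv ℝ (symbolXi f i) q v =
      2 * fderiv ℝ (symbolVec f (EuclideanSpace.single i 1)) q v -
        ((v.1 i : ℂ) * symbol₁ f q + (q.1 i : ℂ) * fderiv ℝ (symbol₁ f) q v) -
        2 * ((v.2 i : ℂ) * symbol₀ f q + (q.2 i : ℂ) * fderiv ℝ (symbol₀ f) q v) := by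
  obtain ⟨h1, h1'⟩ := fderiv_coord_mul ((EuclideanSpace.proj i : E n →L[ℝ] ℝ).comp
    (ContinuousLinearMap.fst ℝ (E n) (E n))) (fderiv_symbol₁ f q).1
  obtain ⟨h2, h2'⟩ := fderiv_coord_mul ((EuclideanSpace.proj i : E n →L[ℝ] ℝ).comp
    (ContinuousLinearMap.snd ℝ (E n) (E n))) (fderiv_symbol₀ f q).1
  have h : HasFDerivAt (symbolXi f i) _ q :=
    (((fderiv_symbolVec f (EuclideanSpace.single i 1) q).1.hasFDerivAt.const_mul 2).sub
      h1.hasFDerivAt).sub (h2.hasFDerivAt.const_mul 2)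
  refine ⟨h.differentiableAt, fun v => ?_⟩
  rw [h.fderiv]
  simp only [_root_.sub_apply, _root_.smul_apply, smul_eq_mul, h1', h2']
  rfl

theorem opXi_const_mul_eq_fderiv {φ : TSphere n → ℂ} {Φ : E n × E n → ℂ} {c : ℂ}
    (h : ∀ p : TSphere n, φ p = c * Φ p.1) (p : TSphere n) (hΦ : DifferentiableAt ℝ Φ p.1)
    (i : Fin n) : opXi i φ p = c * fderiv ℝ Φ p.1 (fieldXi i p.1) := by
  rw [opXi_eq_fderiv h p (hΦ.const_mul c), fderiv_const_mul hΦ]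
  rfl

theorem opX_const_mul_eq_fderiv {φ : TSphere n → ℂ} {Φ : E n × E n → ℂ} {c : ℂ}
    (h : ∀ p : TSphere n, φ p = c * Φ p.1) (p : TSphere n) (hΦ : DifferentiableAt ℝ Φ p.1)
    (i : Fin n) : opX i φ p = c * fderiv ℝ Φ p.1 (fieldX i p.1) := by
  rw [opX_eq_fderiv h p (hΦ.const_mul c), fderiv_const_mul hΦ]
  rfl

/-- The transform of `I⁰f` has the ambient representative `√(2π) F(y)(ξ, ξ)`. Its derivative along
`Ξ_i` is again given by an ambient formula, so it can be differentiated a second time. -/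
theorem jetXi_rayTransform_zero (f : TensorField n) (p : TSphere n) (i : Fin n) :
    jetXi (rayTransform 0 f) p i = ((√(2 * Real.pi) : ℝ) : ℂ) * symbolXi f i p.1 := by
  rw [jetXi, hatTS_opXi (rayTransform_mem 0 f), opXi_const_mul_eq_fderiv
    (hatTS_rayTransform_zero f) p (fderiv_symbol₀ f p.1).1, (fderiv_symbol₀ f p.1).2]
  simp only [fieldXi, symbolXi, symbolVec, symbol₀, symbol₁, map_neg, map_smul, map_sub,
    _root_.neg_apply, _root_.smul_apply, _root_.sub_apply, Complex.real_smul,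
    tensorHat_symm f p.1.1 p.1.2 (EuclideanSpace.single i 1)]
  ring

theorem jetXi_rayTransform_one (f : TensorField n) (p : TSphere n) (i : Fin n) :
    jetXi (rayTransform 1 f) p i = ((√(2 * Real.pi) : ℝ) : ℂ) * Complex.I *
      (2 * fderiv ℝ (tensorHat f) p.1.1 p.1.2 (EuclideanSpace.single i 1) p.1.2 +
        fderiv ℝ (tensorHat f) p.1.1 (EuclideanSpace.single i 1) p.1.2 p.1.2 -
        p.1.1 i * fderiv ℝ (fderiv ℝ (tensorHat f)) p.1.1 p.1.2 p.1.2 p.1.2 p.1.2 -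
        3 * p.1.2 i * symbol₁ f p.1) := by
  rw [jetXi, hatTS_opXi (rayTransform_mem 1 f), opXi_const_mul_eq_fderiv
    (hatTS_rayTransform_one f) p (fderiv_symbol₁ f p.1).1, (fderiv_symbol₁ f p.1).2]
  simp only [fieldXi, symbol₁, map_neg, map_smul, map_sub,
    _root_.neg_apply, _root_.smul_apply, _root_.sub_apply, Complex.real_smul,
    fderiv_tensorHat_symm f p.1.1 p.1.2 p.1.2 (EuclideanSpace.single i 1)]
  ring

theorem jetX_rayTransform_zero (f : TensorField n) (p : TSphere n) (i : Fin n) :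
    jetX (rayTransform 0 f) p i = ((√(2 * Real.pi) : ℝ) : ℂ) *
      (fderiv ℝ (tensorHat f) p.1.1 (EuclideanSpace.single i 1) p.1.2 p.1.2 -
        p.1.2 i * symbol₁ f p.1) := by
  rw [jetX, ← opX_hatTS (rayTransform_mem 0 f), opX_const_mul_eq_fderiv
    (hatTS_rayTransform_zero f) p (fderiv_symbol₀ f p.1).1, (fderiv_symbol₀ f p.1).2]
  simp only [fieldX, symbol₁, map_smul, map_sub, map_zero, _root_.zero_apply,
    _root_.smul_apply, _root_.sub_apply, Complex.real_smul]
  ring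

theorem jetXi2_rayTransform_zero (f : TensorField n) (p : TSphere n) (i j : Fin n) :
    jetXi2 (rayTransform 0 f) p i j = ((√(2 * Real.pi) : ℝ) : ℂ) *
      fderiv ℝ (symbolXi f j) p.1 (fieldXi i p.1) := by
  have hm := rayTransform_mem 0 f
  have h : hatTS (opXi j (rayTransform 0 f)) = fun p => jetXi (rayTransform 0 f) p j := rfl
  rw [jetXi2, Matrix.of_apply, hatTS_opXi (opXi_mem j hm), h, opXi_const_mul_eq_fderiv
    (fun p => jetXi_rayTransform_zero f p j) p (fderiv_symbolXi f j p.1).1]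

/-- The tensor field attached to the image of `f` is the Fourier transform of `f`. -/
theorem hatG_rayTransform (f : TensorField n) (p : TSphere n) (i j : Fin n) :
    hatG (rayTransform 0 f) (rayTransform 1 f) (rayTransform 2 f) p i j =
      2 * ((√(2 * Real.pi) : ℝ) : ℂ) * hatRn (comp f i j) p.1.1 := by
  have hδ : ((EuclideanSpace.single i (1 : ℝ) : E n) j : ℂ) =
      (1 : Matrix (Fin n) (Fin n) ℂ) i j := by
    by_cases h : i = j
    · rw [h, Matrix.one_apply_eq]
      simp
    · simp [h, Ne.symm h]
  rw [hatG, symbolG]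
  simp only [Matrix.add_apply, Matrix.smul_apply, vecMulVec_apply, smul_eq_mul, yC, xiC,
    jetXi_rayTransform_zero, jetXi_rayTransform_one, jetX_rayTransform_zero,
    jetXi2_rayTransform_zero, (fderiv_symbolXi f j p.1).2, (fderiv_symbol₀ f p.1).2,
    (fderiv_symbol₁ f p.1).2, (fderiv_symbolVec f _ p.1).2,
    hatTS_rayTransform_zero, hatTS_rayTransform_one, hatTS_rayTransform_two,
    ← hδ, ← tensorHat_single]
  simp only [fieldXi, symbolXi, symbolVec, symbol₀, symbol₁, map_neg, map_smul, map_sub,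
    _root_.neg_apply, _root_.smul_apply, _root_.sub_apply, Complex.real_smul,
    tensorHat_symm f p.1.1 p.1.2 (EuclideanSpace.single i 1),
    tensorHat_symm f p.1.1 (EuclideanSpace.single j 1) (EuclideanSpace.single i 1),
    fderiv_tensorHat_symm f p.1.1 p.1.2 p.1.2 (EuclideanSpace.single i 1),
    PiLp.neg_apply, PiLp.smul_apply, PiLp.sub_apply, smul_eq_mul, Complex.ofReal_neg,
    Complex.ofReal_mul, Complex.ofReal_sub]
  -- The listed terms are those in which the factor `i` of the transform of `I¹f` meets the factor
  -- `-i` in `G`. Once `i² = -1` is used, every derivative of `F` cancels.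
  linear_combination ((√(2 * Real.pi) : ℝ) : ℂ) *
    (2 * p.1.1 i * p.1.2 j * fderiv ℝ (tensorHat f) p.1.1 p.1.2 p.1.2 p.1.2 +
      2 * p.1.2 i * p.1.1 j * fderiv ℝ (tensorHat f) p.1.1 p.1.2 p.1.2 p.1.2 +
      2 * p.1.1 i * p.1.1 j *
        fderiv ℝ (fderiv ℝ (tensorHat f)) p.1.1 p.1.2 p.1.2 p.1.2 p.1.2 -
      2 * p.1.1 i * fderiv ℝ (tensorHat f) p.1.1 p.1.2 (EuclideanSpace.single j 1) p.1.2 -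
      p.1.1 i * fderiv ℝ (tensorHat f) p.1.1 (EuclideanSpace.single j 1) p.1.2 p.1.2 -
      2 * p.1.1 j * fderiv ℝ (tensorHat f) p.1.1 p.1.2 (EuclideanSpace.single i 1) p.1.2 -
      p.1.1 j * fderiv ℝ (tensorHat f) p.1.1 (EuclideanSpace.single i 1) p.1.2 p.1.2) *
    Complex.I_sq

end ImageJets

/-! ### The norm identity on Schwartz fields, and injectivity of the transforms. -/

section NormIdentity

open MeasureTheory Metric

variable {n : ℕ}

/-- In polar coordinates on `ℝⁿ` the exponent at the origin is `n - 1 + 2t > -1`. -/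
theorem integrable_weight_mul_normSq (hn : 2 ≤ n) (s : ℝ) {t : ℝ} (ht : -(n : ℝ) / 2 < t)
    (g : 𝓢(E n, ℂ)) : Integrable fun y => weight s t ‖y‖ * ‖g y‖ ^ 2 := by
  have hE : Nontrivial (E n) := Module.nontrivial_of_finrank_pos (R := ℝ) (by
    rw [finrank_euclideanSpace_fin]; omega)
  obtain ⟨M, hM⟩ := weight_le s t
  obtain ⟨N, hN⟩ := exists_nat_gt (2 * t + n)
  obtain ⟨C, hC0, hC⟩ := schwartz_decay g (N + M)
  have h1 : Integrable fun y : E n => ‖y‖ ^ (2 * t) * ((1 + ‖y‖) ^ N)⁻¹ := by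
    rw [integrable_fun_norm_addHaar volume (f := fun r => r ^ (2 * t) * ((1 + r) ^ N)⁻¹),
      finrank_euclideanSpace_fin]
    have h2 : ((n - 1 : ℕ) : ℝ) = n - 1 := by rw [Nat.cast_sub (by omega), Nat.cast_one]
    refine (integrableOn_rpow_mul_inv_one_add_pow (a := (n - 1) + 2 * t) (by linarith) (N := N)
      (by linarith)).congr_fun (fun r hr => ?_) measurableSet_Ioi
    have hr : 0 < r := hr
    simp only [smul_eq_mul]
    rw [Real.rpow_add hr, ← h2, Real.rpow_natCast]
    ring
  refine (h1.const_mul (C ^ 2)).mono' ?_ (Filter.Eventually.of_forall fun y => ?_)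
  · have := measurable_weight s t
    have hg := g.continuous.measurable
    exact Measurable.aestronglyMeasurable (by fun_prop)
  · rw [Real.norm_of_nonneg (mul_nonneg (weight_nonneg _ _ (norm_nonneg _)) (sq_nonneg _))]
    have h1y : (1 : ℝ) ≤ 1 + ‖y‖ := by linarith [norm_nonneg y]
    have h3 : ((1 + ‖y‖) ^ (N + M))⁻¹ ≤ 1 := inv_le_one_of_one_le₀ (one_le_pow₀ h1y)
    calc _ ≤ (‖y‖ ^ (2 * t) * (1 + ‖y‖) ^ M) * (C * ((1 + ‖y‖) ^ (N + M))⁻¹) ^ 2 := by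
          gcongr
          · exact hM _ (norm_nonneg _)
          · exact hC y
      _ = C ^ 2 * (‖y‖ ^ (2 * t) * ((1 + ‖y‖) ^ N)⁻¹) * ((1 + ‖y‖) ^ (N + M))⁻¹ := by
          have : (0 : ℝ) < 1 + ‖y‖ := by positivity
          rw [pow_add]
          field_simp
      _ ≤ _ := mul_le_of_le_one_right (by positivity) h3

/-- The Fourier transform of a tensor field, as a field of matrices. -/
def hatMatrix (f : TensorField n) (y : E n) : Matrix (Fin n) (Fin n) ℂ :=
  Matrix.of fun i j => hatRn (comp f i j) y

theorem hatRn_comp (f : TensorField n) (i j : Fin n) (y : E n) :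
    hatRn (comp f i j) y = hatS n (compS f i j) y :=
  (hatS_apply (compS f i j) y).symm

theorem frobSq_hatG_rayTransform (f : TensorField n) (p : TSphere n) :
    frobSq (hatG (rayTransform 0 f) (rayTransform 1 f) (rayTransform 2 f) p) =
      8 * Real.pi * frobSq (hatMatrix f p.1.1) := by
  have h : (√(2 * Real.pi)) ^ 2 = 2 * Real.pi := Real.sq_sqrt (by positivity)
  simp only [frobSq, hatG_rayTransform, hatMatrix, Matrix.of_apply, norm_mul, mul_pow,
    Complex.norm_real, Complex.norm_ofNat, Real.norm_of_nonneg (Real.sqrt_nonneg _), h,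
    ← Finset.mul_sum]
  ring

/-- The Reshetnyak formula on Schwartz fields. -/
theorem tripleNormSq_rayTransform (hn : 2 ≤ n) (ξ₀ : sphere (0 : E n) 1) (s : ℝ) {t : ℝ}
    (ht : -(n : ℝ) / 2 < t) (f : TensorField n) :
    tripleNormSq s t (rayTransform 0 f) (rayTransform 1 f) (rayTransform 2 f) =
      tensorNormSq s t f := by
  have hE : Nontrivial (E n) := Module.nontrivial_of_finrank_pos (R := ℝ) (by
    rw [finrank_euclideanSpace_fin]; omega)
  have hm : Measurable fun y : E n =>
      weight (s + 1 / 2) (t + 1 / 2) ‖y‖ * frobSq (hatMatrix f y) := by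
    have := measurable_weight (s + 1 / 2) (t + 1 / 2)
    have h (i j : Fin n) := (hatS n (compS f i j)).continuous.measurable
    simp only [frobSq, hatMatrix, Matrix.of_apply, hatRn_comp]
    fun_prop
  have h1 : ∫ y, ‖y‖⁻¹ * (weight (s + 1 / 2) (t + 1 / 2) ‖y‖ * frobSq (hatMatrix f y)) =
      tensorNormSq s t f := by
    -- The shift of both indices by `1/2` contributes one factor `|y|`, which the density `|y|⁻¹`
    -- cancels.
    have h2 : ∀ᵐ y : E n, ‖y‖⁻¹ * (weight (s + 1 / 2) (t + 1 / 2) ‖y‖ * frobSq (hatMatrix f y)) =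
        ∑ i, ∑ j, weight s t ‖y‖ * ‖hatRn (comp f i j) y‖ ^ 2 := by
      filter_upwards [compl_mem_ae_iff.mpr (measure_singleton (0 : E n))] with y hy
      have hy : 0 < ‖y‖ := norm_pos_iff.mpr hy
      rw [weight_add s t (1 / 2) hy, show (2 : ℝ) * (1 / 2) = 1 by norm_num, Real.rpow_one,
        mul_assoc, inv_mul_cancel_left₀ hy.ne', frobSq, Finset.mul_sum]
      exact Finset.sum_congr rfl fun i _ => Finset.mul_sum _ _ _
    have h3 (i j : Fin n) : Integrable fun y => weight s t ‖y‖ * ‖hatRn (comp f i j) y‖ ^ 2 := by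
      simp only [hatRn_comp]
      exact integrable_weight_mul_normSq hn s ht _
    rw [integral_congr_ae h2, integral_finsetSum _ fun i _ => integrable_finsetSum _ fun j _ => h3 i j]
    exact Finset.sum_congr rfl fun i _ => integral_finsetSum _ fun j _ => h3 i j
  rw [(tripleNormSq_eq hn ξ₀ ht (rayTransform_mem 0 f) (rayTransform_mem 1 f)
    (rayTransform_mem 2 f)).2]
  have h4 (p : TSphere n) : weight (s + 1 / 2) (t + 1 / 2) ‖p.1.1‖ *
      frobSq (hatG (rayTransform 0 f) (rayTransform 1 f) (rayTransform 2 f) p) =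
      8 * Real.pi * (weight (s + 1 / 2) (t + 1 / 2) ‖p.1.1‖ * frobSq (hatMatrix f p.1.1)) := by
    rw [frobSq_hatG_rayTransform]
    ring
  simp only [h4]
  rw [integral_const_mul, integral_fst_tsMeasure hn ξ₀ hm, h1]
  have h5 := aConst_mul_sphereArea hn ξ₀
  have := Real.pi_ne_zero
  field_simp
  -- The constants are `a_n/4 · 1/(2π) · 8π = a_n`, and `a_n` times the area of `𝕊ⁿ⁻²` is `1`.
  linear_combination 8 * tensorNormSq s t f * h5

theorem rayTransform_add (k : ℕ) (f g : TensorField n) :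
    rayTransform k (f + g) = rayTransform k f + rayTransform k g := by
  funext p
  have h (i j : Fin n) : lineMoment k (compS (f + g) i j) p.1 =
      lineMoment k (compS f i j) p.1 + lineMoment k (compS g i j) p.1 := by
    rw [lineMoment, lineMoment, lineMoment, ← integral_add (integrable_line _ k (mem_slit p))
      (integrable_line _ k (mem_slit p))]
    congr 1
    funext τ
    rw [← smul_add]
    rfl
  simp only [Pi.add_apply, rayTransform_eq, h, smul_add, Finset.sum_add_distrib]

theorem rayTransform_smul (k : ℕ) (c : ℂ) (f : TensorField n) :
    rayTransform k (c • f) = c • rayTransform k f := by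
  funext p
  have h (i j : Fin n) : lineMoment k (compS (c • f) i j) p.1 =
      c • lineMoment k (compS f i j) p.1 := by
    rw [lineMoment, lineMoment, ← integral_smul]
    congr 1
    funext τ
    rw [smul_comm]
    rfl
  simp only [Pi.smul_apply, rayTransform_eq, h, Finset.smul_sum, smul_comm c]

/-- The map `f ↦ (I⁰f, I¹f, I²f)`. -/
def rayTriple (n : ℕ) : TensorField n →ₗ[ℂ] Triple n where
  toFun f := (⟨rayTransform 0 f, rayTransform_mem 0 f⟩, ⟨rayTransform 1 f, rayTransform_mem 1 f⟩,
    ⟨rayTransform 2 f, rayTransform_mem 2 f⟩)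
  map_add' f g := Prod.ext (Subtype.ext (rayTransform_add 0 f g))
    (Prod.ext (Subtype.ext (rayTransform_add 1 f g)) (Subtype.ext (rayTransform_add 2 f g)))
  map_smul' c f := Prod.ext (Subtype.ext (rayTransform_smul 0 c f))
    (Prod.ext (Subtype.ext (rayTransform_smul 1 c f)) (Subtype.ext (rayTransform_smul 2 c f)))

theorem exists_tsphere (hn : 2 ≤ n) (y : E n) : ∃ p : TSphere n, p.1.1 = y := by
  have h : (hyperplane y) ≠ ⊥ := by
    intro h
    rw [Submodule.orthogonal_eq_bot_iff] at h
    have h1 := finrank_span_le_card (R := ℝ) ({y} : Set (E n))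
    rw [h, finrank_top, finrank_euclideanSpace_fin] at h1
    simp at h1
    omega
  obtain ⟨z, hz, hz0⟩ := Submodule.exists_mem_ne_zero_of_ne_bot h
  have hz1 : ‖z‖ ≠ 0 := norm_ne_zero_iff.mpr hz0
  refine ⟨⟨(y, ‖z‖⁻¹ • z), ?_, ?_⟩, rfl⟩
  · rw [norm_smul, norm_inv, norm_norm, inv_mul_cancel₀ hz1]
  · rw [inner_smul_left, real_inner_comm, mem_hyperplane.mp hz, mul_zero]

/-- Every `y` is the first component of some point of `T𝕊ⁿ⁻¹` when `n ≥ 2`, and there `G` determines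
the Fourier transform of `f` at `y`. This supplies definiteness of the inner product on tensor
fields. -/
theorem rayTriple_injective (hn : 2 ≤ n) : Function.Injective (rayTriple n) := by
  refine (injective_iff_map_eq_zero _).mpr fun f hf => ?_
  have h0 : rayTransform 0 f = 0 := congrArg (fun a : Triple n => a.1.1) hf
  have h1 : rayTransform 1 f = 0 := congrArg (fun a : Triple n => a.2.1.1) hf
  have h2 : rayTransform 2 f = 0 := congrArg (fun a : Triple n => a.2.2.1) hf
  have hz (p : TSphere n) : hatG (0 : TSphere n → ℂ) 0 0 p = 0 := by
    have h := hatG_smul 0 (0 : Triple n) p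
    rw [zero_smul, zero_smul] at h
    exact h
  have hc (i j : Fin n) : compS f i j = 0 := by
    refine hatS_injective n ?_
    rw [map_zero]
    ext y
    obtain ⟨p, rfl⟩ := exists_tsphere hn y
    have h := hatG_rayTransform f p i j
    rw [h0, h1, h2, hz, Matrix.zero_apply, hatRn_comp, eq_comm, mul_eq_zero] at h
    refine h.resolve_left (mul_ne_zero two_ne_zero (Complex.ofReal_ne_zero.mpr ?_))
    positivity
  ext x ij
  exact DFunLike.congr_fun (hc ij.1 ij.2) x

/-- The inner product of `H^s_t(ℝⁿ; S²ℝⁿ)` on Schwartz tensor fields, in terms of the momentum ray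
transforms. -/
@[reducible] def tensorCore (hn : 2 ≤ n) (c : InnerProductSpace.Core ℂ (Triple n)) :
    InnerProductSpace.Core ℂ (TensorField n) where
  inner f g := c.inner (rayTriple n f) (rayTriple n g)
  conj_inner_symm f g := c.conj_inner_symm _ _
  re_inner_nonneg f := c.re_inner_nonneg _
  add_left f g h := by rw [map_add, c.add_left]
  smul_left f g r := by rw [map_smul, c.smul_left]
  definite f h := rayTriple_injective hn ((c.definite _ h).trans (map_zero _).symm)

end NormIdentity

/-! ### Extension of a norm-preserving map to Hilbert completions. -/

section Extension

variable {V W : Type*} [AddCommGroup V] [Module ℂ V] [AddCommGroup W] [Module ℂ W]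

theorem norm_toHilbert_sq (c : InnerProductSpace.Core ℂ V) (v : V) :
    ‖toHilbert c v‖ ^ 2 = (c.inner v v).re := by
  have h : ‖toHilbert c v‖ = ‖toWithInner c v‖ :=
    (UniformSpace.Completion.toComplₗᵢ (𝕜 := ℂ) (E := WithInner c)).norm_map _
  rw [h, ← inner_self_eq_norm_sq (𝕜 := ℂ)]
  rfl

theorem denseRange_toHilbert (c : InnerProductSpace.Core ℂ V) : DenseRange (toHilbert c) :=
  UniformSpace.Completion.denseRange_coe (α := WithInner c)

/-- Equality of norms makes the map bounded on a dense subspace, so it extends by continuity.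
Preservation of the norm and uniqueness both follow from agreement of continuous functions on a
dense set. -/
theorem existsUnique_isometry (c₁ : InnerProductSpace.Core ℂ V) (c₂ : InnerProductSpace.Core ℂ W)
    (R : V →ₗ[ℂ] W) (h : ∀ v, c₁.inner v v = c₂.inner (R v) (R v)) :
    ∃! T : HilbertCompletion c₁ →ₗᵢ[ℂ] HilbertCompletion c₂,
      ∀ v, T (toHilbert c₁ v) = toHilbert c₂ (R v) := by
  have hnorm (v : V) : ‖(toHilbert c₂ ∘ₗ R) v‖ = ‖toHilbert c₁ v‖ := by
    rw [← sq_eq_sq₀ (norm_nonneg _) (norm_nonneg _), LinearMap.comp_apply, norm_toHilbert_sq,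
      norm_toHilbert_sq, h]
  have hd := denseRange_toHilbert c₁
  let T := (toHilbert c₂ ∘ₗ R).extendOfNorm (toHilbert c₁)
  have hT (v : V) : T (toHilbert c₁ v) = toHilbert c₂ (R v) :=
    LinearMap.extendOfNorm_eq hd ⟨1, fun v => by rw [hnorm, one_mul]⟩ v
  have hiso (x : HilbertCompletion c₁) : ‖T x‖ = ‖x‖ := by
    refine congrFun (hd.equalizer T.continuous.norm continuous_norm (funext fun v => ?_)) x
    exact (congrArg norm (hT v)).trans (hnorm v)
  refine ⟨⟨T.toLinearMap, hiso⟩, hT, fun S hS => ?_⟩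
  refine DFunLike.ext' (hd.equalizer S.continuous T.continuous (funext fun v => ?_))
  exact (hS v).trans (hT v).symm

end Extension

end MomentumRay

end

theorem mainTheorem8 (n : ℕ) (hn : 2 ≤ n) (s t : ℝ) (ht : -(n : ℝ) / 2 < t) :
    (∀ u : MomentumRay.Triple n, u ≠ 0 →
      0 < MomentumRay.tripleNormSq s t u.1.1 u.2.1.1 u.2.2.1) ∧
    ∃ (hI : ∀ (k : ℕ) (f : MomentumRay.TensorField n),
        MomentumRay.rayTransform k f ∈ MomentumRay.SchwartzTS n)
      (c₁ : InnerProductSpace.Core ℂ (MomentumRay.TensorField n))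
      (c₂ : InnerProductSpace.Core ℂ (MomentumRay.Triple n)),
      (∀ f, c₁.inner f f = (MomentumRay.tensorNormSq s t f : ℂ)) ∧
      (∀ u, c₂.inner u u = (MomentumRay.tripleNormSq s t u.1.1 u.2.1.1 u.2.2.1 : ℂ)) ∧
      ∃! T : MomentumRay.HilbertCompletion c₁ →ₗᵢ[ℂ] MomentumRay.HilbertCompletion c₂,
        ∀ f : MomentumRay.TensorField n,
          T (MomentumRay.toHilbert c₁ f) =
            MomentumRay.toHilbert c₂
              (⟨MomentumRay.rayTransform 0 f, hI 0 f⟩,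
                ⟨MomentumRay.rayTransform 1 f, hI 1 f⟩,
                ⟨MomentumRay.rayTransform 2 f, hI 2 f⟩) := by
  -- The base point serves only to parametrize `T𝕊ⁿ⁻¹`; the norms do not refer to it.
  let ξ₀ : Metric.sphere (0 : MomentumRay.E n) 1 :=
    ⟨EuclideanSpace.single ⟨0, by omega⟩ 1, by simp⟩
  let c₂ := MomentumRay.tripleCore hn ξ₀ s ht
  have hc₂ (u : MomentumRay.Triple n) : c₂.inner u u =
      (MomentumRay.tripleNormSq s t u.1.1 u.2.1.1 u.2.2.1 : ℂ) :=
    MomentumRay.tripleInner_self hn ξ₀ s ht u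
  -- The inner product on tensor fields is the pull-back of the one on triples, so norm preservation
  -- holds by definition. The content lies in the identification of its square norm with
  -- `tensorNormSq`.
  refine ⟨fun u hu => ?_, MomentumRay.rayTransform_mem, MomentumRay.tensorCore hn c₂, c₂,
    fun f => ?_, hc₂, ?_⟩
  · refine (MomentumRay.tripleNormSq_nonneg hn ht u.1.2 u.2.1.2 u.2.2.2 ξ₀).lt_of_ne fun h => hu ?_
    obtain ⟨h1, h2, h3⟩ := MomentumRay.eq_zero_of_tripleNormSq hn ht u.1.2 u.2.1.2 u.2.2.2 ξ₀ h.symm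
    exact Prod.ext (Subtype.ext h1) (Prod.ext (Subtype.ext h2) (Subtype.ext h3))
  · rw [← MomentumRay.tripleNormSq_rayTransform hn ξ₀ s ht f]
    exact hc₂ (MomentumRay.rayTriple n f)
  · exact MomentumRay.existsUnique_isometry _ c₂ (MomentumRay.rayTriple n) fun _ => rfl
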